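/- **Name-restricted $\alpha$Prolog.** Fix a nominal signature: name types $\nu$, each with infinitely many names; data types $\delta$; types $\tau ::= \nu \mid \delta \mid \langle\nu\rangle\tau$; function symbols $f:\tau_1,\dots,\tau_n\to\delta$ (results in data types only); predicate symbols $p:\tau_1,\dots,\tau_n$. Well-typed terms are $t ::= a \mid X \mid f(\vec t) \mid (a\ b)\cdot t \mid \langle a\rangle t$ with $a,b$ names (of equal type in a swapping) and $X$ variables; $\langle a\rangle$ is not a binder. Goals are $$G ::= \top \mid p(\vec t) \mid a\# t \mid t\approx u \mid G\land G' \mid G\lor G' \mid \exists X.G \mid \text{И} a.G,$$ up to renaming of bound variables and bound names, with capture-avoiding substitution. Program clauses are $\text{И}\vec a.\forall\vec X.[p(\vec t)\supset G]$, $\vec a$ distinct, without free variables or free names. On ground (variable-free) terms swappings are carried out, and freshness and equality are given by: $\models a\# b$ if $a\ne b$; $\models a\# f(\vec t)$ if $\models a\# t_i$ for all $i$; $\models a\#\langle a\rangle t$; $\models a\#\langle b\rangle t$ if $a\neq b$ and $\models a\# t$; $\models a\approx a$; $\models f(\vec t)\approx f(\vec u)$ if $\models t_i\approx u_i$ for all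 $i$; $\models\langle a\rangle t\approx\langle a\rangle u$ if $\models t\approx u$; $\models\langle a\rangle t\approx\langle b\rangle u$ if $\models a\# u$ and $\models t\approx(a\ b)\cdot u$. For a set $\Delta$ of program clauses and ground goals (no free variables, free names allowed), provability of $\Delta\Longrightarrow G$ is generated by: $\top$; $a\# t$ if $\models a\# t$; $t\approx u$ if $\models t\approx u$; the usual rules for $\land$ and $\lor$; $\exists X.G$ from $G[t/X]$ for some ground $t$ (with any names); $\text{И}a.G$ from $G$ (the bound name having been renamed so that it is not free in $\text{И}a.G$); and $p(\vec t)$ from $\pi.(G\theta)$ whenever $\text{И}\vec a.\forall\vec X.[p(\vec u)\supset G]\in\Delta$, $\pi$ is a composition of swappings, $\theta$ is a ground substitution for $\vec X$, and $\models t_i\approx\pi.(u_i\theta)$ for all $i$. **The logic $\mathcal G^-$.** Terms are simply typed $\lambda$-terms over constants and nominal constants, taken up to $\beta\eta$-conversion; nominal constants exist only at designated nominal types, infinitely many at each; $\mathrm{supp}$ is the set of nominal constants occurring in the $\beta\eta$-long form. Formulas are $B ::= \top\mid p\,\vec t\mid t=u\mid B\land C\mid B\lor C\mid\exists x.B\mid\nabla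 z.B$ ($z$ of nominal type). Definitional clauses are $\forall\vec x.[(\nabla\vec z.\,p\,\vec u)\triangleq B]$, with head and body of empty support and the free variables of $B$ among $\vec x$. For a set of definitional clauses, provability of $\longrightarrow B$ for closed $B$ is generated by: $\top$; $t=t$; the usual rules for $\land$, $\lor$; $\exists x.B$ from $B[t/x]$ for some closed $t$; $\nabla x.B$ from $B[a/x]$ for some nominal constant $a\notin\mathrm{supp}(B)$; and $p\,\vec t$ from $B\theta$ for a clause as above and a closed substitution $\theta$ for $\vec z,\vec x$ which sends $\vec z$ to distinct nominal constants not in $\mathrm{supp}(\vec x\theta)$ and satisfies $\vec t=\vec u\theta$. **The translation.** Types: $\nu\mapsto\nu$, $\delta\mapsto\delta$, $\langle\nu\rangle\tau\mapsto\nu\to\phi(\tau)$. The base types of $\mathcal G^-$ are the name types, which are the nominal types and whose nominal constants are the names, and the data types; constants are the function symbols; predicate symbols are those of $\alpha$Prolog and a distinguished $\mathit{fresh}$ (at each type $\nu$, $\tau$). Terms: $$\phi(a)=a,\quad \phi(X\,\vec a)=X\,\vec a,\quad \phi((a\ b)\cdot t)=(a\ b)\cdot\phi(t),\quad \phi(f(\vec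 t))=f\,\overrightarrow{\phi(t)},\quad \phi(\langle a\rangle t)=\lambda a.\phi(t),$$ where $(a\ b)\cdot{}$ exchanges the nominal constants $a$ and $b$ in a term, and $\lambda a.t$, $\nabla a.B$ stand for $\lambda x.t[x/a]$, $\nabla x.B[x/a]$ with $x$ fresh. Goals, for a list $\vec a$ of distinct names: $$\begin{aligned}\phi_{\vec a}(\top)&=\top, & \phi_{\vec a}(p\,\vec t)&=\nabla\vec a.\,p\,\overrightarrow{\phi(t)},\\ \phi_{\vec a}(b\# t)&=\nabla\vec a.\,\mathit{fresh}\,\phi(b)\,\phi(t), & \phi_{\vec a}(t\approx u)&=\nabla\vec a.(\phi(t)=\phi(u)),\\ \phi_{\vec a}(G_1\land G_2)&=\phi_{\vec a}(G_1)\land\phi_{\vec a}(G_2), & \phi_{\vec a}(G_1\lor G_2)&=\phi_{\vec a}(G_1)\lor\phi_{\vec a}(G_2),\\ \phi_{\vec a}(\exists X.G)&=\exists X.\phi_{\vec a}(G[X\,\vec a/X]), & \phi_{\vec a}(\text{И}b.G)&=\phi_{\vec a b}(G)\end{aligned}$$ (in the last equation $b$ is renamed so as to be neither in $\vec a$ nor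 free in $\text{И}b.G$). Clauses: with $\sigma=\{X\,\vec a/X\mid X\in\vec X\}$, $$\phi(\text{И}\vec a.\forall\vec X.[p(\vec t)\supset G])=\forall\vec X.[(\nabla\vec a.\,p\,\overrightarrow{\phi(t\sigma)})\triangleq\phi_{\vec a}(G\sigma)],\qquad \phi(\Delta)=\{\phi(D)\mid D\in\Delta\}.$$ **Theorem 2.** Let $\Delta$ be a set of program clauses, $G$ a ground goal, and $\vec a$ a list of distinct names. Assume that every free name of $G$ which acts on a variable is in $\vec a$, that is: whenever $\langle a\rangle t$, $(a\ b)\cdot t$ or $(b\ a)\cdot t$ is a subterm of $G$ in which $t$ contains a variable and $a$ is free in $G$ at this place, then $a$ is in $\vec a$. (This holds, for example, if all free names of $G$ are in $\vec a$, or if $G$ contains no $\exists$.) Then $\Delta\Longrightarrow G$ has a proof in $\alpha$Prolog if and only if $\longrightarrow\phi_{\vec a}(G)$ has a proof in $\mathcal G^-$ with the definitional clauses $\phi(\Delta)$ together with the clause $\forall x.[(\nabla z.\,\mathit{fresh}\,z\,x)\triangleq\top]$ for $\mathit{fresh}$. -/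

import Mathlib

universe u v

namespace NomHO

/-! ### Typed de Bruijn indices -/

/-- `Ix Γ τ` is the type of positions in the list `Γ` at which `τ` stands: a variable of type `τ`
in the context `Γ`. -/
inductive Ix {α : Type u} : List α → α → Type u
  | z {Γ : List α} {τ : α} : Ix (τ :: Γ) τ
  | s {Γ : List α} {σ τ : α} : Ix Γ τ → Ix (σ :: Γ) τ

/-- The empty context has no variables. -/
def Ix.elim {α : Type u} {C : Sort v} {τ : α} : Ix ([] : List α) τ → C := nofun

/-- Extend an assignment on `Γ` by a value for the new variable of `σ :: Γ`. -/
def Ix.cons {α : Type u} {C : α → Type v} {Γ : List α} {σ : α} (t : C σ)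
    (θ : ∀ τ, Ix Γ τ → C τ) : ∀ τ, Ix (σ :: Γ) τ → C τ
  | _, .z => t
  | _, .s i => θ _ i

/-- The position in `Γ.map f` that corresponds to a position in `Γ`. -/
def Ix.map {α : Type u} {β : Type v} (f : α → β) :
    ∀ {Γ : List α} {τ : α}, Ix Γ τ → Ix (Γ.map f) (f τ)
  | _, _, .z => .z
  | _, _, .s i => .s (i.map f)

/-! ### Name-restricted αProlog -/

/-- Types of αProlog: name types, data types, and abstraction types `⟨ν⟩τ`. -/
inductive NTy (N D : Type u) : Type u
  | name (ν : N)
  | data (δ : D)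
  | abs (ν : N) (τ : NTy N D)

/-- A monomorphic nominal signature. Every name type has infinitely many names; function symbols
build elements of data types only, so that name types are inhabited by names only. -/
structure NSig where
  NameTy : Type u
  DataTy : Type u
  Name : NameTy → Type u
  name_infinite : ∀ ν, Infinite (Name ν)
  Fn : Type u
  fnArity : Fn → ℕ
  fnArg : ∀ f : Fn, Fin (fnArity f) → NTy NameTy DataTy
  fnRes : Fn → DataTy
  Pred : Type u
  predArity : Pred → ℕ
  predArg : ∀ p : Pred, Fin (predArity p) → NTy NameTy DataTy

/-- The types over a nominal signature. -/
abbrev NSig.Ty (S : NSig.{u}) : Type u := NTy S.NameTy S.DataTy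

/-- Names of arbitrary name type. -/
abbrev NSig.AnyName (S : NSig.{u}) : Type u := Σ ν : S.NameTy, S.Name ν

/-- Families of permutations of the names, one for each name type. -/
abbrev NSig.NPerm (S : NSig.{u}) : Type u := ∀ ν : S.NameTy, Equiv.Perm (S.Name ν)

open Classical in
/-- The swapping `(a b)`. -/
noncomputable def NSig.swapping (S : NSig.{u}) {ν : S.NameTy} (a b : S.Name ν) : S.NPerm :=
  Pi.mulSingle ν (Equiv.swap a b)

/-- Compositions of zero or more swappings. -/
def NSig.perms (S : NSig.{u}) : Submonoid S.NPerm :=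
  Submonoid.closure {π | ∃ (ν : S.NameTy) (a b : S.Name ν), π = S.swapping a b}

/-- An occurrence of a name: either a free name, or a reference to an enclosing binder `И`. The
list `Λ` holds the types of the names bound by the enclosing binders. -/
inductive Nm (S : NSig.{u}) (Λ : List S.NameTy) (ν : S.NameTy) : Type u
  | free (a : S.Name ν)
  | bound (i : Ix Λ ν)

section Nm

variable {S : NSig.{u}} {Λ Λ' : List S.NameTy}

/-- The free name of a name occurrence, if it is one. -/
def Nm.names {ν : S.NameTy} : Nm S Λ ν → List S.AnyName
  | .free a => [⟨ν, a⟩]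
  | .bound _ => []

/-- Without enclosing binders an occurrence of a name is a name. -/
def Nm.get {ν : S.NameTy} : Nm S [] ν → S.Name ν
  | .free a => a
  | .bound i => nomatch i

/-- Move a name occurrence under one more binder. -/
def Nm.weaken {μ ν : S.NameTy} : Nm S Λ ν → Nm S (μ :: Λ) ν
  | .free a => .free a
  | .bound i => .bound (.s i)

/-- Extend a map of name occurrences so that it fixes one more bound name. -/
def Nm.lift (f : ∀ ν, Nm S Λ ν → Nm S Λ' ν) {μ : S.NameTy} :
    ∀ ν, Nm S (μ :: Λ) ν → Nm S (μ :: Λ') ν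
  | ν, .free a => (f ν (.free a)).weaken
  | _, .bound .z => .bound .z
  | ν, .bound (.s i) => (f ν (.bound i)).weaken

/-- Instantiate the outermost bound name by the name `a`. -/
def Nm.inst {μ : S.NameTy} (a : S.Name μ) : ∀ ν, Nm S (μ :: Λ) ν → Nm S Λ ν
  | _, .free b => .free b
  | _, .bound .z => .free a
  | _, .bound (.s i) => .bound i

/-- Permutations act on free names. -/
def Nm.act (π : S.NPerm) : ∀ ν, Nm S Λ ν → Nm S Λ ν
  | ν, .free a => .free (π ν a)
  | _, .bound i => .bound i

end Nm

/-- Well-typed terms `a | X | f(t⃗) | (a b)·t | ⟨a⟩t` with variables in `Γ`. A name-abstraction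
does not bind. -/
inductive Tm (S : NSig.{u}) (Λ : List S.NameTy) (Γ : List S.Ty) : S.Ty → Type u
  | name {ν : S.NameTy} (a : Nm S Λ ν) : Tm S Λ Γ (.name ν)
  | var {τ : S.Ty} (X : Ix Γ τ) : Tm S Λ Γ τ
  | fn (f : S.Fn) (ts : ∀ i, Tm S Λ Γ (S.fnArg f i)) : Tm S Λ Γ (.data (S.fnRes f))
  | swap {ν : S.NameTy} {τ : S.Ty} (a b : Nm S Λ ν) (t : Tm S Λ Γ τ) : Tm S Λ Γ τ
  | abs {ν : S.NameTy} {τ : S.Ty} (a : Nm S Λ ν) (t : Tm S Λ Γ τ) : Tm S Λ Γ (.abs ν τ)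

section Tm

variable {S : NSig.{u}} {Λ Λ' : List S.NameTy} {Γ Γ' : List S.Ty}

/-- All names that occur free in a term. -/
def Tm.names : ∀ {τ : S.Ty}, Tm S Λ Γ τ → List S.AnyName
  | _, .name a => a.names
  | _, .var _ => []
  | _, .fn _ ts => (List.finRange _).flatMap fun i => (ts i).names
  | _, .swap a b t => a.names ++ b.names ++ t.names
  | _, .abs a t => a.names ++ t.names

/-- The term contains a variable. -/
def Tm.HasVar : ∀ {τ : S.Ty}, Tm S Λ Γ τ → Prop
  | _, .name _ => False
  | _, .var _ => True
  | _, .fn _ ts => ∃ i, (ts i).HasVar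
  | _, .swap _ _ t => t.HasVar
  | _, .abs _ t => t.HasVar

/-- The free name `c` is used in a swapping or a name-abstraction of a term with a variable. -/
def Tm.ActsOnVar (c : S.AnyName) : ∀ {τ : S.Ty}, Tm S Λ Γ τ → Prop
  | _, .name _ => False
  | _, .var _ => False
  | _, .fn _ ts => ∃ i, (ts i).ActsOnVar c
  | _, .swap a b t => ((c ∈ a.names ∨ c ∈ b.names) ∧ t.HasVar) ∨ t.ActsOnVar c
  | _, .abs a t => (c ∈ a.names ∧ t.HasVar) ∨ t.ActsOnVar c

/-- Apply a map to all occurrences of names. -/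
def Tm.mapName (f : ∀ ν, Nm S Λ ν → Nm S Λ' ν) : ∀ {τ : S.Ty}, Tm S Λ Γ τ → Tm S Λ' Γ τ
  | _, .name a => .name (f _ a)
  | _, .var X => .var X
  | _, .fn g ts => .fn g fun i => (ts i).mapName f
  | _, .swap a b t => .swap (f _ a) (f _ b) (t.mapName f)
  | _, .abs a t => .abs (f _ a) (t.mapName f)

/-- Simultaneous substitution for variables; name-abstractions may capture. -/
def Tm.subst (θ : ∀ τ, Ix Γ τ → Tm S Λ Γ' τ) : ∀ {τ : S.Ty}, Tm S Λ Γ τ → Tm S Λ Γ' τ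
  | _, .name a => .name a
  | _, .var X => θ _ X
  | _, .fn g ts => .fn g fun i => (ts i).subst θ
  | _, .swap a b t => .swap a b (t.subst θ)
  | _, .abs a t => .abs a (t.subst θ)

/-- The substitution under one more variable binder. -/
def Tm.liftSub (θ : ∀ τ, Ix Γ τ → Tm S Λ Γ' τ) {σ : S.Ty} :
    ∀ τ, Ix (σ :: Γ) τ → Tm S Λ (σ :: Γ') τ :=
  Ix.cons (.var .z) fun τ i => (θ τ i).subst fun _ j => .var (.s j)

/-- The effect of a permutation on a term. -/
def Tm.act (π : S.NPerm) {τ : S.Ty} (t : Tm S Λ Γ τ) : Tm S Λ Γ τ := t.mapName (Nm.act π)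

end Tm

/-- Ground nominal terms in which all swappings have been carried out. -/
inductive Val (S : NSig.{u}) : S.Ty → Type u
  | name {ν : S.NameTy} (a : S.Name ν) : Val S (.name ν)
  | fn (f : S.Fn) (ts : ∀ i, Val S (S.fnArg f i)) : Val S (.data (S.fnRes f))
  | abs {ν : S.NameTy} {τ : S.Ty} (a : S.Name ν) (t : Val S τ) : Val S (.abs ν τ)

section Val

variable {S : NSig.{u}}

/-- Permutations of names act on ground nominal terms. -/
def Val.act (π : S.NPerm) : ∀ {τ : S.Ty}, Val S τ → Val S τ
  | _, .name a => .name (π _ a)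
  | _, .fn f ts => .fn f fun i => (ts i).act π
  | _, .abs a t => .abs (π _ a) (t.act π)

/-- Freshness `⊨ a # t`. -/
inductive Val.Fresh (a : S.AnyName) : ∀ {τ : S.Ty}, Val S τ → Prop
  | name {ν : S.NameTy} {b : S.Name ν} (h : a ≠ ⟨ν, b⟩) : Val.Fresh a (.name b)
  | fn {f : S.Fn} {ts : ∀ i, Val S (S.fnArg f i)} (h : ∀ i, Val.Fresh a (ts i)) :
      Val.Fresh a (.fn f ts)
  | abs_same {ν : S.NameTy} {τ : S.Ty} {b : S.Name ν} {t : Val S τ} (h : a = ⟨ν, b⟩) :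
      Val.Fresh a (.abs b t)
  | abs {ν : S.NameTy} {τ : S.Ty} {b : S.Name ν} {t : Val S τ} (h : a ≠ ⟨ν, b⟩)
      (ht : Val.Fresh a t) : Val.Fresh a (.abs b t)

/-- Equality `⊨ t ≈ u`. -/
inductive Val.Eqv : ∀ {τ : S.Ty}, Val S τ → Val S τ → Prop
  | name {ν : S.NameTy} (a : S.Name ν) : Val.Eqv (.name a) (.name a)
  | fn {f : S.Fn} {ts us : ∀ i, Val S (S.fnArg f i)} (h : ∀ i, Val.Eqv (ts i) (us i)) :
      Val.Eqv (.fn f ts) (.fn f us)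
  | abs_same {ν : S.NameTy} {τ : S.Ty} (a : S.Name ν) {t u : Val S τ} (h : Val.Eqv t u) :
      Val.Eqv (.abs a t) (.abs a u)
  | abs {ν : S.NameTy} {τ : S.Ty} {a b : S.Name ν} {t u : Val S τ} (hf : Val.Fresh ⟨ν, a⟩ u)
      (h : Val.Eqv t (u.act (S.swapping a b))) : Val.Eqv (.abs a t) (.abs b u)

/-- Carry out the swappings in a ground term. -/
noncomputable def Tm.eval : ∀ {τ : S.Ty}, Tm S [] [] τ → Val S τ
  | _, .name a => .name a.get
  | _, .var X => nomatch X
  | _, .fn f ts => .fn f fun i => (ts i).eval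
  | _, .swap a b t => t.eval.act (S.swapping a.get b.get)
  | _, .abs a t => .abs a.get t.eval

end Val

/-- Goals. `ex` binds a variable and `new` (that is, `И`) binds a name. -/
inductive Goal (S : NSig.{u}) : List S.NameTy → List S.Ty → Type u
  | top {Λ : List S.NameTy} {Γ : List S.Ty} : Goal S Λ Γ
  | atom {Λ : List S.NameTy} {Γ : List S.Ty} (p : S.Pred)
      (ts : ∀ i, Tm S Λ Γ (S.predArg p i)) : Goal S Λ Γ
  | fresh {Λ : List S.NameTy} {Γ : List S.Ty} {ν : S.NameTy} {τ : S.Ty} (a : Nm S Λ ν)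
      (t : Tm S Λ Γ τ) : Goal S Λ Γ
  | eq {Λ : List S.NameTy} {Γ : List S.Ty} {τ : S.Ty} (t u : Tm S Λ Γ τ) : Goal S Λ Γ
  | and {Λ : List S.NameTy} {Γ : List S.Ty} (G H : Goal S Λ Γ) : Goal S Λ Γ
  | or {Λ : List S.NameTy} {Γ : List S.Ty} (G H : Goal S Λ Γ) : Goal S Λ Γ
  | ex {Λ : List S.NameTy} {Γ : List S.Ty} {τ : S.Ty} (G : Goal S Λ (τ :: Γ)) : Goal S Λ Γ
  | new {Λ : List S.NameTy} {Γ : List S.Ty} {ν : S.NameTy} (G : Goal S (ν :: Λ) Γ) : Goal S Λ Γ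

section Goal

variable {S : NSig.{u}}

/-- All names that occur free in a goal. -/
def Goal.names : ∀ {Λ : List S.NameTy} {Γ : List S.Ty}, Goal S Λ Γ → List S.AnyName
  | _, _, .top => []
  | _, _, .atom _ ts => (List.finRange _).flatMap fun i => (ts i).names
  | _, _, .fresh a t => a.names ++ t.names
  | _, _, .eq t u => t.names ++ u.names
  | _, _, .and G H => G.names ++ H.names
  | _, _, .or G H => G.names ++ H.names
  | _, _, .ex G => G.names
  | _, _, .new G => G.names

/-- `a` acts on a variable in `G`: some subterm `⟨a⟩t`, `(a b)·t` or `(b a)·t` of `G` with a free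
occurrence of `a` is such that `t` contains a variable. -/
def Goal.ActsOnVar (c : S.AnyName) :
    ∀ {Λ : List S.NameTy} {Γ : List S.Ty}, Goal S Λ Γ → Prop
  | _, _, .top => False
  | _, _, .atom _ ts => ∃ i, (ts i).ActsOnVar c
  | _, _, .fresh _ t => t.ActsOnVar c
  | _, _, .eq t u => t.ActsOnVar c ∨ u.ActsOnVar c
  | _, _, .and G H => G.ActsOnVar c ∨ H.ActsOnVar c
  | _, _, .or G H => G.ActsOnVar c ∨ H.ActsOnVar c
  | _, _, .ex G => G.ActsOnVar c
  | _, _, .new G => G.ActsOnVar c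

/-- Apply a map to all occurrences of names that are not bound within the goal. -/
def Goal.mapName : ∀ {Λ Λ' : List S.NameTy} {Γ : List S.Ty},
    (∀ ν, Nm S Λ ν → Nm S Λ' ν) → Goal S Λ Γ → Goal S Λ' Γ
  | _, _, _, _, .top => .top
  | _, _, _, f, .atom p ts => .atom p fun i => (ts i).mapName f
  | _, _, _, f, .fresh a t => .fresh (f _ a) (t.mapName f)
  | _, _, _, f, .eq t u => .eq (t.mapName f) (u.mapName f)
  | _, _, _, f, .and G H => .and (G.mapName f) (H.mapName f)
  | _, _, _, f, .or G H => .or (G.mapName f) (H.mapName f)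
  | _, _, _, f, .ex G => .ex (G.mapName f)
  | _, _, _, f, .new G => .new (G.mapName (Nm.lift f))

/-- Capture-avoiding simultaneous substitution for variables. -/
def Goal.subst : ∀ {Λ : List S.NameTy} {Γ Γ' : List S.Ty},
    (∀ τ, Ix Γ τ → Tm S Λ Γ' τ) → Goal S Λ Γ → Goal S Λ Γ'
  | _, _, _, _, .top => .top
  | _, _, _, θ, .atom p ts => .atom p fun i => (ts i).subst θ
  | _, _, _, θ, .fresh a t => .fresh a (t.subst θ)
  | _, _, _, θ, .eq t u => .eq (t.subst θ) (u.subst θ)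
  | _, _, _, θ, .and G H => .and (G.subst θ) (H.subst θ)
  | _, _, _, θ, .or G H => .or (G.subst θ) (H.subst θ)
  | _, _, _, θ, .ex G => .ex (G.subst (Tm.liftSub θ))
  | _, _, _, θ, .new G => .new (G.subst fun τ i => (θ τ i).mapName fun _ => Nm.weaken)

/-- The effect of a permutation on a goal. -/
def Goal.act (π : S.NPerm) {Λ : List S.NameTy} {Γ : List S.Ty} (G : Goal S Λ Γ) : Goal S Λ Γ :=
  G.mapName (Nm.act π)

/-- `G[t/X]` for the outermost variable `X` of a goal. -/
def Goal.inst {Λ : List S.NameTy} {Γ : List S.Ty} {σ : S.Ty} (G : Goal S Λ (σ :: Γ))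
    (t : Tm S Λ Γ σ) : Goal S Λ Γ :=
  G.subst (Ix.cons t fun _ i => .var i)

/-- Replace the outermost bound name of a goal by the name `a`. -/
def Goal.instName {Λ : List S.NameTy} {Γ : List S.Ty} {ν : S.NameTy} (G : Goal S (ν :: Λ) Γ)
    (a : S.Name ν) : Goal S Λ Γ :=
  G.mapName (Nm.inst a)

end Goal

/-- A well-formed program clause `Иa⃗.∀X⃗.[p(t⃗) ⊃ G]`: no free variables and no free names. -/
structure NClause (S : NSig.{u}) where
  bnames : List S.AnyName
  nodup : bnames.Nodup
  vars : List S.Ty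
  pred : S.Pred
  args : ∀ i, Tm S [] vars (S.predArg pred i)
  body : Goal S [] vars
  args_closed : ∀ i, (args i).names ⊆ bnames
  body_closed : body.names ⊆ bnames

/-- `NProv Δ G`: the sequent `Δ ⟹ G` has a proof in αProlog. In `new`, the bound name is first
renamed to a name that is not free in the goal. -/
inductive NProv {S : NSig.{u}} (Δ : Set (NClause S)) : Goal S [] [] → Prop
  | top : NProv Δ .top
  | fresh {ν : S.NameTy} {τ : S.Ty} {a : Nm S [] ν} {t : Tm S [] [] τ}
      (h : Val.Fresh ⟨ν, a.get⟩ t.eval) : NProv Δ (.fresh a t)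
  | eq {τ : S.Ty} {t u : Tm S [] [] τ} (h : Val.Eqv t.eval u.eval) : NProv Δ (.eq t u)
  | and {G H : Goal S [] []} (hG : NProv Δ G) (hH : NProv Δ H) : NProv Δ (.and G H)
  | or_left {G H : Goal S [] []} (h : NProv Δ G) : NProv Δ (.or G H)
  | or_right {G H : Goal S [] []} (h : NProv Δ H) : NProv Δ (.or G H)
  | ex {τ : S.Ty} {G : Goal S [] [τ]} (t : Tm S [] [] τ) (h : NProv Δ (G.inst t)) :
      NProv Δ (.ex G)
  | new {ν : S.NameTy} {G : Goal S [ν] []} (a : S.Name ν)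
      (ha : (⟨ν, a⟩ : S.AnyName) ∉ G.names) (h : NProv Δ (G.instName a)) : NProv Δ (.new G)
  | backchain (D : NClause S) (hD : D ∈ Δ) (π : S.NPerm) (hπ : π ∈ S.perms)
      (θ : ∀ τ, Ix D.vars τ → Tm S [] [] τ) {ts : ∀ i, Tm S [] [] (S.predArg D.pred i)}
      (hts : ∀ i, Val.Eqv (ts i).eval (((D.args i).subst θ).act π).eval)
      (h : NProv Δ ((D.body.subst θ).act π)) : NProv Δ (.atom D.pred ts)

/-! ### The logic `𝒢⁻` -/

/-- Simple types over a set of base types (the type of formulas is kept apart). -/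
inductive STy (B : Type u) : Type u
  | base (b : B)
  | arr (σ τ : STy B)

/-- The type `σ₁ → ⋯ → σₙ → τ`. -/
def STy.arrows {B : Type u} : ∀ {n : ℕ}, (Fin n → STy B) → STy B → STy B
  | 0, _, τ => τ
  | _ + 1, σ, τ => .arr (σ 0) (STy.arrows (fun i => σ i.succ) τ)

/-- A signature for `𝒢⁻`: base types, designated nominal types with infinitely many nominal
constants each, constants, and predicate symbols. -/
structure HSig where
  Base : Type u
  NomIx : Type u
  nomTy : NomIx → STy Base
  nomTy_injective : Function.Injective nomTy
  Nom : NomIx → Type u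
  nom_infinite : ∀ ν, Infinite (Nom ν)
  Con : Type u
  conTy : Con → STy Base
  Pred : Type u
  predArity : Pred → ℕ
  predArg : ∀ p : Pred, Fin (predArity p) → STy Base

/-- The types over a signature. -/
abbrev HSig.Ty (L : HSig.{u}) : Type u := STy L.Base

/-- Nominal constants of arbitrary nominal type. -/
abbrev HSig.AnyNom (L : HSig.{u}) : Type u := Σ ν : L.NomIx, L.Nom ν

/-- Simply typed λ-terms with constants and nominal constants. -/
inductive HTm (L : HSig.{u}) : List L.Ty → L.Ty → Type u
  | var {Γ : List L.Ty} {τ : L.Ty} (x : Ix Γ τ) : HTm L Γ τ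
  | con {Γ : List L.Ty} (c : L.Con) : HTm L Γ (L.conTy c)
  | nom {Γ : List L.Ty} {ν : L.NomIx} (a : L.Nom ν) : HTm L Γ (L.nomTy ν)
  | app {Γ : List L.Ty} {σ τ : L.Ty} (t : HTm L Γ (.arr σ τ)) (u : HTm L Γ σ) : HTm L Γ τ
  | lam {Γ : List L.Ty} {σ τ : L.Ty} (t : HTm L (σ :: Γ) τ) : HTm L Γ (.arr σ τ)

section HTm

variable {L : HSig.{u}}

/-- Renamings under a binder. -/
def liftRen {Γ Γ' : List L.Ty} (r : ∀ τ, Ix Γ τ → Ix Γ' τ) {σ : L.Ty} :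
    ∀ τ, Ix (σ :: Γ) τ → Ix (σ :: Γ') τ :=
  Ix.cons .z fun τ i => .s (r τ i)

/-- Renaming of variables. -/
def HTm.rename : ∀ {Γ Γ' : List L.Ty} {τ : L.Ty}, (∀ τ, Ix Γ τ → Ix Γ' τ) → HTm L Γ τ → HTm L Γ' τ
  | _, _, _, r, .var x => .var (r _ x)
  | _, _, _, _, .con c => .con c
  | _, _, _, _, .nom a => .nom a
  | _, _, _, r, .app t u => .app (t.rename r) (u.rename r)
  | _, _, _, r, .lam t => .lam (t.rename (liftRen r))

/-- Weakening by one variable. -/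
def HTm.weaken {Γ : List L.Ty} {σ τ : L.Ty} (t : HTm L Γ τ) : HTm L (σ :: Γ) τ :=
  t.rename fun _ i => .s i

/-- Substitutions under a binder. -/
def HTm.liftSub {Γ Γ' : List L.Ty} (θ : ∀ τ, Ix Γ τ → HTm L Γ' τ) {σ : L.Ty} :
    ∀ τ, Ix (σ :: Γ) τ → HTm L (σ :: Γ') τ :=
  Ix.cons (.var .z) fun τ i => (θ τ i).weaken

/-- Capture-avoiding simultaneous replacement of the variables according to `θ` and of the nominal
constants according to `n`. -/
def HTm.bind : ∀ {Γ Γ' : List L.Ty} {τ : L.Ty}, (∀ τ, Ix Γ τ → HTm L Γ' τ) →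
    (∀ ν, L.Nom ν → HTm L Γ' (L.nomTy ν)) → HTm L Γ τ → HTm L Γ' τ
  | _, _, _, θ, _, .var x => θ _ x
  | _, _, _, _, _, .con c => .con c
  | _, _, _, _, n, .nom a => n _ a
  | _, _, _, θ, n, .app t u => .app (t.bind θ n) (u.bind θ n)
  | _, _, _, θ, n, .lam t => .lam (t.bind (HTm.liftSub θ) fun ν a => (n ν a).weaken)

/-- Capture-avoiding simultaneous substitution for variables. -/
def HTm.subst {Γ Γ' : List L.Ty} {τ : L.Ty} (θ : ∀ τ, Ix Γ τ → HTm L Γ' τ) (t : HTm L Γ τ) :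
    HTm L Γ' τ :=
  t.bind θ fun _ a => .nom a

/-- `t[u/x]` for the outermost variable `x`. -/
def HTm.inst {Γ : List L.Ty} {σ τ : L.Ty} (t : HTm L (σ :: Γ) τ) (u : HTm L Γ σ) : HTm L Γ τ :=
  t.subst (Ix.cons u fun _ i => .var i)

/-- λ-conversion: the congruence generated by β and η. -/
inductive HTm.Conv : ∀ {Γ : List L.Ty} {τ : L.Ty}, HTm L Γ τ → HTm L Γ τ → Prop
  | refl {Γ : List L.Ty} {τ : L.Ty} (t : HTm L Γ τ) : HTm.Conv t t
  | symm {Γ : List L.Ty} {τ : L.Ty} {t u : HTm L Γ τ} (h : HTm.Conv t u) : HTm.Conv u t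
  | trans {Γ : List L.Ty} {τ : L.Ty} {t u v : HTm L Γ τ} (h : HTm.Conv t u)
      (h' : HTm.Conv u v) : HTm.Conv t v
  | app {Γ : List L.Ty} {σ τ : L.Ty} {t t' : HTm L Γ (.arr σ τ)} {u u' : HTm L Γ σ}
      (h : HTm.Conv t t') (h' : HTm.Conv u u') : HTm.Conv (.app t u) (.app t' u')
  | lam {Γ : List L.Ty} {σ τ : L.Ty} {t t' : HTm L (σ :: Γ) τ} (h : HTm.Conv t t') :
      HTm.Conv (.lam t) (.lam t')
  | beta {Γ : List L.Ty} {σ τ : L.Ty} (t : HTm L (σ :: Γ) τ) (u : HTm L Γ σ) :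
      HTm.Conv (.app (.lam t) u) (t.inst u)
  | eta {Γ : List L.Ty} {σ τ : L.Ty} (t : HTm L Γ (.arr σ τ)) :
      HTm.Conv (.lam (.app t.weaken (.var .z))) t

/-- The nominal constants that are written in a λ-term. -/
def HTm.noms : ∀ {Γ : List L.Ty} {τ : L.Ty}, HTm L Γ τ → Set L.AnyNom
  | _, _, .var _ => ∅
  | _, _, .con _ => ∅
  | _, _, .nom a => {⟨_, a⟩}
  | _, _, .app t u => t.noms ∪ u.noms
  | _, _, .lam t => t.noms

/-- The support of a term. As terms are compared up to λ-conversion, it consists of the nominal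
constants that occur in all terms convertible to it; these are the ones in its βη-long form. -/
def HTm.supp {Γ : List L.Ty} {τ : L.Ty} (t : HTm L Γ τ) : Set L.AnyNom :=
  {a | ∀ u, HTm.Conv t u → a ∈ u.noms}

open Classical in
/-- The renaming of nominal constants to terms that sends `a` to the outermost variable. -/
noncomputable def absMap (L : HSig.{u}) (a : L.AnyNom) (Γ : List L.Ty) :
    ∀ ν, L.Nom ν → HTm L (L.nomTy a.1 :: Γ) (L.nomTy ν) :=
  Function.update (fun _ b => .nom b) a.1 (Function.update (fun b => .nom b) a.2 (.var .z))

/-- Replace the nominal constant `a` by a new outermost variable: the body of `λa.t`. -/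
noncomputable def HTm.absNom {Γ : List L.Ty} {τ : L.Ty} (a : L.AnyNom) (t : HTm L Γ τ) :
    HTm L (L.nomTy a.1 :: Γ) τ :=
  t.bind (fun _ i => .var (.s i)) (absMap L a Γ)

end HTm

/-- Formulas of `𝒢⁻`. -/
inductive HFm (L : HSig.{u}) : List L.Ty → Type u
  | top {Γ : List L.Ty} : HFm L Γ
  | atom {Γ : List L.Ty} (p : L.Pred) (ts : ∀ i, HTm L Γ (L.predArg p i)) : HFm L Γ
  | eq {Γ : List L.Ty} {τ : L.Ty} (t u : HTm L Γ τ) : HFm L Γ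
  | and {Γ : List L.Ty} (B C : HFm L Γ) : HFm L Γ
  | or {Γ : List L.Ty} (B C : HFm L Γ) : HFm L Γ
  | ex {Γ : List L.Ty} {τ : L.Ty} (B : HFm L (τ :: Γ)) : HFm L Γ
  | nabla {Γ : List L.Ty} {ν : L.NomIx} (B : HFm L (L.nomTy ν :: Γ)) : HFm L Γ

section HFm

variable {L : HSig.{u}}

/-- Capture-avoiding simultaneous replacement of variables and nominal constants. -/
def HFm.bind : ∀ {Γ Γ' : List L.Ty}, (∀ τ, Ix Γ τ → HTm L Γ' τ) →
    (∀ ν, L.Nom ν → HTm L Γ' (L.nomTy ν)) → HFm L Γ → HFm L Γ'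
  | _, _, _, _, .top => .top
  | _, _, θ, n, .atom p ts => .atom p fun i => (ts i).bind θ n
  | _, _, θ, n, .eq t u => .eq (t.bind θ n) (u.bind θ n)
  | _, _, θ, n, .and B C => .and (B.bind θ n) (C.bind θ n)
  | _, _, θ, n, .or B C => .or (B.bind θ n) (C.bind θ n)
  | _, _, θ, n, .ex B => .ex (B.bind (HTm.liftSub θ) fun ν a => (n ν a).weaken)
  | _, _, θ, n, .nabla B => .nabla (B.bind (HTm.liftSub θ) fun ν a => (n ν a).weaken)

/-- Capture-avoiding simultaneous substitution for variables. -/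
def HFm.subst {Γ Γ' : List L.Ty} (θ : ∀ τ, Ix Γ τ → HTm L Γ' τ) (B : HFm L Γ) : HFm L Γ' :=
  B.bind θ fun _ a => .nom a

/-- `B[t/x]` for the outermost variable `x`. -/
def HFm.inst {Γ : List L.Ty} {σ : L.Ty} (B : HFm L (σ :: Γ)) (t : HTm L Γ σ) : HFm L Γ :=
  B.subst (Ix.cons t fun _ i => .var i)

/-- The support of a formula. -/
def HFm.supp : ∀ {Γ : List L.Ty}, HFm L Γ → Set L.AnyNom
  | _, .top => ∅
  | _, .atom _ ts => ⋃ i, (ts i).supp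
  | _, .eq t u => t.supp ∪ u.supp
  | _, .and B C => B.supp ∪ C.supp
  | _, .or B C => B.supp ∪ C.supp
  | _, .ex B => B.supp
  | _, .nabla B => B.supp

/-- `∇a.B` for a nominal constant `a`: the formula `∇x.B[x/a]`. -/
noncomputable def HFm.nablaNom {Γ : List L.Ty} (a : L.AnyNom) (B : HFm L Γ) : HFm L Γ :=
  .nabla (ν := a.1) (B.bind (fun _ i => .var (.s i)) (absMap L a Γ))

/-- `∇a₁.⋯∇aₙ.B` for nominal constants `a₁, …, aₙ`. -/
noncomputable def HFm.nablas {Γ : List L.Ty} : List L.AnyNom → HFm L Γ → HFm L Γ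
  | [], B => B
  | a :: as, B => (HFm.nablas as B).nablaNom a

end HFm

/-- The context of the variables `z⃗` (of nominal types) and `x⃗`. -/
abbrev headCtx (L : HSig.{u}) (zs : List L.NomIx) (xs : List L.Ty) : List L.Ty :=
  zs.map L.nomTy ++ xs

/-- A definitional clause `∀x⃗.[(∇z⃗.p t⃗) ≜ B]`, where head and body have empty support, the free
variables of `t⃗` are among `z⃗, x⃗`, and those of `B` are among `x⃗`. -/
structure HClause (L : HSig.{u}) where
  xs : List L.Ty
  zs : List L.NomIx
  pred : L.Pred
  args : ∀ i, HTm L (headCtx L zs xs) (L.predArg pred i)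
  body : HFm L xs
  args_supp : ∀ i, (args i).supp = ∅
  body_supp : body.supp = ∅

/-- The closed substitution for `z⃗` and `x⃗` that is given by nominal constants `ζ` for `z⃗` and
terms `θ` for `x⃗`. -/
def headSub {L : HSig.{u}} {xs : List L.Ty} (θ : ∀ τ, Ix xs τ → HTm L [] τ) :
    ∀ (zs : List L.NomIx), (∀ ν, Ix zs ν → L.Nom ν) → ∀ τ, Ix (headCtx L zs xs) τ → HTm L [] τ
  | [], _ => θ
  | ν :: zs, ζ => Ix.cons (.nom (ζ ν .z)) (headSub θ zs fun ν' i => ζ ν' (.s i))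

/-- `HProv 𝒟 B`: the sequent `⟶ B` has a proof in `𝒢⁻` with the definitional clauses `𝒟`. -/
inductive HProv {L : HSig.{u}} (𝒟 : Set (HClause L)) : HFm L [] → Prop
  | top : HProv 𝒟 .top
  | eq {τ : L.Ty} {t u : HTm L [] τ} (h : HTm.Conv t u) : HProv 𝒟 (.eq t u)
  | and {B C : HFm L []} (hB : HProv 𝒟 B) (hC : HProv 𝒟 C) : HProv 𝒟 (.and B C)
  | or_left {B C : HFm L []} (h : HProv 𝒟 B) : HProv 𝒟 (.or B C)
  | or_right {B C : HFm L []} (h : HProv 𝒟 C) : HProv 𝒟 (.or B C)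
  | ex {τ : L.Ty} {B : HFm L [τ]} (t : HTm L [] τ) (h : HProv 𝒟 (B.inst t)) : HProv 𝒟 (.ex B)
  | nabla {ν : L.NomIx} {B : HFm L [L.nomTy ν]} (a : L.Nom ν)
      (ha : (⟨ν, a⟩ : L.AnyNom) ∉ B.supp) (h : HProv 𝒟 (B.inst (.nom a))) : HProv 𝒟 (.nabla B)
  | defn (D : HClause L) (hD : D ∈ 𝒟) (θ : ∀ τ, Ix D.xs τ → HTm L [] τ)
      (ζ : ∀ ν, Ix D.zs ν → L.Nom ν) (hζ : ∀ ν, Function.Injective (ζ ν))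
      (hsupp : ∀ τ (x : Ix D.xs τ) ν (z : Ix D.zs ν), (⟨ν, ζ ν z⟩ : L.AnyNom) ∉ (θ τ x).supp)
      {ts : ∀ i, HTm L [] (L.predArg D.pred i)}
      (hts : ∀ i, HTm.Conv (ts i) ((D.args i).subst (headSub θ D.zs ζ)))
      (h : HProv 𝒟 (D.body.subst θ)) : HProv 𝒟 (.atom D.pred ts)

/-! ### The translation -/

/-- Translation of types: `⟨ν⟩τ` becomes `ν → τ`. -/
def trTy {N D : Type u} : NTy N D → STy (N ⊕ D)
  | .name ν => .base (.inl ν)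
  | .data δ => .base (.inr δ)
  | .abs ν τ => .arr (.base (.inl ν)) (trTy τ)

/-- The target signature. Its base types are the name types, which are the nominal types, and the
data types; nominal constants are the names; constants are the function symbols; predicate symbols
are those of the source and the distinguished predicates `fresh`, one for each name type and each
type. -/
@[reducible] def NSig.target (S : NSig.{u}) : HSig.{u} where
  Base := S.NameTy ⊕ S.DataTy
  NomIx := S.NameTy
  nomTy ν := .base (.inl ν)
  nomTy_injective := fun _ _ h => Sum.inl_injective (STy.base.inj h)
  Nom := S.Name
  nom_infinite := S.name_infinite
  Con := S.Fn
  conTy f := STy.arrows (fun i => trTy (S.fnArg f i)) (.base (.inr (S.fnRes f)))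
  Pred := S.Pred ⊕ (S.NameTy × STy (S.NameTy ⊕ S.DataTy))
  predArity
    | .inl p => S.predArity p
    | .inr _ => 2
  predArg
    | .inl p => fun i => trTy (S.predArg p i)
    | .inr (ν, τ) => ![.base (.inl ν), τ]

section Translation

variable {S : NSig.{u}}

/-- The application `t u₁ ⋯ uₙ`. -/
def HTm.apps {L : HSig.{u}} {Γ : List L.Ty} {τ : L.Ty} : ∀ {n : ℕ} {σ : Fin n → L.Ty},
    HTm L Γ (STy.arrows σ τ) → (∀ i, HTm L Γ (σ i)) → HTm L Γ τ
  | 0, _, t, _ => t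
  | _ + 1, _, t, us => HTm.apps (.app t (us 0)) fun i => us i.succ

/-- The type of a variable of type `τ` that is raised over the nominal constants `a⃗`. -/
def raiseTy {L : HSig.{u}} : List L.AnyNom → L.Ty → L.Ty
  | [], τ => τ
  | a :: as, τ => .arr (L.nomTy a.1) (raiseTy as τ)

/-- The application `t a⃗` to nominal constants. -/
def HTm.appNoms {L : HSig.{u}} {Γ : List L.Ty} {τ : L.Ty} :
    ∀ as : List L.AnyNom, HTm L Γ (raiseTy as τ) → HTm L Γ τ
  | [], t => t
  | a :: as, t => HTm.appNoms as (.app t (.nom a.2))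

/-- The swapping of two nominal constants in a term. -/
noncomputable def HTm.swapNom {Γ : List S.target.Ty} {τ : S.target.Ty} {ν : S.NameTy}
    (a b : S.Name ν) (t : HTm S.target Γ τ) : HTm S.target Γ τ :=
  t.bind (fun _ i => .var i) fun ν' c => .nom (ν := ν') (S.swapping a b ν' c)

/-- Replace the nominal constants `a⃗` by new outermost variables. -/
noncomputable def HTm.absNoms {L : HSig.{u}} {Γ : List L.Ty} {τ : L.Ty} :
    ∀ as : List L.AnyNom, HTm L Γ τ → HTm L (headCtx L (as.map Sigma.fst) Γ) τ
  | [], t => t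
  | a :: as, t => (HTm.absNoms as t).absNom a

/-- Translation of terms. The environment `η` gives the names that stand for the bound names, and
`ρ` gives the raised variables that have been substituted for the variables. -/
noncomputable def trTm {Λ : List S.NameTy} {Γ : List S.Ty} {Γ' : List S.target.Ty}
    (η : ∀ ν, Nm S Λ ν → S.Name ν) (ρ : ∀ τ, Ix Γ τ → HTm S.target Γ' (trTy τ)) :
    ∀ {τ : S.Ty}, Tm S Λ Γ τ → HTm S.target Γ' (trTy τ)
  | _, .name a => .nom (L := S.target) (η _ a)
  | _, .var X => ρ _ X
  | _, .fn f ts => HTm.apps (.con (L := S.target) f) fun i => trTm η ρ (ts i)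
  | _, .swap a b t => HTm.swapNom (η _ a) (η _ b) (trTm η ρ t)
  | _, .abs (ν := ν) a t => .lam (HTm.absNom (L := S.target) ⟨ν, η ν a⟩ (trTm η ρ t))

/-- The environment for names under a binder whose bound name is represented by `b`. -/
def nmEnv {Λ : List S.NameTy} (η : ∀ ν, Nm S Λ ν → S.Name ν) {μ : S.NameTy} (b : S.Name μ) :
    ∀ ν, Nm S (μ :: Λ) ν → S.Name ν
  | ν, .free a => η ν (.free a)
  | _, .bound .z => b
  | ν, .bound (.s i) => η ν (.bound i)

theorem NSig.exists_fresh (S : NSig.{u}) (ν : S.NameTy) (l : List S.AnyName) :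
    ∃ b : S.Name ν, (⟨ν, b⟩ : S.AnyName) ∉ l := by
  have := S.name_infinite ν
  by_contra! h
  have hfin : (Set.range fun b : S.Name ν => (⟨ν, b⟩ : S.AnyName)).Finite :=
    (List.finite_toSet l).subset (by rintro _ ⟨b, rfl⟩; exact h b)
  exact Set.infinite_range_of_injective sigma_mk_injective hfin

/-- A name of type `ν` outside the list `l`. -/
noncomputable def NSig.freshName (S : NSig.{u}) (ν : S.NameTy) (l : List S.AnyName) : S.Name ν :=
  (S.exists_fresh ν l).choose

/-- The translation `φ_{a⃗}` of goals. For `new`, the bound name is represented by a name `b` that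
is neither in `a⃗` nor free in the goal; the choice does not matter, since `b` ends up bound. -/
noncomputable def trGoal : ∀ {Λ : List S.NameTy} {Γ : List S.Ty} {Γ' : List S.target.Ty},
    List S.AnyName → (∀ ν, Nm S Λ ν → S.Name ν) →
    (∀ τ, Ix Γ τ → HTm S.target Γ' (trTy τ)) → Goal S Λ Γ → HFm S.target Γ'
  | _, _, _, _, _, _, .top => .top
  | _, _, _, as, η, ρ, .atom p ts =>
      HFm.nablas (L := S.target) as (.atom (L := S.target) (.inl p) fun i => trTm η ρ (ts i))
  | _, _, _, as, η, ρ, .fresh (ν := ν) (τ := τ) a t =>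
      HFm.nablas (L := S.target) as (.atom (L := S.target) (.inr (ν, trTy τ))
        (Fin.cons (HTm.nom (L := S.target) (η ν a)) (Fin.cons (trTm η ρ t) finZeroElim)))
  | _, _, _, as, η, ρ, .eq t u =>
      HFm.nablas (L := S.target) as (.eq (trTm η ρ t) (trTm η ρ u))
  | _, _, _, as, η, ρ, .and G H => .and (trGoal as η ρ G) (trGoal as η ρ H)
  | _, _, _, as, η, ρ, .or G H => .or (trGoal as η ρ G) (trGoal as η ρ H)
  | _, _, _, as, η, ρ, .ex (τ := τ) G =>
      .ex (τ := raiseTy (L := S.target) as (trTy τ)) (trGoal as η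
        (Ix.cons (C := fun τ => HTm S.target _ (trTy τ))
          (HTm.appNoms (L := S.target) as (.var .z)) fun σ i => (ρ σ i).weaken) G)
  | _, _, _, as, η, ρ, .new (ν := ν) G =>
      trGoal (as ++ [⟨ν, S.freshName ν (as ++ G.names)⟩])
        (nmEnv η (S.freshName ν (as ++ G.names))) ρ G

/-! Translated clauses have empty support. -/

/-- The nominal constants that are written in a formula. -/
def HFm.noms {L : HSig.{u}} : ∀ {Γ : List L.Ty}, HFm L Γ → Set L.AnyNom
  | _, .top => ∅
  | _, .atom _ ts => ⋃ i, (ts i).noms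
  | _, .eq t u => t.noms ∪ u.noms
  | _, .and B C => B.noms ∪ C.noms
  | _, .or B C => B.noms ∪ C.noms
  | _, .ex B => B.noms
  | _, .nabla B => B.noms

theorem HTm.supp_subset_noms {L : HSig.{u}} {Γ : List L.Ty} {τ : L.Ty} (t : HTm L Γ τ) :
    t.supp ⊆ t.noms := fun _ h => h t (.refl t)

theorem HFm.supp_subset_noms {L : HSig.{u}} {Γ : List L.Ty} (B : HFm L Γ) : B.supp ⊆ B.noms := by
  induction B with
  | top => exact subset_rfl
  | atom p ts => exact Set.iUnion_mono fun i => (ts i).supp_subset_noms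
  | eq t u => exact Set.union_subset_union t.supp_subset_noms u.supp_subset_noms
  | and B C hB hC => exact Set.union_subset_union hB hC
  | or B C hB hC => exact Set.union_subset_union hB hC
  | ex B hB => exact hB
  | nabla B hB => exact hB

theorem HTm.noms_rename {L : HSig.{u}} {Γ : List L.Ty} {τ : L.Ty} (t : HTm L Γ τ) :
    ∀ {Γ' : List L.Ty} (r : ∀ τ, Ix Γ τ → Ix Γ' τ), (t.rename r).noms = t.noms := by
  induction t with
  | var x => intro _ r; rfl
  | con c => intro _ r; rfl
  | nom a => intro _ r; rfl
  | app t u ht hu => intro _ r; exact congrArg₂ (· ∪ ·) (ht r) (hu r)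
  | lam t ht => intro _ r; exact ht _

theorem HTm.noms_liftSub {L : HSig.{u}} {Γ Γ' : List L.Ty} {θ : ∀ τ, Ix Γ τ → HTm L Γ' τ}
    {σ : L.Ty} {c : L.AnyNom} {τ : L.Ty} {x : Ix (σ :: Γ) τ} (h : c ∈ (HTm.liftSub θ τ x).noms) :
    ∃ τ y, c ∈ (θ τ y).noms := by
  cases x with
  | z => exact h.elim
  | s i => exact ⟨_, i, by simpa [HTm.liftSub, Ix.cons, HTm.weaken, HTm.noms_rename] using h⟩

theorem HTm.noms_bind {L : HSig.{u}} {c : L.AnyNom} {Γ : List L.Ty} {τ : L.Ty} (t : HTm L Γ τ) :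
    ∀ {Γ' : List L.Ty} (θ : ∀ τ, Ix Γ τ → HTm L Γ' τ) (n : ∀ ν, L.Nom ν → HTm L Γ' (L.nomTy ν)),
      c ∈ (t.bind θ n).noms → (∃ τ x, c ∈ (θ τ x).noms) ∨
        ∃ a : L.AnyNom, a ∈ t.noms ∧ c ∈ (n a.1 a.2).noms := by
  induction t with
  | var x => intro _ θ n h; exact .inl ⟨_, x, h⟩
  | con _ => intro _ θ n h; exact h.elim
  | nom a => intro _ θ n h; exact .inr ⟨⟨_, a⟩, rfl, h⟩
  | app t u ht hu =>
    intro _ θ n h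
    rcases h with h | h
    · exact (ht θ n h).imp id fun ⟨a, ha, hc⟩ => ⟨a, .inl ha, hc⟩
    · exact (hu θ n h).imp id fun ⟨a, ha, hc⟩ => ⟨a, .inr ha, hc⟩
  | lam t ht =>
    intro _ θ n h
    rcases ht _ _ h with ⟨τ, x, hx⟩ | ⟨a, ha, hc⟩
    · exact .inl (HTm.noms_liftSub hx)
    · exact .inr ⟨a, ha, by simpa [HTm.weaken, HTm.noms_rename] using hc⟩

theorem HFm.noms_bind {L : HSig.{u}} {c : L.AnyNom} {Γ : List L.Ty} (B : HFm L Γ) :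
    ∀ {Γ' : List L.Ty} (θ : ∀ τ, Ix Γ τ → HTm L Γ' τ) (n : ∀ ν, L.Nom ν → HTm L Γ' (L.nomTy ν)),
      c ∈ (B.bind θ n).noms → (∃ τ x, c ∈ (θ τ x).noms) ∨
        ∃ a : L.AnyNom, a ∈ B.noms ∧ c ∈ (n a.1 a.2).noms := by
  have binder : ∀ {Γ Γ' : List L.Ty} {σ : L.Ty} (θ : ∀ τ, Ix Γ τ → HTm L Γ' τ)
      (n : ∀ ν, L.Nom ν → HTm L Γ' (L.nomTy ν)) (A : Set L.AnyNom),
      ((∃ τ x, c ∈ (HTm.liftSub θ (σ := σ) τ x).noms) ∨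
        ∃ a : L.AnyNom, a ∈ A ∧ c ∈ ((n a.1 a.2).weaken (σ := σ)).noms) →
      (∃ τ x, c ∈ (θ τ x).noms) ∨ ∃ a : L.AnyNom, a ∈ A ∧ c ∈ (n a.1 a.2).noms := by
    rintro Γ Γ' σ θ n A (⟨τ, x, hx⟩ | ⟨a, ha, hc⟩)
    · exact .inl (HTm.noms_liftSub hx)
    · exact .inr ⟨a, ha, by simpa [HTm.weaken, HTm.noms_rename] using hc⟩
  induction B with
  | top => intro _ θ n h; exact h.elim
  | atom p ts =>
    intro _ θ n h
    obtain ⟨i, hi⟩ := Set.mem_iUnion.1 h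
    exact ((ts i).noms_bind θ n hi).imp id fun ⟨a, ha, hc⟩ => ⟨a, Set.mem_iUnion.2 ⟨i, ha⟩, hc⟩
  | eq t u =>
    intro _ θ n h
    rcases h with h | h
    · exact (t.noms_bind θ n h).imp id fun ⟨a, ha, hc⟩ => ⟨a, .inl ha, hc⟩
    · exact (u.noms_bind θ n h).imp id fun ⟨a, ha, hc⟩ => ⟨a, .inr ha, hc⟩
  | and B C hB hC =>
    intro _ θ n h
    rcases h with h | h
    · exact (hB θ n h).imp id fun ⟨a, ha, hc⟩ => ⟨a, .inl ha, hc⟩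
    · exact (hC θ n h).imp id fun ⟨a, ha, hc⟩ => ⟨a, .inr ha, hc⟩
  | or B C hB hC =>
    intro _ θ n h
    rcases h with h | h
    · exact (hB θ n h).imp id fun ⟨a, ha, hc⟩ => ⟨a, .inl ha, hc⟩
    · exact (hC θ n h).imp id fun ⟨a, ha, hc⟩ => ⟨a, .inr ha, hc⟩
  | ex B hB => intro _ θ n h; exact binder θ n _ (hB _ _ h)
  | nabla B hB => intro _ θ n h; exact binder θ n _ (hB _ _ h)

theorem noms_absMap {L : HSig.{u}} {a b c : L.AnyNom} {Γ : List L.Ty}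
    (h : c ∈ (absMap L a Γ b.1 b.2).noms) : c = b ∧ c ≠ a := by
  classical
  obtain ⟨ν, a⟩ := a
  obtain ⟨μ, b⟩ := b
  by_cases hμ : μ = ν
  · subst hμ
    by_cases hb : b = a
    · subst hb
      simp [absMap, HTm.noms] at h
    · simp only [absMap, Function.update_self, Function.update_of_ne hb] at h
      have hc : c = ⟨μ, b⟩ := h
      exact ⟨hc, by rw [hc]; simpa using hb⟩
  · simp only [absMap, Function.update_of_ne hμ] at h
    have hc : c = ⟨μ, b⟩ := h
    exact ⟨hc, by rw [hc]; exact fun h' => hμ (congrArg Sigma.fst h')⟩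

theorem HTm.noms_absNom {L : HSig.{u}} {a c : L.AnyNom} {Γ : List L.Ty} {τ : L.Ty}
    (t : HTm L Γ τ) (h : c ∈ (t.absNom a).noms) : c ∈ t.noms ∧ c ≠ a := by
  rcases t.noms_bind _ _ h with ⟨_, _, h⟩ | ⟨b, hb, h⟩
  · exact h.elim
  · obtain ⟨rfl, hne⟩ := noms_absMap h
    exact ⟨hb, hne⟩

theorem HTm.noms_absNoms {L : HSig.{u}} {c : L.AnyNom} {Γ : List L.Ty} {τ : L.Ty}
    (t : HTm L Γ τ) : ∀ as : List L.AnyNom, c ∈ (t.absNoms as).noms → c ∈ t.noms ∧ c ∉ as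
  | [], h => ⟨h, List.not_mem_nil⟩
  | a :: as, h => by
    obtain ⟨h', hne⟩ := HTm.noms_absNom _ h
    obtain ⟨ht, has⟩ := t.noms_absNoms as h'
    exact ⟨ht, by simp [hne, has]⟩

theorem HFm.noms_nablas {L : HSig.{u}} {c : L.AnyNom} {Γ : List L.Ty}
    (B : HFm L Γ) : ∀ as : List L.AnyNom, c ∈ (B.nablas as).noms → c ∈ B.noms ∧ c ∉ as
  | [], h => ⟨h, List.not_mem_nil⟩
  | a :: as, h => by
    rcases (B.nablas as).noms_bind _ _ h with ⟨_, _, h⟩ | ⟨b, hb, h⟩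
    · exact h.elim
    · obtain ⟨rfl, hne⟩ := noms_absMap h
      obtain ⟨ht, has⟩ := B.noms_nablas as hb
      exact ⟨ht, by simp [hne, has]⟩

theorem HTm.noms_apps {L : HSig.{u}} {c : L.AnyNom} {Γ : List L.Ty} {τ : L.Ty} :
    ∀ {n : ℕ} {σ : Fin n → L.Ty} (t : HTm L Γ (STy.arrows σ τ)) (us : ∀ i, HTm L Γ (σ i)),
      c ∈ (HTm.apps t us).noms → c ∈ t.noms ∨ ∃ i, c ∈ (us i).noms
  | 0, _, _, _, h => .inl h
  | _ + 1, _, t, us, h => by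
    rcases HTm.noms_apps (.app t (us 0)) (fun i => us i.succ) h with (h | h) | ⟨i, h⟩
    · exact .inl h
    · exact .inr ⟨0, h⟩
    · exact .inr ⟨i.succ, h⟩

theorem HTm.noms_appNoms {L : HSig.{u}} {c : L.AnyNom} {Γ : List L.Ty} {τ : L.Ty} :
    ∀ (as : List L.AnyNom) (t : HTm L Γ (raiseTy as τ)),
      c ∈ (HTm.appNoms as t).noms → c ∈ t.noms ∨ c ∈ as
  | [], _, h => .inl h
  | a :: as, t, h => by
    rcases HTm.noms_appNoms as _ h with (h | h) | h
    · exact .inl h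
    · exact .inr (List.mem_cons.2 (.inl h))
    · exact .inr (List.mem_cons_of_mem _ h)

theorem NSig.swapping_cases {ν : S.NameTy} (a b : S.Name ν) (c : S.AnyName) :
    (⟨c.1, S.swapping a b c.1 c.2⟩ : S.AnyName) = c ∨
      (⟨c.1, S.swapping a b c.1 c.2⟩ : S.AnyName) = ⟨ν, a⟩ ∨
      (⟨c.1, S.swapping a b c.1 c.2⟩ : S.AnyName) = ⟨ν, b⟩ := by
  classical
  obtain ⟨μ, c⟩ := c
  by_cases hμ : μ = ν
  · subst hμ
    by_cases ha : c = a
    · subst ha; simp [NSig.swapping]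
    · by_cases hb : c = b
      · subst hb; simp [NSig.swapping]
      · simp [NSig.swapping, Equiv.swap_apply_of_ne_of_ne ha hb]
  · simp [NSig.swapping, Pi.mulSingle_eq_of_ne hμ]

theorem noms_trTm {c : S.AnyName} {A : Set S.AnyName} {Λ : List S.NameTy} {Γ : List S.Ty}
    {Γ' : List S.target.Ty} {η : ∀ ν, Nm S Λ ν → S.Name ν}
    {ρ : ∀ τ, Ix Γ τ → HTm S.target Γ' (trTy τ)}
    (hη : ∀ ν (a : Nm S Λ ν), (⟨ν, η ν a⟩ : S.AnyName) ∈ a.names ∨ (⟨ν, η ν a⟩ : S.AnyName) ∈ A)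
    (hρ : ∀ τ i, (ρ τ i).noms ⊆ A) {τ : S.Ty} (t : Tm S Λ Γ τ) (h : c ∈ (trTm η ρ t).noms) :
    c ∈ t.names ∨ c ∈ A := by
  induction t generalizing c with
  | name a =>
    have hc : c = ⟨_, η _ a⟩ := h
    exact hc ▸ hη _ a
  | var X => exact .inr (hρ _ X h)
  | fn f ts ih =>
    rcases HTm.noms_apps _ _ h with h | ⟨i, h⟩
    · exact h.elim
    · exact (ih i h).imp (fun h => List.mem_flatMap.2 ⟨i, List.mem_finRange i, h⟩) id
  | swap a b t ih =>
    rcases HTm.noms_bind _ _ _ h with ⟨_, _, h⟩ | ⟨d, hd, h⟩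
    · exact h.elim
    · have hc : c = ⟨d.1, S.swapping (η _ a) (η _ b) d.1 d.2⟩ := h
      rcases NSig.swapping_cases (η _ a) (η _ b) d with h | h | h
      · rw [hc, h]
        exact (ih hd).imp (fun h => List.mem_append.2 (.inr h)) id
      · rw [hc, h]
        exact (hη _ a).imp (fun h => List.mem_append.2 (.inl (List.mem_append.2 (.inl h)))) id
      · rw [hc, h]
        exact (hη _ b).imp (fun h => List.mem_append.2 (.inl (List.mem_append.2 (.inr h)))) id
  | abs a t ih =>
    exact (ih (HTm.noms_absNom _ h).1).imp (fun h => List.mem_append.2 (.inr h)) id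

theorem noms_trGoal {Λ : List S.NameTy} {Γ : List S.Ty} (G : Goal S Λ Γ) :
    ∀ {c : S.AnyName} {Γ' : List S.target.Ty} (as : List S.AnyName)
      (η : ∀ ν, Nm S Λ ν → S.Name ν) (ρ : ∀ τ, Ix Γ τ → HTm S.target Γ' (trTy τ)),
      (∀ ν (a : Nm S Λ ν), (⟨ν, η ν a⟩ : S.AnyName) ∈ a.names ∨ (⟨ν, η ν a⟩ : S.AnyName) ∈ as) →
      (∀ τ i, (ρ τ i).noms ⊆ {a | a ∈ as}) → c ∈ (trGoal as η ρ G).noms → c ∈ G.names ∧ c ∉ as := by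
  induction G with
  | top => intro c _ as η ρ hη hρ h; exact h.elim
  | atom p ts =>
    intro c _ as η ρ hη hρ h
    obtain ⟨h, hc⟩ := HFm.noms_nablas (L := S.target) _ as h
    obtain ⟨i, hi⟩ := Set.mem_iUnion.1 h
    exact ⟨List.mem_flatMap.2 ⟨i, List.mem_finRange i,
      (noms_trTm (A := {a | a ∈ as}) hη hρ _ hi).resolve_right hc⟩, hc⟩
  | fresh a t =>
    intro c _ as η ρ hη hρ h
    obtain ⟨h, hc⟩ := HFm.noms_nablas (L := S.target) _ as h
    obtain ⟨i, hi⟩ := Set.mem_iUnion.1 h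
    refine ⟨?_, hc⟩
    rcases i with ⟨_ | _ | i, hlt⟩
    · have hc' : c = ⟨_, η _ a⟩ := hi
      subst hc'
      exact List.mem_append.2 (.inl ((hη _ a).resolve_right hc))
    · exact List.mem_append.2 (.inr
        ((noms_trTm (A := {a | a ∈ as}) hη hρ t hi).resolve_right hc))
    · exact absurd hlt (Nat.not_lt.2 (Nat.le_add_left 2 i))
  | eq t u =>
    intro c _ as η ρ hη hρ h
    obtain ⟨h, hc⟩ := HFm.noms_nablas (L := S.target) _ as h
    refine ⟨List.mem_append.2 ?_, hc⟩
    rcases h with h | h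
    · exact .inl ((noms_trTm (A := {a | a ∈ as}) hη hρ t h).resolve_right hc)
    · exact .inr ((noms_trTm (A := {a | a ∈ as}) hη hρ u h).resolve_right hc)
  | and G H hG hH =>
    intro c _ as η ρ hη hρ h
    rcases h with h | h
    · exact (hG as η ρ hη hρ h).imp (fun h => List.mem_append.2 (.inl h)) id
    · exact (hH as η ρ hη hρ h).imp (fun h => List.mem_append.2 (.inr h)) id
  | or G H hG hH =>
    intro c _ as η ρ hη hρ h
    rcases h with h | h
    · exact (hG as η ρ hη hρ h).imp (fun h => List.mem_append.2 (.inl h)) id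
    · exact (hH as η ρ hη hρ h).imp (fun h => List.mem_append.2 (.inr h)) id
  | ex G hG =>
    intro c _ as η ρ hη hρ h
    refine hG as η _ hη ?_ h
    rintro _ (_ | i) d hd
    · exact (HTm.noms_appNoms (L := S.target) as _ hd).resolve_left fun h => h.elim
    · exact hρ _ i (by simpa [Ix.cons, HTm.weaken, HTm.noms_rename] using hd)
  | new G hG =>
    intro c _ as η ρ hη hρ h
    refine (hG _ _ ρ ?_ ?_ h).imp id fun h h' => h (List.mem_append.2 (.inl h'))
    · rintro ν (a | (_ | i))
      · exact (hη ν (.free a)).imp id fun h => List.mem_append.2 (.inl h)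
      · exact .inr (by simp [nmEnv])
      · exact .inr (List.mem_append.2 (.inl ((hη ν (.bound i)).resolve_left List.not_mem_nil)))
    · exact fun τ i d hd => List.mem_append.2 (.inl (hρ τ i hd))

/-- The substitution of the raised variables `X a⃗` for the variables `X`. -/
def raiseEnv (as : List S.AnyName) (vars : List S.Ty) : ∀ τ, Ix vars τ →
    HTm S.target (vars.map fun τ => raiseTy (L := S.target) as (trTy τ)) (trTy τ) :=
  fun _ i => HTm.appNoms (L := S.target) as (.var (i.map _))

theorem noms_raiseEnv (as : List S.AnyName) (vars : List S.Ty) (τ : S.Ty) (i : Ix vars τ) :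
    (raiseEnv as vars τ i).noms ⊆ {a | a ∈ as} :=
  fun _ h => (HTm.noms_appNoms (L := S.target) as _ h).resolve_left fun h => h.elim

theorem names_get (A : Set S.AnyName) (ν : S.NameTy) (a : Nm S [] ν) :
    (⟨ν, a.get⟩ : S.AnyName) ∈ a.names ∨ (⟨ν, a.get⟩ : S.AnyName) ∈ A := by
  cases a with
  | free a => exact .inl (List.mem_singleton.2 rfl)
  | bound i => cases i

/-- The translation of program clauses. -/
noncomputable def trClause (D : NClause S) : HClause S.target where
  xs := D.vars.map fun τ => raiseTy (L := S.target) D.bnames (trTy τ)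
  zs := D.bnames.map Sigma.fst
  pred := .inl D.pred
  args i := HTm.absNoms (L := S.target) D.bnames
    (trTm (fun _ a => a.get) (raiseEnv D.bnames D.vars) (D.args i))
  body := trGoal D.bnames (fun _ a => a.get) (raiseEnv D.bnames D.vars) D.body
  args_supp i := Set.eq_empty_iff_forall_notMem.2 fun c hc => by
    obtain ⟨h, hn⟩ := HTm.noms_absNoms (L := S.target) _ D.bnames (HTm.supp_subset_noms _ hc)
    exact hn ((noms_trTm (A := {a | a ∈ D.bnames}) (names_get _) (noms_raiseEnv _ _) _ h).elim
      (fun h => D.args_closed i h) id)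
  body_supp := Set.eq_empty_iff_forall_notMem.2 fun c hc => by
    obtain ⟨h, hn⟩ := noms_trGoal D.body D.bnames _ _ (names_get {a | a ∈ D.bnames}) (noms_raiseEnv _ _)
      (HFm.supp_subset_noms _ hc)
    exact hn (D.body_closed h)

/-- The clause `∀x.[(∇z. fresh z x) ≜ ⊤]` for `z` of name type `ν` and `x` of type `τ`. -/
def freshClause (S : NSig.{u}) (ν : S.NameTy) (τ : S.target.Ty) : HClause S.target where
  xs := [τ]
  zs := [ν]
  pred := .inr (ν, τ)
  args := Fin.cons (HTm.var (L := S.target) .z)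
    (Fin.cons (HTm.var (L := S.target) (.s .z)) finZeroElim)
  body := .top
  args_supp i := by
    rw [← Set.subset_empty_iff]
    refine (HTm.supp_subset_noms _).trans ?_
    rcases i with ⟨_ | _ | i, hlt⟩
    · exact subset_rfl
    · exact subset_rfl
    · exact absurd hlt (Nat.not_lt.2 (Nat.le_add_left 2 i))
  body_supp := rfl

/-- The definitional clauses `φ(Δ)` together with the clause for `fresh` at all types. -/
def trProgram (Δ : Set (NClause S)) : Set (HClause S.target) :=
  trClause '' Δ ∪ {C | ∃ (ν : S.NameTy) (τ : S.target.Ty), C = freshClause S ν τ}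

/-- The translation `φ_{a⃗}(G)` of a ground goal. -/
noncomputable def trGround (as : List S.AnyName) (G : Goal S [] []) : HFm S.target [] :=
  trGoal as (fun _ a => a.get) (fun _ i => i.elim) G

end Translation

end NomHO

/-!
Both directions are inductions on proofs, for a relation `Rep` between closed formulas of `𝒢⁻` and
ground goals that contains all pairs `(φ_{a⃗}(G), G)` of the theorem (`rep_trGround`) and is stable
under what the rules do to formulas and goals.

**Equality of terms.** λ-terms are interpreted in a set-theoretic model: environments map names to
names, base types are interpreted by trees that branch over the names of a type at a
name-abstraction, and function types from names by functions. Conversion is sound for the model.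
Conversely, a logical-relations argument (`Red`) shows that a closed term of a translated type is
convertible to the translation of a ground nominal term (`HTm.exists_conv_val`), and on ground nominal
terms equality of the trees in all environments is the relation `≈`, while not depending on the
value of a name is freshness (`Val.eqv_of_tree`, `Val.fresh_of_tree`). Hence three notions agree for
ground terms: `≈`, equality in the model, and convertibility of the translations (`Tm.eqv_eval`,
`HTm.conv_of_sem`), and the effect of substitution and swapping can be computed in the model.

**Raising.** A variable `X` of a goal under `Иa⃗` becomes `X a⃗`. A closed term `u` for the raised
variable corresponds to a ground term `t` for `X` if `u` is `λ(r a⃗).t` for names `r(a⃗)` outside the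
support of `u` (`Raises`); every `t` has such a `u` (`raises_lamNoms`), and every `u` has such a `t`,
namely a normal form of `u (r a⃗)` (`exists_raises`). In the model this correspondence is preserved
by translated terms, provided that the names acting on variables are among `a⃗` (`sem_trTm`): an
abstraction or swapping then changes the environment on `r(a⃗)` only. This is where the hypothesis on
`G` is used. For subterms without variables, injectivity of the renaming suffices
(`sem_trTm_ground`).

**Formulas.** An atomic goal is translated to a `∇`-prefixed atom. Opening the prefix with any
nominal constants outside the support gives the same result up to a permutation of the nominal
constants (`Opens`, `Opens.nabla_of_inst`). `Rep` combines this with `Raises` at existential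
quantifiers and with all but finitely many names at `И`, and `rep_trGoal` is its fundamental lemma.

**Proofs.** In `NProv.hProv` a proof of a goal is turned into a proof of any representation, and in
`HProv.nProv` a proof of a representation into a proof of the goal; backchaining on `Иa⃗.∀X⃗.[p(t⃗) ⊃ G]`
with `π` and `θ` corresponds to using its translation with `π(a⃗)` for `∇a⃗` and with the abstractions
of `π·θ` over `π(a⃗)` for the raised variables. Permutations are carried along in both inductions,
because provability is invariant under them but the given proof may have used particular names.
-/

namespace NomHO

section LambdaCalculus

variable {L : HSig.{u}}

/-! ### Renaming and substitution in λ-terms -/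

theorem liftRen_comp {Γ Γ' Γ'' : List L.Ty} (r : ∀ τ, Ix Γ τ → Ix Γ' τ)
    (r' : ∀ τ, Ix Γ' τ → Ix Γ'' τ) {σ : L.Ty} (τ : L.Ty) (i : Ix (σ :: Γ) τ) :
    liftRen r' τ (liftRen r τ i) = liftRen (fun τ i => r' τ (r τ i)) τ i := by
  cases i <;> rfl

theorem HTm.rename_rename {Γ : List L.Ty} {τ : L.Ty} (t : HTm L Γ τ) :
    ∀ {Γ' Γ'' : List L.Ty} (r : ∀ τ, Ix Γ τ → Ix Γ' τ) (r' : ∀ τ, Ix Γ' τ → Ix Γ'' τ),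
      (t.rename r).rename r' = t.rename fun τ i => r' τ (r τ i) := by
  induction t with
  | var x => intros; rfl
  | con c => intros; rfl
  | nom a => intros; rfl
  | app t u ht hu => intro _ _ r r'; simp only [HTm.rename, ht, hu]
  | lam t ht =>
    intro _ _ r r'
    simp only [HTm.rename, ht]
    congr 2
    funext τ i
    exact liftRen_comp r r' τ i

theorem HTm.weaken_rename {Γ Γ' : List L.Ty} {σ τ : L.Ty} (t : HTm L Γ τ)
    (r : ∀ τ, Ix Γ τ → Ix Γ' τ) :
    (t.weaken (σ := σ)).rename (liftRen r) = (t.rename r).weaken := by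
  simp only [HTm.weaken, HTm.rename_rename]; rfl

theorem HTm.bind_rename {Γ : List L.Ty} {τ : L.Ty} (t : HTm L Γ τ) :
    ∀ {Γ' Γ'' : List L.Ty} (θ : ∀ τ, Ix Γ τ → HTm L Γ' τ)
      (n : ∀ ν, L.Nom ν → HTm L Γ' (L.nomTy ν)) (r : ∀ τ, Ix Γ' τ → Ix Γ'' τ),
      (t.bind θ n).rename r = t.bind (fun τ i => (θ τ i).rename r) fun ν a => (n ν a).rename r := by
  induction t with
  | var x => intros; rfl
  | con c => intros; rfl
  | nom a => intros; rfl
  | app t u ht hu => intro _ _ θ n r; simp only [HTm.rename, HTm.bind, ht, hu]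
  | lam t ht =>
    intro _ _ θ n r
    simp only [HTm.rename, HTm.bind, ht, HTm.weaken_rename]
    congr 2
    funext τ i
    cases i with
    | z => rfl
    | s i => exact HTm.weaken_rename _ _

theorem HTm.rename_bind {Γ : List L.Ty} {τ : L.Ty} (t : HTm L Γ τ) :
    ∀ {Γ' Γ'' : List L.Ty} (r : ∀ τ, Ix Γ τ → Ix Γ' τ) (θ : ∀ τ, Ix Γ' τ → HTm L Γ'' τ)
      (n : ∀ ν, L.Nom ν → HTm L Γ'' (L.nomTy ν)),
      (t.rename r).bind θ n = t.bind (fun τ i => θ τ (r τ i)) n := by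
  induction t with
  | var x => intros; rfl
  | con c => intros; rfl
  | nom a => intros; rfl
  | app t u ht hu => intro _ _ r θ n; simp only [HTm.rename, HTm.bind, ht, hu]
  | lam t ht =>
    intro _ _ r θ n
    simp only [HTm.rename, HTm.bind, ht]
    congr 2
    funext τ i
    cases i <;> rfl

theorem HTm.weaken_bind {Γ Γ' : List L.Ty} {σ τ : L.Ty} (t : HTm L Γ τ)
    (θ : ∀ τ, Ix Γ τ → HTm L Γ' τ) (n : ∀ ν, L.Nom ν → HTm L Γ' (L.nomTy ν)) :
    (t.weaken (σ := σ)).bind (HTm.liftSub θ) (fun ν a => (n ν a).weaken) =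
      (t.bind θ n).weaken := by
  simp only [HTm.weaken, HTm.rename_bind, HTm.bind_rename]; rfl

theorem HTm.liftSub_bind {Γ Γ' Γ'' : List L.Ty} (θ : ∀ τ, Ix Γ τ → HTm L Γ' τ)
    (θ' : ∀ τ, Ix Γ' τ → HTm L Γ'' τ) (n' : ∀ ν, L.Nom ν → HTm L Γ'' (L.nomTy ν)) {σ : L.Ty} :
    (fun τ (i : Ix (σ :: Γ) τ) => (HTm.liftSub θ τ i).bind (HTm.liftSub θ')
      fun ν a => (n' ν a).weaken) = HTm.liftSub fun τ i => (θ τ i).bind θ' n' := by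
  funext τ i
  cases i with
  | z => rfl
  | s i => exact HTm.weaken_bind _ _ _

theorem HTm.bind_bind {Γ : List L.Ty} {τ : L.Ty} (t : HTm L Γ τ) :
    ∀ {Γ' Γ'' : List L.Ty} (θ : ∀ τ, Ix Γ τ → HTm L Γ' τ)
      (n : ∀ ν, L.Nom ν → HTm L Γ' (L.nomTy ν)) (θ' : ∀ τ, Ix Γ' τ → HTm L Γ'' τ)
      (n' : ∀ ν, L.Nom ν → HTm L Γ'' (L.nomTy ν)),
      (t.bind θ n).bind θ' n' =
        t.bind (fun τ i => (θ τ i).bind θ' n') fun ν a => (n ν a).bind θ' n' := by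
  induction t with
  | var x => intros; rfl
  | con c => intros; rfl
  | nom a => intros; rfl
  | app t u ht hu => intro _ _ θ n θ' n'; simp only [HTm.bind, ht, hu]
  | lam t ht =>
    intro _ _ θ n θ' n'
    simp only [HTm.bind, ht, HTm.liftSub_bind, HTm.weaken_bind]

theorem HTm.liftSub_var {Γ : List L.Ty} {σ : L.Ty} :
    HTm.liftSub (fun _ (i : Ix Γ _) => (.var i : HTm L Γ _)) (σ := σ) = fun _ i => .var i := by
  funext τ i
  cases i <;> rfl

theorem HTm.bind_id {Γ : List L.Ty} {τ : L.Ty} (t : HTm L Γ τ) :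
    t.bind (fun _ i => .var i) (fun _ a => .nom a) = t := by
  induction t with
  | var x => rfl
  | con c => rfl
  | nom a => rfl
  | app t u ht hu => simp only [HTm.bind, ht, hu]
  | lam t ht =>
    simp only [HTm.bind, HTm.liftSub_var]
    exact congrArg _ ht

theorem HTm.bind_congr {Γ : List L.Ty} {τ : L.Ty} (t : HTm L Γ τ) :
    ∀ {Γ' : List L.Ty} {θ : ∀ τ, Ix Γ τ → HTm L Γ' τ} {n n' : ∀ ν, L.Nom ν → HTm L Γ' (L.nomTy ν)},
      (∀ a ∈ t.noms, n a.1 a.2 = n' a.1 a.2) → t.bind θ n = t.bind θ n' := by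
  induction t with
  | var x => intros; rfl
  | con c => intros; rfl
  | nom a => intro _ θ n n' h; exact h ⟨_, a⟩ rfl
  | app t u ht hu =>
    intro _ θ n n' h
    simp only [HTm.bind, ht fun a ha => h a (.inl ha), hu fun a ha => h a (.inr ha)]
  | lam t ht =>
    intro _ θ n n' h
    exact congrArg HTm.lam (ht fun a ha => congrArg HTm.weaken (h a ha))

theorem HTm.rename_eq_bind {Γ : List L.Ty} {τ : L.Ty} (t : HTm L Γ τ) {Γ' : List L.Ty}
    (r : ∀ τ, Ix Γ τ → Ix Γ' τ) :
    t.rename r = t.bind (fun τ i => .var (r τ i)) fun _ a => .nom a := by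
  conv_lhs => rw [← t.bind_id, HTm.bind_rename]
  rfl

/-- Substituting under a binder and then for the bound variable. -/
theorem HTm.bind_liftSub_inst {Γ Γ' : List L.Ty} {σ τ : L.Ty} (t : HTm L (σ :: Γ) τ)
    (θ : ∀ τ, Ix Γ τ → HTm L Γ' τ) (n : ∀ ν, L.Nom ν → HTm L Γ' (L.nomTy ν)) (u : HTm L Γ' σ) :
    (t.bind (HTm.liftSub θ) fun ν a => (n ν a).weaken).inst u = t.bind (Ix.cons u θ) n := by
  have h : ∀ {τ : L.Ty} (v : HTm L Γ' τ), (v.weaken (σ := σ)).inst u = v := fun v => by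
    simp only [HTm.inst, HTm.subst, HTm.weaken, HTm.rename_bind]; exact v.bind_id
  simp only [HTm.inst, HTm.subst] at h ⊢
  simp only [HTm.bind_bind, h]
  congr 1
  funext τ i
  cases i with
  | z => rfl
  | s i => exact h _

theorem HTm.inst_bind {Γ Γ' : List L.Ty} {σ τ : L.Ty} (t : HTm L (σ :: Γ) τ)
    (θ : ∀ τ, Ix Γ τ → HTm L Γ' τ) (n : ∀ ν, L.Nom ν → HTm L Γ' (L.nomTy ν)) (u : HTm L Γ σ) :
    (t.inst u).bind θ n = t.bind (Ix.cons (u.bind θ n) θ) n := by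
  simp only [HTm.inst, HTm.subst, HTm.bind_bind]
  congr 1
  funext τ i
  cases i <;> rfl

theorem HFm.bind_bind {Γ : List L.Ty} (B : HFm L Γ) :
    ∀ {Γ' Γ'' : List L.Ty} (θ : ∀ τ, Ix Γ τ → HTm L Γ' τ)
      (n : ∀ ν, L.Nom ν → HTm L Γ' (L.nomTy ν)) (θ' : ∀ τ, Ix Γ' τ → HTm L Γ'' τ)
      (n' : ∀ ν, L.Nom ν → HTm L Γ'' (L.nomTy ν)),
      (B.bind θ n).bind θ' n' =
        B.bind (fun τ i => (θ τ i).bind θ' n') fun ν a => (n ν a).bind θ' n' := by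
  induction B with
  | top => intros; rfl
  | atom p ts => intros; simp only [HFm.bind, HTm.bind_bind]
  | eq t u => intros; simp only [HFm.bind, HTm.bind_bind]
  | and B C hB hC => intros; simp only [HFm.bind, hB, hC]
  | or B C hB hC => intros; simp only [HFm.bind, hB, hC]
  | ex B hB => intros; simp only [HFm.bind, hB, HTm.liftSub_bind, HTm.weaken_bind]
  | nabla B hB => intros; simp only [HFm.bind, hB, HTm.liftSub_bind, HTm.weaken_bind]

theorem HFm.bind_id {Γ : List L.Ty} (B : HFm L Γ) :
    B.bind (fun _ i => .var i) (fun _ a => .nom a) = B := by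
  induction B with
  | top => rfl
  | atom p ts => simp only [HFm.bind, HTm.bind_id]
  | eq t u => simp only [HFm.bind, HTm.bind_id]
  | and B C hB hC => simp only [HFm.bind, hB, hC]
  | or B C hB hC => simp only [HFm.bind, hB, hC]
  | ex B hB => simp only [HFm.bind, HTm.liftSub_var]; exact congrArg _ hB
  | nabla B hB => simp only [HFm.bind, HTm.liftSub_var]; exact congrArg _ hB

theorem HFm.bind_congr {Γ : List L.Ty} (B : HFm L Γ) :
    ∀ {Γ' : List L.Ty} {θ : ∀ τ, Ix Γ τ → HTm L Γ' τ} {n n' : ∀ ν, L.Nom ν → HTm L Γ' (L.nomTy ν)},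
      (∀ a ∈ B.noms, n a.1 a.2 = n' a.1 a.2) → B.bind θ n = B.bind θ n' := by
  induction B with
  | top => intros; rfl
  | atom p ts =>
    intro _ θ n n' h
    simp only [HFm.bind]
    congr 1
    funext i
    exact (ts i).bind_congr fun a ha => h a (Set.mem_iUnion.2 ⟨i, ha⟩)
  | eq t u =>
    intro _ θ n n' h
    simp only [HFm.bind, t.bind_congr fun a ha => h a (.inl ha),
      u.bind_congr fun a ha => h a (.inr ha)]
  | and B C hB hC =>
    intro _ θ n n' h
    simp only [HFm.bind, hB fun a ha => h a (.inl ha), hC fun a ha => h a (.inr ha)]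
  | or B C hB hC =>
    intro _ θ n n' h
    simp only [HFm.bind, hB fun a ha => h a (.inl ha), hC fun a ha => h a (.inr ha)]
  | ex B hB =>
    intro _ θ n n' h
    exact congrArg HFm.ex (hB fun a ha => congrArg HTm.weaken (h a ha))
  | nabla B hB =>
    intro _ θ n n' h
    exact congrArg HFm.nabla (hB fun a ha => congrArg HTm.weaken (h a ha))

theorem HFm.bind_liftSub_inst {Γ Γ' : List L.Ty} {σ : L.Ty} (B : HFm L (σ :: Γ))
    (θ : ∀ τ, Ix Γ τ → HTm L Γ' τ) (n : ∀ ν, L.Nom ν → HTm L Γ' (L.nomTy ν)) (u : HTm L Γ' σ) :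
    (B.bind (HTm.liftSub θ) fun ν a => (n ν a).weaken).inst u = B.bind (Ix.cons u θ) n := by
  have h : ∀ {τ : L.Ty} (v : HTm L Γ' τ), (v.weaken (σ := σ)).inst u = v := fun v => by
    simp only [HTm.inst, HTm.subst, HTm.weaken, HTm.rename_bind]; exact v.bind_id
  simp only [HTm.inst, HTm.subst] at h
  simp only [HFm.inst, HFm.subst, HFm.bind_bind, h]
  congr 1
  funext τ i
  cases i with
  | z => rfl
  | s i => exact h _

theorem HFm.inst_bind {Γ Γ' : List L.Ty} {σ : L.Ty} (B : HFm L (σ :: Γ))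
    (θ : ∀ τ, Ix Γ τ → HTm L Γ' τ) (n : ∀ ν, L.Nom ν → HTm L Γ' (L.nomTy ν)) (u : HTm L Γ σ) :
    (B.inst u).bind θ n = B.bind (Ix.cons (u.bind θ n) θ) n := by
  simp only [HFm.inst, HFm.subst, HFm.bind_bind]
  congr 1
  funext τ i
  cases i <;> rfl

/-! ### Conversion -/

theorem HTm.Conv.bind {Γ : List L.Ty} {τ : L.Ty} {t u : HTm L Γ τ} (h : HTm.Conv t u) :
    ∀ {Γ' : List L.Ty} (θ : ∀ τ, Ix Γ τ → HTm L Γ' τ) (n : ∀ ν, L.Nom ν → HTm L Γ' (L.nomTy ν)),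
      HTm.Conv (t.bind θ n) (u.bind θ n) := by
  induction h with
  | refl t => intros; exact .refl _
  | symm _ ih => intros; exact .symm (ih _ _)
  | trans _ _ ih ih' => intros; exact .trans (ih _ _) (ih' _ _)
  | app _ _ ih ih' => intros; exact .app (ih _ _) (ih' _ _)
  | lam _ ih => intros; exact .lam (ih _ _)
  | beta t u =>
    intro _ θ n
    rw [HTm.inst_bind, ← HTm.bind_liftSub_inst]
    exact .beta _ _
  | eta t =>
    intro _ θ n
    simp only [HTm.bind, HTm.weaken_bind]
    exact .eta _

theorem HTm.Conv.weaken {Γ : List L.Ty} {σ τ : L.Ty} {t u : HTm L Γ τ} (h : HTm.Conv t u) :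
    HTm.Conv (t.weaken (σ := σ)) u.weaken := by
  simp only [HTm.weaken, HTm.rename_eq_bind]
  exact h.bind _ _

theorem HTm.Conv.liftSub {Γ Γ' : List L.Ty} {θ θ' : ∀ τ, Ix Γ τ → HTm L Γ' τ}
    (h : ∀ τ i, HTm.Conv (θ τ i) (θ' τ i)) {σ : L.Ty} (τ : L.Ty) (i : Ix (σ :: Γ) τ) :
    HTm.Conv (HTm.liftSub θ τ i) (HTm.liftSub θ' τ i) := by
  cases i with
  | z => exact .refl _
  | s i => exact (h _ i).weaken

theorem HTm.Conv.bind_left {Γ : List L.Ty} {τ : L.Ty} (t : HTm L Γ τ) :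
    ∀ {Γ' : List L.Ty} {θ θ' : ∀ τ, Ix Γ τ → HTm L Γ' τ} (n : ∀ ν, L.Nom ν → HTm L Γ' (L.nomTy ν)),
      (∀ τ i, HTm.Conv (θ τ i) (θ' τ i)) → HTm.Conv (t.bind θ n) (t.bind θ' n) := by
  induction t with
  | var x => intro _ _ _ _ h; exact h _ x
  | con c => intros; exact .refl _
  | nom a => intros; exact .refl _
  | app t u ht hu => intro _ _ _ _ h; exact .app (ht _ h) (hu _ h)
  | lam t ht => intro _ _ _ _ h; exact .lam (ht _ (HTm.Conv.liftSub h))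

theorem HTm.Conv.apps {Γ : List L.Ty} {τ : L.Ty} : ∀ {n : ℕ} {σ : Fin n → L.Ty}
    {t t' : HTm L Γ (STy.arrows σ τ)} {us us' : ∀ i, HTm L Γ (σ i)}, HTm.Conv t t' →
    (∀ i, HTm.Conv (us i) (us' i)) → HTm.Conv (HTm.apps t us) (HTm.apps t' us')
  | 0, _, _, _, _, _, h, _ => h
  | _ + 1, _, t, t', us, us', h, h' =>
    HTm.Conv.apps (t := .app t (us 0)) (t' := .app t' (us' 0)) (.app h (h' 0)) fun i => h' i.succ

theorem HTm.Conv.mem_supp {Γ : List L.Ty} {τ : L.Ty} {t u : HTm L Γ τ} (h : HTm.Conv t u)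
    {a : L.AnyNom} (ha : a ∈ t.supp) : a ∈ u.supp := fun v hv => ha v (h.trans hv)

theorem HTm.exists_conv_of_notMem_supp {Γ : List L.Ty} {τ : L.Ty} {t : HTm L Γ τ} {a : L.AnyNom}
    (ha : a ∉ t.supp) : ∃ u, HTm.Conv t u ∧ a ∉ u.noms := by
  simpa [HTm.supp] using ha

/-- Conversion of formulas: the terms at corresponding places are convertible. -/
inductive HFm.Conv : ∀ {Γ : List L.Ty}, HFm L Γ → HFm L Γ → Prop
  | top {Γ : List L.Ty} : HFm.Conv (.top : HFm L Γ) .top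
  | atom {Γ : List L.Ty} {p : L.Pred} {ts us : ∀ i, HTm L Γ (L.predArg p i)}
      (h : ∀ i, HTm.Conv (ts i) (us i)) : HFm.Conv (.atom p ts) (.atom p us)
  | eq {Γ : List L.Ty} {τ : L.Ty} {t t' u u' : HTm L Γ τ} (h : HTm.Conv t t')
      (h' : HTm.Conv u u') : HFm.Conv (.eq t u) (.eq t' u')
  | and {Γ : List L.Ty} {B B' C C' : HFm L Γ} (h : HFm.Conv B B') (h' : HFm.Conv C C') :
      HFm.Conv (.and B C) (.and B' C')
  | or {Γ : List L.Ty} {B B' C C' : HFm L Γ} (h : HFm.Conv B B') (h' : HFm.Conv C C') :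
      HFm.Conv (.or B C) (.or B' C')
  | ex {Γ : List L.Ty} {τ : L.Ty} {B B' : HFm L (τ :: Γ)} (h : HFm.Conv B B') :
      HFm.Conv (.ex B) (.ex B')
  | nabla {Γ : List L.Ty} {ν : L.NomIx} {B B' : HFm L (L.nomTy ν :: Γ)} (h : HFm.Conv B B') :
      HFm.Conv (.nabla B) (.nabla B')

theorem HFm.Conv.refl {Γ : List L.Ty} (B : HFm L Γ) : HFm.Conv B B := by
  induction B with
  | top => exact .top
  | atom p ts => exact .atom fun i => .refl _
  | eq t u => exact .eq (.refl _) (.refl _)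
  | and B C hB hC => exact .and hB hC
  | or B C hB hC => exact .or hB hC
  | ex B hB => exact .ex hB
  | nabla B hB => exact .nabla hB

theorem HFm.Conv.symm {Γ : List L.Ty} {B C : HFm L Γ} (h : HFm.Conv B C) : HFm.Conv C B := by
  induction h with
  | top => exact .top
  | atom h => exact .atom fun i => (h i).symm
  | eq h h' => exact .eq h.symm h'.symm
  | and _ _ ih ih' => exact .and ih ih'
  | or _ _ ih ih' => exact .or ih ih'
  | ex _ ih => exact .ex ih
  | nabla _ ih => exact .nabla ih

theorem HFm.Conv.trans {Γ : List L.Ty} {B C : HFm L Γ} (h : HFm.Conv B C) :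
    ∀ {D : HFm L Γ}, HFm.Conv C D → HFm.Conv B D := by
  induction h with
  | top => exact id
  | atom h => intro D hD; cases hD with | atom h' => exact .atom fun i => (h i).trans (h' i)
  | eq h h' => intro D hD; cases hD with | eq k k' => exact .eq (h.trans k) (h'.trans k')
  | and _ _ ih ih' => intro D hD; cases hD with | and k k' => exact .and (ih k) (ih' k')
  | or _ _ ih ih' => intro D hD; cases hD with | or k k' => exact .or (ih k) (ih' k')
  | ex _ ih => intro D hD; cases hD with | ex k => exact .ex (ih k)
  | nabla _ ih => intro D hD; cases hD with | nabla k => exact .nabla (ih k)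

theorem HFm.Conv.bind {Γ : List L.Ty} {B C : HFm L Γ} (h : HFm.Conv B C) :
    ∀ {Γ' : List L.Ty} (θ : ∀ τ, Ix Γ τ → HTm L Γ' τ) (n : ∀ ν, L.Nom ν → HTm L Γ' (L.nomTy ν)),
      HFm.Conv (B.bind θ n) (C.bind θ n) := by
  induction h with
  | top => intros; exact .top
  | atom h => intros; exact .atom fun i => (h i).bind _ _
  | eq h h' => intros; exact .eq (h.bind _ _) (h'.bind _ _)
  | and _ _ ih ih' => intros; exact .and (ih _ _) (ih' _ _)
  | or _ _ ih ih' => intros; exact .or (ih _ _) (ih' _ _)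
  | ex _ ih => intros; exact .ex (ih _ _)
  | nabla _ ih => intros; exact .nabla (ih _ _)

theorem HFm.Conv.bind_left {Γ : List L.Ty} (B : HFm L Γ) :
    ∀ {Γ' : List L.Ty} {θ θ' : ∀ τ, Ix Γ τ → HTm L Γ' τ} (n : ∀ ν, L.Nom ν → HTm L Γ' (L.nomTy ν)),
      (∀ τ i, HTm.Conv (θ τ i) (θ' τ i)) → HFm.Conv (B.bind θ n) (B.bind θ' n) := by
  induction B with
  | top => intros; exact .top
  | atom p ts => intro _ _ _ _ h; exact .atom fun i => .bind_left _ _ h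
  | eq t u => intro _ _ _ _ h; exact .eq (.bind_left _ _ h) (.bind_left _ _ h)
  | and B C hB hC => intro _ _ _ _ h; exact .and (hB _ h) (hC _ h)
  | or B C hB hC => intro _ _ _ _ h; exact .or (hB _ h) (hC _ h)
  | ex B hB => intro _ _ _ _ h; exact .ex (hB _ (HTm.Conv.liftSub h))
  | nabla B hB => intro _ _ _ _ h; exact .nabla (hB _ (HTm.Conv.liftSub h))

theorem HFm.Conv.inst {Γ : List L.Ty} {σ : L.Ty} {B C : HFm L (σ :: Γ)} (h : HFm.Conv B C)
    (u : HTm L Γ σ) : HFm.Conv (B.inst u) (C.inst u) := h.bind _ _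

theorem HFm.Conv.mem_supp {Γ : List L.Ty} {B C : HFm L Γ} (h : HFm.Conv B C) {a : L.AnyNom}
    (ha : a ∈ B.supp) : a ∈ C.supp := by
  induction h with
  | top => exact ha
  | atom h =>
    obtain ⟨i, hi⟩ := Set.mem_iUnion.1 ha
    exact Set.mem_iUnion.2 ⟨i, (h i).mem_supp hi⟩
  | eq h h' => exact ha.imp h.mem_supp h'.mem_supp
  | and _ _ ih ih' => exact Or.imp ih ih' ha
  | or _ _ ih ih' => exact Or.imp ih ih' ha
  | ex _ ih => exact ih ha
  | nabla _ ih => exact ih ha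

/-! ### Renaming of nominal constants -/

/-- Apply a map to the nominal constants of a term. -/
def HTm.mapNom (m : ∀ ν, L.Nom ν → L.Nom ν) {Γ : List L.Ty} {τ : L.Ty} (t : HTm L Γ τ) :
    HTm L Γ τ :=
  t.bind (fun _ i => .var i) fun ν a => .nom (m ν a)

/-- Apply a map to the nominal constants of a formula. -/
def HFm.mapNom (m : ∀ ν, L.Nom ν → L.Nom ν) {Γ : List L.Ty} (B : HFm L Γ) : HFm L Γ :=
  B.bind (fun _ i => .var i) fun ν a => .nom (m ν a)

theorem HTm.mapNom_mapNom (m m' : ∀ ν, L.Nom ν → L.Nom ν) {Γ : List L.Ty} {τ : L.Ty}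
    (t : HTm L Γ τ) : (t.mapNom m).mapNom m' = t.mapNom fun ν a => m' ν (m ν a) :=
  HTm.bind_bind _ _ _ _ _

theorem HFm.mapNom_mapNom (m m' : ∀ ν, L.Nom ν → L.Nom ν) {Γ : List L.Ty} (B : HFm L Γ) :
    (B.mapNom m).mapNom m' = B.mapNom fun ν a => m' ν (m ν a) :=
  HFm.bind_bind _ _ _ _ _

theorem HFm.mapNom_ex (m : ∀ ν, L.Nom ν → L.Nom ν) {Γ : List L.Ty} {τ : L.Ty}
    (B : HFm L (τ :: Γ)) : (HFm.ex B).mapNom m = .ex (B.mapNom m) := by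
  simp only [HFm.mapNom, HFm.bind, HTm.liftSub_var]; rfl

theorem HFm.mapNom_nabla (m : ∀ ν, L.Nom ν → L.Nom ν) {Γ : List L.Ty} {ν : L.NomIx}
    (B : HFm L (L.nomTy ν :: Γ)) : (HFm.nabla B).mapNom m = .nabla (B.mapNom m) := by
  simp only [HFm.mapNom, HFm.bind, HTm.liftSub_var]; rfl

theorem HFm.mapNom_inst (m : ∀ ν, L.Nom ν → L.Nom ν) {Γ : List L.Ty} {σ : L.Ty}
    (B : HFm L (σ :: Γ)) (u : HTm L Γ σ) :
    (B.inst u).mapNom m = (B.mapNom m).inst (u.mapNom m) := by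
  simp only [HFm.mapNom, HTm.mapNom, HFm.inst_bind]
  simp only [HFm.inst, HFm.subst, HFm.bind_bind]
  congr 1

theorem HTm.mem_noms_mapNom {m : ∀ ν, L.Nom ν → L.Nom ν} {Γ : List L.Ty} {τ : L.Ty}
    {t : HTm L Γ τ} {c : L.AnyNom} (h : c ∈ (t.mapNom m).noms) :
    ∃ a ∈ t.noms, c = ⟨a.1, m a.1 a.2⟩ := by
  rcases HTm.noms_bind _ _ _ h with ⟨_, _, h⟩ | ⟨a, ha, h⟩
  · exact h.elim
  · exact ⟨a, ha, h⟩

theorem HTm.notMem_supp_mapNom {m : ∀ ν, L.Nom ν → L.Nom ν} (hm : ∀ ν, Function.Injective (m ν))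
    {Γ : List L.Ty} {τ : L.Ty} {t : HTm L Γ τ} {c : L.AnyNom} (h : c ∉ t.supp) :
    (⟨c.1, m c.1 c.2⟩ : L.AnyNom) ∉ (t.mapNom m).supp := by
  obtain ⟨u, hu, hc⟩ := HTm.exists_conv_of_notMem_supp h
  intro h'
  obtain ⟨⟨μ, a⟩, ha, h⟩ := HTm.mem_noms_mapNom (h' _ (hu.bind _ _))
  obtain ⟨ν, c⟩ := c
  cases (Sigma.mk.inj h).1
  cases hm _ (eq_of_heq (Sigma.mk.inj h).2)
  exact hc ha

theorem HFm.notMem_supp_mapNom {m : ∀ ν, L.Nom ν → L.Nom ν} (hm : ∀ ν, Function.Injective (m ν))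
    {c : L.AnyNom} {Γ : List L.Ty} (B : HFm L Γ) (h : c ∉ B.supp) :
    (⟨c.1, m c.1 c.2⟩ : L.AnyNom) ∉ (B.mapNom m).supp := by
  induction B with
  | top => exact id
  | atom p ts =>
    intro h'
    obtain ⟨i, hi⟩ := Set.mem_iUnion.1 h'
    exact HTm.notMem_supp_mapNom hm (fun h' => h (Set.mem_iUnion.2 ⟨i, h'⟩)) hi
  | eq t u =>
    exact not_or.2 ⟨HTm.notMem_supp_mapNom hm fun h' => h (.inl h'),
      HTm.notMem_supp_mapNom hm fun h' => h (.inr h')⟩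
  | and B C hB hC => exact not_or.2 ⟨hB fun h' => h (.inl h'), hC fun h' => h (.inr h')⟩
  | or B C hB hC => exact not_or.2 ⟨hB fun h' => h (.inl h'), hC fun h' => h (.inr h')⟩
  | ex B hB => rw [HFm.mapNom_ex]; exact hB h
  | nabla B hB => rw [HFm.mapNom_nabla]; exact hB h

/-- A renaming that moves finitely many nominal constants, all of them outside the support of a
term, does not change the term up to conversion. The constants are dealt with one at a time, since
convertible terms that avoid one of them each need not be equal. -/
theorem HTm.conv_mapNom {Γ : List L.Ty} {τ : L.Ty} {t : HTm L Γ τ} :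
    ∀ (l : List L.AnyNom) (m : ∀ ν, L.Nom ν → L.Nom ν), (∀ c ∈ l, c ∉ t.supp) →
      (∀ c : L.AnyNom, c ∉ l → m c.1 c.2 = c.2) → HTm.Conv (t.mapNom m) t
  | [], m, _, hm => by
    rw [show m = fun _ a => a from funext fun ν => funext fun a => hm ⟨ν, a⟩ List.not_mem_nil]
    rw [HTm.mapNom, HTm.bind_id]
    exact .refl t
  | a :: l, m, hl, hm => by
    classical
    obtain ⟨u, hu, ha⟩ := HTm.exists_conv_of_notMem_supp (hl a List.mem_cons_self)
    let m' : ∀ ν, L.Nom ν → L.Nom ν := fun ν b => if (⟨ν, b⟩ : L.AnyNom) = a then b else m ν b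
    have h : u.mapNom m = u.mapNom m' := u.bind_congr fun b hb => by
      have : b ≠ a := fun h => ha (h ▸ hb)
      simp [m', this]
    refine (hu.bind _ _).trans ((h ▸ HTm.Conv.refl _ : HTm.Conv (u.mapNom m) (u.mapNom m')).trans
      ((hu.symm.bind _ _).trans (HTm.conv_mapNom l m' (fun c hc => hl c (List.mem_cons_of_mem _ hc))
        fun c hc => ?_)))
    by_cases hca : c = a
    · subst hca; exact if_pos rfl
    · exact (if_neg hca).trans (hm c (by simp [hca, hc]))

theorem HFm.conv_mapNom {l : List L.AnyNom} {m : ∀ ν, L.Nom ν → L.Nom ν}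
    (hm : ∀ c : L.AnyNom, c ∉ l → m c.1 c.2 = c.2) {Γ : List L.Ty} (B : HFm L Γ)
    (hl : ∀ c ∈ l, c ∉ B.supp) : HFm.Conv (B.mapNom m) B := by
  induction B with
  | top => exact .top
  | atom p ts =>
    exact .atom fun i => HTm.conv_mapNom l m (fun c hc h => hl c hc (Set.mem_iUnion.2 ⟨i, h⟩)) hm
  | eq t u =>
    exact .eq (HTm.conv_mapNom l m (fun c hc h => hl c hc (.inl h)) hm)
      (HTm.conv_mapNom l m (fun c hc h => hl c hc (.inr h)) hm)
  | and B C hB hC =>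
    exact .and (hB fun c hc h => hl c hc (.inl h)) (hC fun c hc h => hl c hc (.inr h))
  | or B C hB hC =>
    exact .or (hB fun c hc h => hl c hc (.inl h)) (hC fun c hc h => hl c hc (.inr h))
  | ex B hB => rw [HFm.mapNom_ex]; exact .ex (hB hl)
  | nabla B hB => rw [HFm.mapNom_nabla]; exact .nabla (hB hl)

/-- The support of a substitution instance. -/
theorem HFm.notMem_supp_bind {c : L.AnyNom} {Γ Γ' : List L.Ty} (B : HFm L Γ)
    {θ : ∀ τ, Ix Γ τ → HTm L Γ' τ} {n : ∀ ν, L.Nom ν → HTm L Γ' (L.nomTy ν)}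
    (hθ : ∀ τ i, c ∉ (θ τ i).supp) (hn : ∀ a ∈ B.noms, c ∉ (n a.1 a.2).noms) :
    c ∉ (B.bind θ n).supp := by
  choose θ' hθ' hc using fun τ i => HTm.exists_conv_of_notMem_supp (hθ τ i)
  intro h
  rcases HFm.noms_bind _ _ _ (HFm.supp_subset_noms _ ((HFm.Conv.bind_left B n hθ').mem_supp h)) with
    ⟨τ, i, h⟩ | ⟨a, ha, h⟩
  · exact hc τ i h
  · exact hn a ha h

theorem HTm.finite_noms {Γ : List L.Ty} {τ : L.Ty} (t : HTm L Γ τ) : t.noms.Finite := by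
  induction t with
  | var x => exact Set.finite_empty
  | con c => exact Set.finite_empty
  | nom a => exact Set.finite_singleton _
  | app t u ht hu => exact ht.union hu
  | lam t ht => exact ht

theorem HFm.finite_noms {Γ : List L.Ty} (B : HFm L Γ) : B.noms.Finite := by
  induction B with
  | top => exact Set.finite_empty
  | atom p ts => exact Set.finite_iUnion fun i => (ts i).finite_noms
  | eq t u => exact t.finite_noms.union u.finite_noms
  | and B C hB hC => exact hB.union hC
  | or B C hB hC => exact hB.union hC
  | ex B hB => exact hB
  | nabla B hB => exact hB

theorem HTm.exists_noms_subset {Γ : List L.Ty} {τ : L.Ty} (t : HTm L Γ τ) :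
    ∃ l : List L.AnyNom, ∀ a ∈ t.noms, a ∈ l :=
  ⟨t.finite_noms.toFinset.toList, by simp⟩

theorem HFm.exists_noms_subset {Γ : List L.Ty} (B : HFm L Γ) :
    ∃ l : List L.AnyNom, ∀ a ∈ B.noms, a ∈ l :=
  ⟨B.finite_noms.toFinset.toList, by simp⟩

end LambdaCalculus

section Model

variable {S : NSig.{u}}

/-! ### Environments for names -/

/-- Environments: maps that send names to names of the same type. -/
abbrev NSig.Env (S : NSig.{u}) : Type u := ∀ ν : S.NameTy, S.Name ν → S.Name ν

theorem NSig.Env.ext {s s' : S.Env} (h : ∀ a : S.AnyName, s a.1 a.2 = s' a.1 a.2) : s = s' :=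
  funext fun ν => funext fun a => h ⟨ν, a⟩

/-- The action of an environment on names of arbitrary type. -/
def NSig.Env.app (s : S.Env) (a : S.AnyName) : S.AnyName := ⟨a.1, s a.1 a.2⟩

open Classical in
/-- The environment that sends `a` to `d` and agrees with `s` elsewhere. -/
noncomputable def NSig.Env.upd (s : S.Env) (a : S.AnyName) (d : S.Name a.1) : S.Env :=
  Function.update s a.1 (Function.update (s a.1) a.2 d)

theorem NSig.Env.upd_self (s : S.Env) (a : S.AnyName) (d : S.Name a.1) : s.upd a d a.1 a.2 = d := by
  simp [NSig.Env.upd]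

theorem NSig.Env.upd_mk (s : S.Env) {ν : S.NameTy} (a : S.Name ν) (d : S.Name ν) :
    s.upd ⟨ν, a⟩ d ν a = d := s.upd_self ⟨ν, a⟩ d

theorem NSig.Env.upd_ne (s : S.Env) {a b : S.AnyName} (d : S.Name a.1) (h : b ≠ a) :
    s.upd a d b.1 b.2 = s b.1 b.2 := by
  classical
  obtain ⟨ν, a⟩ := a
  obtain ⟨μ, b⟩ := b
  by_cases hμ : μ = ν
  · subst hμ
    have : b ≠ a := fun h' => h (h' ▸ rfl)
    simp [NSig.Env.upd, this]
  · simp [NSig.Env.upd, hμ]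

theorem NSig.Env.upd_eq_self (s : S.Env) (a : S.AnyName) : s.upd a (s a.1 a.2) = s :=
  NSig.Env.ext fun b => by
    by_cases h : b = a
    · subst h; exact s.upd_self _ _
    · exact s.upd_ne _ h

open Classical in
/-- The environment that agrees with `e` on the list `as` and with `s` elsewhere. -/
noncomputable def NSig.Env.mix (as : List S.AnyName) (e s : S.Env) : S.Env :=
  fun ν a => if (⟨ν, a⟩ : S.AnyName) ∈ as then e ν a else s ν a

theorem NSig.Env.mix_mem {as : List S.AnyName} (e s : S.Env) {a : S.AnyName} (h : a ∈ as) :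
    NSig.Env.mix as e s a.1 a.2 = e a.1 a.2 := if_pos h

theorem NSig.Env.mix_notMem {as : List S.AnyName} (e s : S.Env) {a : S.AnyName} (h : a ∉ as) :
    NSig.Env.mix as e s a.1 a.2 = s a.1 a.2 := if_neg h

theorem NSig.Env.mix_self (as : List S.AnyName) (s : S.Env) : NSig.Env.mix as s s = s :=
  funext fun _ => funext fun _ => ite_self _

theorem NSig.Env.mix_upd (as : List S.AnyName) (e s : S.Env) {a : S.AnyName} (d : S.Name a.1)
    (h : a ∈ as) : (NSig.Env.mix as e s).upd a d = NSig.Env.mix as (e.upd a d) s :=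
  NSig.Env.ext fun b => by
    by_cases hb : b = a
    · subst hb; rw [NSig.Env.upd_self, NSig.Env.mix_mem _ _ h, NSig.Env.upd_self]
    · rw [NSig.Env.upd_ne _ _ hb]
      by_cases hb' : b ∈ as
      · rw [NSig.Env.mix_mem _ _ hb', NSig.Env.mix_mem _ _ hb', NSig.Env.upd_ne _ _ hb]
      · rw [NSig.Env.mix_notMem _ _ hb', NSig.Env.mix_notMem _ _ hb']

theorem NSig.swapping_left {ν : S.NameTy} (a b : S.Name ν) : S.swapping a b ν a = b := by
  simp [NSig.swapping]

theorem NSig.swapping_right {ν : S.NameTy} (a b : S.Name ν) : S.swapping a b ν b = a := by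
  simp [NSig.swapping]

theorem NSig.swapping_of_ne {ν : S.NameTy} (a b : S.Name ν) {c : S.AnyName} (ha : c ≠ ⟨ν, a⟩)
    (hb : c ≠ ⟨ν, b⟩) : S.swapping a b c.1 c.2 = c.2 := by
  classical
  obtain ⟨μ, c⟩ := c
  by_cases hμ : μ = ν
  · subst hμ
    have ha' : c ≠ a := fun h => ha (h ▸ rfl)
    have hb' : c ≠ b := fun h => hb (h ▸ rfl)
    simp [NSig.swapping, Equiv.swap_apply_of_ne_of_ne ha' hb']
  · simp [NSig.swapping, Pi.mulSingle_eq_of_ne hμ]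

/-! ### A set-theoretic model of the λ-calculus -/

/-- Well-founded trees: first-order terms in which an abstraction over names is a function on
names. -/
inductive Tree (S : NSig.{u}) : Type u
  | name (a : S.AnyName)
  | fn (f : S.Fn) (ts : Fin (S.fnArity f) → Tree S)
  | abs (ν : S.NameTy) (g : S.Name ν → Tree S)

/-- The interpretation of types: nominal types consist of the names, data types of all trees, and
function types of all functions. -/
def Dom (S : NSig.{u}) : STy (S.NameTy ⊕ S.DataTy) → Type u
  | .base (.inl ν) => S.Name ν
  | .base (.inr _) => Tree S
  | .arr σ τ => Dom S σ → Dom S τ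

/-- The types of the form `φ(τ)` embed into trees. -/
def reify : ∀ τ : S.Ty, Dom S (trTy τ) → Tree S
  | .name ν, a => .name ⟨ν, a⟩
  | .data _, t => t
  | .abs ν τ, g => .abs ν fun c => reify τ (g c)

theorem reify_injective : ∀ τ : S.Ty, Function.Injective (reify τ)
  | .name ν, a, b, h => by
    have h' : (⟨ν, a⟩ : S.AnyName) = ⟨ν, b⟩ := Tree.name.inj h
    cases h'; rfl
  | .data _, _, _, h => h
  | .abs ν τ, f, g, h => funext fun c =>
    reify_injective τ (congrFun (eq_of_heq (Tree.abs.inj h).2) c)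

/-- Currying of functions of several arguments. -/
def curry : ∀ {n : ℕ} (σ : Fin n → S.target.Ty) (τ : S.target.Ty),
    ((∀ i, Dom S (σ i)) → Dom S τ) → Dom S (STy.arrows σ τ)
  | 0, _, _, h => h fun i => i.elim0
  | _ + 1, σ, τ, h => fun d => curry (fun i => σ i.succ) τ fun us => h (Fin.cons d us)

/-- Interpretation of λ-terms in an environment `s` for the nominal constants and an assignment `γ`
for the variables. -/
def sem : ∀ {Γ : List S.target.Ty} {τ : S.target.Ty}, HTm S.target Γ τ → S.Env →
    (∀ τ, Ix Γ τ → Dom S τ) → Dom S τ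
  | _, _, .var x, _, γ => γ _ x
  | _, _, .con f, _, _ => curry _ (.base (.inr (S.fnRes f)))
      fun us => Tree.fn f fun i => reify (S.fnArg f i) (us i)
  | _, _, .nom a, s, _ => s _ a
  | _, _, .app t u, s, γ => (sem t s γ : Dom S _ → Dom S _) (sem u s γ)
  | _, _, .lam t, s, γ => fun d => sem t s (Ix.cons (C := Dom S) d γ)

/-- Interpretation of closed λ-terms. -/
def sem₀ {τ : S.target.Ty} (t : HTm S.target [] τ) (s : S.Env) : Dom S τ :=
  sem t s fun _ i => i.elim

theorem sem_apps {Γ : List S.target.Ty} (s : S.Env) (γ : ∀ τ, Ix Γ τ → Dom S τ) {τ : S.target.Ty} :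
    ∀ {n : ℕ} {σ : Fin n → S.target.Ty} (t : HTm S.target Γ (STy.arrows σ τ))
      (us : ∀ i, HTm S.target Γ (σ i)) (h : (∀ i, Dom S (σ i)) → Dom S τ),
      sem t s γ = curry σ τ h → sem (HTm.apps t us) s γ = h fun i => sem (us i) s γ
  | 0, _, t, us, h, ht => by
    refine (show sem (HTm.apps t us) s γ = _ from ht).trans (congrArg h ?_)
    funext i; exact i.elim0
  | n + 1, σ, t, us, h, ht => by
    refine (sem_apps s γ (.app t (us 0)) (fun i => us i.succ)
      (fun vs => h (Fin.cons (sem (us 0) s γ) vs)) (congrFun ht (sem (us 0) s γ))).trans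
      (congrArg h ?_)
    funext i
    refine Fin.cases ?_ (fun i => ?_) i <;> rfl

theorem sem_apps_con {Γ : List S.target.Ty} (s : S.Env) (γ : ∀ τ, Ix Γ τ → Dom S τ) (f : S.Fn)
    (us : ∀ i, HTm S.target Γ (trTy (S.fnArg f i))) :
    sem (HTm.apps (.con (L := S.target) f) us) s γ =
      Tree.fn f fun i => reify (S.fnArg f i) (sem (us i) s γ) :=
  sem_apps s γ (HTm.con (L := S.target) f) us _ rfl

theorem sem_rename {Γ : List S.target.Ty} {τ : S.target.Ty} (t : HTm S.target Γ τ) :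
    ∀ {Γ' : List S.target.Ty} (r : ∀ τ, Ix Γ τ → Ix Γ' τ) (s : S.Env)
      (γ : ∀ τ, Ix Γ' τ → Dom S τ), sem (t.rename r) s γ = sem t s fun τ i => γ τ (r τ i) := by
  induction t with
  | var x => intros; rfl
  | con c => intros; rfl
  | nom a => intros; rfl
  | app t u ht hu => intro _ r s γ; simp only [HTm.rename, sem, ht, hu]
  | lam t ht =>
    intro _ r s γ
    simp only [HTm.rename, sem, ht]
    funext d
    congr 1
    funext τ i
    cases i <;> rfl

theorem sem_weaken {Γ : List S.target.Ty} {σ τ : S.target.Ty} (t : HTm S.target Γ τ) (s : S.Env)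
    (γ : ∀ τ, Ix Γ τ → Dom S τ) (d : Dom S σ) :
    sem (t.weaken (σ := σ)) s (Ix.cons (C := Dom S) d γ) = sem t s γ :=
  sem_rename t _ s _

theorem sem_bind {Γ : List S.target.Ty} {τ : S.target.Ty} (t : HTm S.target Γ τ) :
    ∀ {Γ' : List S.target.Ty} (θ : ∀ τ, Ix Γ τ → HTm S.target Γ' τ)
      (n : ∀ ν, S.Name ν → HTm S.target Γ' (.base (.inl ν))) (s : S.Env)
      (γ : ∀ τ, Ix Γ' τ → Dom S τ),
      sem (t.bind θ n) s γ = sem t (fun ν a => sem (n ν a) s γ) fun τ i => sem (θ τ i) s γ := by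
  induction t with
  | var x => intros; rfl
  | con c => intros; rfl
  | nom a => intros; rfl
  | app t u ht hu => intro _ θ n s γ; simp only [HTm.bind, sem, ht, hu]
  | lam t ht =>
    intro _ θ n s γ
    simp only [HTm.bind, sem]
    funext d
    refine (ht _ _ s _).trans ?_
    simp only [sem_weaken]
    congr 1
    funext τ i
    cases i with
    | z => rfl
    | s i => exact sem_weaken _ _ _ _

theorem sem_congr {Γ : List S.target.Ty} {τ : S.target.Ty} (t : HTm S.target Γ τ) {s s' : S.Env} :
    ∀ {γ : ∀ τ, Ix Γ τ → Dom S τ}, (∀ a ∈ t.noms, s a.1 a.2 = s' a.1 a.2) →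
      sem t s γ = sem t s' γ := by
  induction t with
  | var x => intros; rfl
  | con c => intros; rfl
  | nom a => intro γ h; exact h ⟨_, a⟩ rfl
  | app t u ht hu =>
    intro γ h
    simp only [sem, ht fun a ha => h a (.inl ha), hu fun a ha => h a (.inr ha)]
  | lam t ht => intro γ h; exact funext fun d => ht h

theorem sem_inst {Γ : List S.target.Ty} {σ τ : S.target.Ty} (t : HTm S.target (σ :: Γ) τ)
    (u : HTm S.target Γ σ) (s : S.Env) (γ : ∀ τ, Ix Γ τ → Dom S τ) :
    sem (t.inst u) s γ = sem t s (Ix.cons (C := Dom S) (sem u s γ) γ) := by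
  refine (sem_bind t _ _ s γ).trans ?_
  congr 1
  funext τ i
  cases i <;> rfl

/-- Convertible terms are equal in the model. -/
theorem HTm.Conv.sem_eq {Γ : List S.target.Ty} {τ : S.target.Ty} {t u : HTm S.target Γ τ}
    (h : HTm.Conv t u) (s : S.Env) : ∀ γ : ∀ τ, Ix Γ τ → Dom S τ, sem t s γ = sem u s γ := by
  induction h with
  | refl t => intro γ; rfl
  | symm _ ih => intro γ; exact (ih γ).symm
  | trans _ _ ih ih' => intro γ; exact (ih γ).trans (ih' γ)
  | app _ _ ih ih' => intro γ; simp only [sem, ih, ih']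
  | lam _ ih => intro γ; exact funext fun d => ih _
  | beta t u => intro γ; exact (sem_inst t u s γ).symm
  | eta t => intro γ; exact funext fun d => by simp only [sem, sem_weaken]; rfl

theorem sem_absNom {Γ : List S.target.Ty} {τ : S.target.Ty} (a : S.AnyName)
    (t : HTm S.target Γ τ) (s : S.Env) (γ : ∀ τ, Ix Γ τ → Dom S τ) (d : S.Name a.1) :
    sem (HTm.absNom (L := S.target) a t) s (Ix.cons (C := Dom S) (σ := .base (.inl a.1)) d γ) =
      sem t (s.upd a d) γ := by
  refine (sem_bind t _ _ s _).trans ?_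
  congr 1
  refine NSig.Env.ext fun b => ?_
  obtain ⟨ν, a⟩ := a
  by_cases hb : b = ⟨ν, a⟩
  · subst hb
    rw [NSig.Env.upd_mk]
    simp only [absMap, Function.update_self]
    rfl
  · rw [NSig.Env.upd_ne _ _ hb]
    obtain ⟨μ, b⟩ := b
    by_cases hμ : μ = ν
    · subst hμ
      have : b ≠ a := fun h => hb (h ▸ rfl)
      simp [absMap, sem, this]
    · simp [absMap, sem, hμ]

theorem sem_swapNom {Γ : List S.target.Ty} {τ : S.target.Ty} {ν : S.NameTy} (a b : S.Name ν)
    (t : HTm S.target Γ τ) (s : S.Env) (γ : ∀ τ, Ix Γ τ → Dom S τ) :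
    sem (HTm.swapNom a b t) s γ = sem t (fun μ c => s μ (S.swapping a b μ c)) γ :=
  sem_bind t _ _ s γ

/-! ### Ground nominal terms in the model -/

/-- The tree that a ground nominal term denotes in an environment. -/
noncomputable def Val.tree : ∀ {τ : S.Ty}, Val S τ → S.Env → Tree S
  | _, .name a, s => .name ⟨_, s _ a⟩
  | _, .fn f ts, s => .fn f fun i => (ts i).tree s
  | _, .abs (ν := ν) a t, s => .abs ν fun c => t.tree (s.upd ⟨ν, a⟩ c)

theorem Val.tree_act (π : S.NPerm) {τ : S.Ty} (v : Val S τ) :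
    ∀ s : S.Env, (v.act π).tree s = v.tree fun ν a => s ν (π ν a) := by
  induction v with
  | name a => intro s; rfl
  | fn f ts ih => intro s; simp only [Val.act, Val.tree, ih]
  | @abs ν τ a t ih =>
    intro s
    simp only [Val.act, Val.tree, ih]
    congr 1
    funext c
    congr 1
    refine NSig.Env.ext fun b => ?_
    by_cases hb : b = ⟨ν, a⟩
    · subst hb; rw [NSig.Env.upd_mk, NSig.Env.upd_mk]
    · rw [NSig.Env.upd_ne _ _ hb]
      refine s.upd_ne (a := ⟨ν, π ν a⟩) (b := ⟨b.1, π b.1 b.2⟩) c fun h => hb ?_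
      obtain ⟨μ, b⟩ := b
      cases (Sigma.mk.inj h).1
      cases (π _).injective (eq_of_heq (Sigma.mk.inj h).2)
      rfl

theorem Val.Fresh.tree_eq {a : S.AnyName} {τ : S.Ty} {v : Val S τ} (h : Val.Fresh a v) :
    ∀ {s s' : S.Env}, (∀ b : S.AnyName, b ≠ a → s b.1 b.2 = s' b.1 b.2) → v.tree s = v.tree s' := by
  have upd : ∀ {s s' : S.Env} {b : S.AnyName} (c : S.Name b.1) {d : S.AnyName},
      (d ≠ b → s d.1 d.2 = s' d.1 d.2) → s.upd b c d.1 d.2 = s'.upd b c d.1 d.2 := by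
    intro s s' b c d h
    by_cases hd : d = b
    · subst hd; simp only [NSig.Env.upd_self]
    · simp only [NSig.Env.upd_ne _ _ hd, h hd]
  induction h with
  | @name ν b h => intro s s' hs; simp only [Val.tree, hs ⟨ν, b⟩ h.symm]
  | fn h ih => intro s s' hs; simp only [Val.tree, fun i => ih i hs]
  | @abs_same ν τ b t h =>
    intro s s' hs
    subst h
    simp only [Val.tree]
    congr 1; funext c; congr 1
    exact NSig.Env.ext fun d => upd c fun hd => hs d hd
  | abs h ht ih =>
    intro s s' hs
    simp only [Val.tree]
    congr 1; funext c
    exact ih fun d hd => upd (b := ⟨_, _⟩) c fun _ => hs d hd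

theorem Val.fresh_of_tree {a : S.AnyName} {τ : S.Ty} {v : Val S τ}
    (h : ∀ (s : S.Env) (d : S.Name a.1), v.tree (s.upd a d) = v.tree s) : Val.Fresh a v := by
  induction v with
  | @name ν b =>
    refine .name ?_
    rintro rfl
    obtain ⟨d, hd⟩ := S.exists_fresh ν [⟨ν, b⟩]
    have h' := Tree.name.inj (h (fun _ c => c) d)
    rw [NSig.Env.upd_mk] at h'
    exact hd (by simp [h'])
  | fn f ts ih =>
    exact .fn fun i => ih i fun s d => congrFun (eq_of_heq (Tree.fn.inj (h s d)).2) i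
  | @abs ν τ b t ih =>
    by_cases hb : a = ⟨ν, b⟩
    · exact .abs_same hb
    · refine .abs hb (ih fun s d => ?_)
      have h' := congrFun (eq_of_heq (Tree.abs.inj (h s d)).2) (s ν b)
      have h₁ := (s.upd a d).upd_eq_self ⟨ν, b⟩
      have h₂ := s.upd_eq_self ⟨ν, b⟩
      rw [NSig.Env.upd_ne (b := ⟨ν, b⟩) _ _ (Ne.symm hb)] at h₁
      simp only at h₁ h₂
      rwa [h₁, h₂] at h'

theorem Val.Eqv.tree_eq {τ : S.Ty} {v w : Val S τ} (h : Val.Eqv v w) :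
    ∀ s : S.Env, v.tree s = w.tree s := by
  induction h with
  | name a => intro s; rfl
  | fn h ih => intro s; simp only [Val.tree, fun i => ih i s]
  | abs_same a h ih => intro s; simp only [Val.tree, ih]
  | @abs ν τ a b t u hf h ih =>
    intro s
    simp only [Val.tree, ih, Val.tree_act]
    congr 1
    funext c
    refine hf.tree_eq fun d hd => ?_
    by_cases hb : d = ⟨ν, b⟩
    · subst hb
      simp only [NSig.swapping_right, NSig.Env.upd_mk]
    · rw [NSig.Env.upd_ne _ _ hb, NSig.swapping_of_ne a b hd hb, NSig.Env.upd_ne _ _ hd]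

theorem Val.eqv_of_tree {τ : S.Ty} (v : Val S τ) : ∀ {τ' : S.Ty} (w : Val S τ') (h : τ' = τ),
    (∀ s : S.Env, v.tree s = w.tree s) → Val.Eqv v (h ▸ w) := by
  induction v with
  | @name ν a =>
    intro τ' w h hs
    cases w with
    | name b =>
      cases h
      have h' := Tree.name.inj (hs fun _ c => c)
      cases h'
      exact .name a
    | fn g us => cases h
    | abs b u => cases h
  | fn f ts ih =>
    intro τ' w h hs
    cases w with
    | name b => cases h
    | fn g us =>
      have hfg := (Tree.fn.inj (hs fun _ c => c)).1
      subst hfg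
      exact .fn fun i => ih i (us i) rfl fun s => congrFun (eq_of_heq (Tree.fn.inj (hs s)).2) i
    | abs b u => cases h
  | @abs ν τ a t ih =>
    intro τ' w h hs
    cases w with
    | name b => cases h
    | fn g us => cases h
    | @abs ν' τ'' b u =>
      cases h
      have hs' : ∀ (s : S.Env) (c : S.Name ν), t.tree (s.upd ⟨ν, a⟩ c) = u.tree (s.upd ⟨ν, b⟩ c) :=
        fun s c => congrFun (eq_of_heq (Tree.abs.inj (hs s)).2) c
      by_cases hab : a = b
      · subst hab
        refine .abs_same a (ih u rfl fun s => ?_)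
        have h' := hs' s (s ν a)
        have h₁ := s.upd_eq_self ⟨ν, a⟩
        simp only at h₁
        rwa [h₁] at h'
      · have hab' : (⟨ν, b⟩ : S.AnyName) ≠ ⟨ν, a⟩ := fun h' => hab (by cases h'; rfl)
        have hu : ∀ s : S.Env, u.tree s = t.tree (s.upd ⟨ν, a⟩ (s ν b)) := fun s => by
          have h₁ := s.upd_eq_self ⟨ν, b⟩
          simp only at h₁
          rw [hs', h₁]
        have hf : Val.Fresh ⟨ν, a⟩ u := Val.fresh_of_tree fun s d => by
          rw [hu, hu, NSig.Env.upd_ne (b := ⟨ν, b⟩) _ _ hab']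
          congr 1
          refine NSig.Env.ext fun c => ?_
          by_cases hc : c = ⟨ν, a⟩
          · subst hc; simp only [NSig.Env.upd_mk]
          · simp only [NSig.Env.upd_ne _ _ hc]
        refine .abs hf (ih _ rfl fun s => ?_)
        have h' := hs' s (s ν a)
        have h₁ := s.upd_eq_self ⟨ν, a⟩
        simp only at h₁
        rw [h₁] at h'
        rw [h', Val.tree_act]
        refine hf.tree_eq fun c hc => ?_
        by_cases hb : c = ⟨ν, b⟩
        · subst hb; rw [NSig.Env.upd_mk, NSig.swapping_right]
        · rw [NSig.Env.upd_ne _ _ hb, NSig.swapping_of_ne a b hc hb]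

end Model

section Normalization

/-! ### Ground nominal terms as λ-terms -/

theorem absMap_self {L : HSig.{u}} (a : L.AnyNom) (Γ : List L.Ty) :
    absMap L a Γ a.1 a.2 = .var .z := by
  simp [absMap]

theorem absMap_of_ne {L : HSig.{u}} {a b : L.AnyNom} (h : b ≠ a) (Γ : List L.Ty) :
    absMap L a Γ b.1 b.2 = .nom b.2 := by
  classical
  obtain ⟨ν, a⟩ := a
  obtain ⟨μ, b⟩ := b
  by_cases hμ : μ = ν
  · subst hμ
    have : b ≠ a := fun h' => h (h' ▸ rfl)
    simp [absMap, this]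
  · simp [absMap, hμ]

theorem HTm.apps_bind {L : HSig.{u}} {Γ Γ' : List L.Ty} {τ : L.Ty}
    (θ : ∀ τ, Ix Γ τ → HTm L Γ' τ) (m : ∀ ν, L.Nom ν → HTm L Γ' (L.nomTy ν)) :
    ∀ {n : ℕ} {σ : Fin n → L.Ty} (t : HTm L Γ (STy.arrows σ τ)) (us : ∀ i, HTm L Γ (σ i)),
      (HTm.apps t us).bind θ m = HTm.apps (t.bind θ m) fun i => (us i).bind θ m
  | 0, _, _, _ => rfl
  | _ + 1, _, t, us => HTm.apps_bind θ m (.app t (us 0)) fun i => us i.succ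

variable {S : NSig.{u}}

/-- The translation of ground nominal terms without swappings. -/
noncomputable def Val.toHTm : ∀ {τ : S.Ty}, Val S τ → HTm S.target [] (trTy τ)
  | _, .name a => .nom (L := S.target) a
  | _, .fn f ts => HTm.apps (.con (L := S.target) f) fun i => (ts i).toHTm
  | _, .abs (ν := ν) a t => .lam (HTm.absNom (L := S.target) ⟨ν, a⟩ t.toHTm)

/-- The translation of ground terms. -/
noncomputable def Tm.toHTm {τ : S.Ty} (t : Tm S [] [] τ) : HTm S.target [] (trTy τ) :=
  trTm (fun _ a => a.get) (fun _ i => i.elim) t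

/-- Ground nominal terms without swappings are ground terms. -/
def Val.toTm : ∀ {τ : S.Ty}, Val S τ → Tm S [] [] τ
  | _, .name a => .name (.free a)
  | _, .fn f ts => .fn f fun i => (ts i).toTm
  | _, .abs a t => .abs (.free a) t.toTm

theorem Val.eval_toTm {τ : S.Ty} (v : Val S τ) : v.toTm.eval = v := by
  induction v with
  | name a => rfl
  | fn f ts ih => simp only [Val.toTm, Tm.eval, ih]
  | abs a t ih => simp only [Val.toTm, Tm.eval, ih]; rfl

theorem Val.reify_sem {τ : S.Ty} (v : Val S τ) :
    ∀ s : S.Env, reify τ (sem₀ v.toHTm s) = v.tree s := by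
  induction v with
  | name a => intro s; rfl
  | fn f ts ih =>
    intro s
    exact (sem_apps_con s _ f _).trans (congrArg (Tree.fn f) (funext fun i => ih i s))
  | @abs ν τ a t ih =>
    intro s
    refine congrArg (Tree.abs ν) (funext fun c => ?_)
    rw [← ih]
    exact congrArg (reify τ) (sem_absNom (S := S) ⟨ν, a⟩ t.toHTm s _ c)

theorem Tm.reify_sem {τ : S.Ty} (t : Tm S [] [] τ) (s : S.Env) :
    reify τ (sem₀ t.toHTm s) = t.eval.tree s := by
  have aux : ∀ {Γ : List S.Ty} {τ : S.Ty} (t : Tm S [] Γ τ) (hΓ : Γ = []) (s : S.Env),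
      reify τ (sem₀ (hΓ ▸ t).toHTm s) = (hΓ ▸ t : Tm S [] [] τ).eval.tree s := by
    intro Γ τ t
    induction t with
    | name a => intro hΓ s; subst hΓ; rfl
    | var X => intro hΓ s; subst hΓ; exact X.elim
    | fn f ts ih =>
      intro hΓ s
      subst hΓ
      exact (sem_apps_con s _ f _).trans (congrArg (Tree.fn f) (funext fun i => ih i rfl s))
    | swap a b t ih =>
      intro hΓ s
      subst hΓ
      refine (congrArg _ (sem_swapNom (S := S) a.get b.get _ s _)).trans ((ih rfl _).trans ?_)
      exact (Val.tree_act _ _ _).symm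
    | @abs ν τ a t ih =>
      intro hΓ s
      subst hΓ
      refine congrArg (Tree.abs ν) (funext fun c => ?_)
      rw [← ih rfl]
      exact congrArg (reify τ) (sem_absNom (S := S) ⟨ν, a.get⟩ _ s _ c)
  exact aux t rfl s

theorem Val.notMem_noms {a : S.AnyName} {τ : S.Ty} {v : Val S τ} (h : Val.Fresh a v) :
    a ∉ v.toHTm.noms := by
  induction h with
  | name h => exact h
  | fn h ih =>
    intro h'
    rcases HTm.noms_apps _ _ h' with h' | ⟨i, h'⟩
    · exact h'
    · exact ih i h'
  | abs_same h => exact fun h' => (HTm.noms_absNom (L := S.target) _ h').2 h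
  | abs h ht ih => exact fun h' => ih (HTm.noms_absNom (L := S.target) _ h').1

theorem HTm.mapNom_lam {L : HSig.{u}} (m : ∀ ν, L.Nom ν → L.Nom ν) {Γ : List L.Ty} {σ τ : L.Ty}
    (t : HTm L (σ :: Γ) τ) : (HTm.lam t).mapNom m = .lam (t.mapNom m) := by
  simp only [HTm.mapNom, HTm.bind, HTm.liftSub_var]; rfl

theorem Val.toHTm_act (π : S.NPerm) {τ : S.Ty} (v : Val S τ) :
    (v.act π).toHTm = HTm.mapNom (L := S.target) (fun ν => π ν) v.toHTm := by
  induction v with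
  | name a => rfl
  | fn f ts ih =>
    simp only [Val.act, Val.toHTm, ih]
    exact (HTm.apps_bind (L := S.target) (fun _ i => .var i)
      (fun ν a => HTm.nom (L := S.target) (π ν a)) (.con (L := S.target) f) _).symm
  | @abs ν τ a t ih =>
    simp only [Val.act, Val.toHTm, ih]
    refine .trans (congrArg HTm.lam ?_) (HTm.mapNom_lam (L := S.target) _ _).symm
    simp only [HTm.absNom, HTm.mapNom]
    refine (HTm.bind_bind _ _ _ _ _).trans (.trans ?_ (HTm.bind_bind _ _ _ _ _).symm)
    refine HTm.bind_congr _ fun b _ => ?_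
    by_cases hb : b = ⟨ν, a⟩
    · subst hb
      rw [absMap_self]
      exact absMap_self (L := S.target) ⟨ν, π ν a⟩ _
    · rw [absMap_of_ne hb]
      refine absMap_of_ne (L := S.target) (a := ⟨ν, π ν a⟩) (b := ⟨b.1, π b.1 b.2⟩) (fun h => hb ?_) _
      obtain ⟨μ, b⟩ := b
      cases (Sigma.mk.inj h).1
      cases (π _).injective (eq_of_heq (Sigma.mk.inj h).2)
      rfl

theorem Val.Eqv.toHTm_eq {τ : S.Ty} {v w : Val S τ} (h : Val.Eqv v w) : v.toHTm = w.toHTm := by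
  induction h with
  | name a => rfl
  | fn h ih => simp only [Val.toHTm, ih]
  | @abs_same ν τ a t u h ih => exact congrArg (fun w => (HTm.absNom (L := S.target) ⟨ν, a⟩ w).lam) ih
  | @abs ν τ a b t u hf h ih =>
    simp only [Val.toHTm, ih, Val.toHTm_act]
    congr 1
    refine (HTm.bind_bind _ _ _ _ _).trans (HTm.bind_congr _ fun c hc => ?_)
    have hca : c ≠ ⟨ν, a⟩ := fun h => Val.notMem_noms hf (h ▸ hc)
    show absMap S.target ⟨ν, a⟩ [] c.1 (S.swapping a b c.1 c.2) = _
    by_cases hb : c = ⟨ν, b⟩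
    · subst hb
      rw [absMap_self]
      simp only [NSig.swapping_right]
      exact absMap_self (L := S.target) ⟨ν, a⟩ _
    · rw [NSig.swapping_of_ne a b hca hb, absMap_of_ne hca, absMap_of_ne hb]

/-! ### Normalization of closed terms -/

/-- Reducibility of closed terms: at base types, being convertible to a name or to a translated
ground term; at function types, preservation of reducibility. -/
def Red : ∀ τ : STy (S.NameTy ⊕ S.DataTy), HTm S.target [] τ → Prop
  | .base (.inl ν), t => ∃ a : S.Name ν, HTm.Conv t (.nom (L := S.target) a)
  | .base (.inr δ), t => ∃ v : Val S (.data δ), HTm.Conv t v.toHTm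
  | .arr σ τ, t => ∀ u : HTm S.target [] σ, Red σ u → Red τ (.app t u)

theorem Red.conv : ∀ {τ : STy (S.NameTy ⊕ S.DataTy)} {t u : HTm S.target [] τ},
    HTm.Conv t u → Red τ u → Red τ t
  | .base (.inl _), _, _, h, ⟨a, ha⟩ => ⟨a, h.trans ha⟩
  | .base (.inr _), _, _, h, ⟨v, hv⟩ => ⟨v, h.trans hv⟩
  | .arr _ _, _, _, h, hu => fun v hv => Red.conv (.app h (.refl v)) (hu v hv)

/-- A reducible term of a translated type is convertible to a translated ground term. At function
types, the body of the abstraction is obtained by application to a name that is not in the term. -/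
theorem Red.exists_val : ∀ (τ : S.Ty) {t : HTm S.target [] (trTy τ)}, Red (trTy τ) t →
    ∃ v : Val S τ, HTm.Conv t v.toHTm
  | .name _, _, ⟨a, ha⟩ => ⟨.name a, ha⟩
  | .data _, _, h => h
  | .abs ν τ, t, h => by
    obtain ⟨l, hl⟩ := HTm.exists_noms_subset t
    obtain ⟨a, ha⟩ := S.exists_fresh ν l
    obtain ⟨v, hv⟩ := Red.exists_val τ (h (.nom (L := S.target) a) ⟨a, .refl _⟩)
    refine ⟨.abs a v, .trans (.symm ?_) (.lam (hv.bind _ _))⟩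
    have ht : t.bind (fun _ i => .var (.s i)) (absMap S.target ⟨ν, a⟩ []) =
        HTm.weaken (L := S.target) (σ := .base (.inl ν)) t := by
      rw [HTm.weaken, HTm.rename_eq_bind]
      refine t.bind_congr fun b hb => absMap_of_ne ?_ _
      rintro rfl
      exact ha (hl _ hb)
    have h' : HTm.absNom (L := S.target) ⟨ν, a⟩ (.app t (.nom (L := S.target) a)) =
        .app (HTm.weaken (L := S.target) (σ := .base (.inl ν)) t) (.var .z) :=
      congrArg₂ HTm.app ht (absMap_self (L := S.target) ⟨ν, a⟩ _)
    rw [← HTm.absNom, h']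
    exact .eta t

theorem red_of_apps : ∀ {n : ℕ} {σ : Fin n → STy (S.NameTy ⊕ S.DataTy)}
    {τ : STy (S.NameTy ⊕ S.DataTy)} {t : HTm S.target [] (STy.arrows σ τ)},
    (∀ us : ∀ i, HTm S.target [] (σ i), (∀ i, Red (σ i) (us i)) → Red τ (HTm.apps t us)) →
      Red (STy.arrows σ τ) t
  | 0, _, _, _, h => h (fun i => i.elim0) fun i => i.elim0
  | _ + 1, _, _, _, h => fun u hu => red_of_apps fun us hus =>
    h (Fin.cons u us) (Fin.cases hu hus)

theorem HTm.red_subst {Γ : List S.target.Ty} {τ : S.target.Ty} (t : HTm S.target Γ τ) :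
    ∀ θ : ∀ τ, Ix Γ τ → HTm S.target [] τ, (∀ τ i, Red τ (θ τ i)) → Red τ (t.subst θ) := by
  induction t with
  | var x => intro θ h; exact h _ x
  | con f =>
    intro θ _
    refine red_of_apps fun us hus => ?_
    choose vs hvs using fun i => Red.exists_val (S.fnArg f i) (hus i)
    exact ⟨.fn f vs, .apps (.refl _) hvs⟩
  | nom a => intro θ _; exact ⟨a, .refl _⟩
  | app t u ht hu => intro θ h; exact ht θ h _ (hu θ h)
  | lam t ht =>
    intro θ h u hu
    refine Red.conv (.beta _ _) ?_
    have := t.bind_liftSub_inst θ (fun _ a => .nom a) u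
    refine this ▸ ht (Ix.cons u θ) ?_
    rintro _ (_ | i)
    · exact hu
    · exact h _ i

/-- Every closed term of a translated type is convertible to a translated ground term. -/
theorem HTm.exists_conv_val {τ : S.Ty} (t : HTm S.target [] (trTy τ)) :
    ∃ v : Val S τ, HTm.Conv t v.toHTm := by
  have h := t.red_subst (fun _ i => i.elim) fun _ i => i.elim
  have ht : t.subst (fun _ i => i.elim) = t := by
    refine .trans ?_ t.bind_id
    rw [HTm.subst]
    congr 1
    funext _ i
    exact i.elim
  exact Red.exists_val τ (ht ▸ h)

/-- Closed terms of a translated type that are equal in the model are convertible. -/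
theorem HTm.conv_of_sem {τ : S.Ty} {t u : HTm S.target [] (trTy τ)}
    (h : ∀ s : S.Env, sem₀ t s = sem₀ u s) : HTm.Conv t u := by
  obtain ⟨v, hv⟩ := t.exists_conv_val
  obtain ⟨w, hw⟩ := u.exists_conv_val
  have hvw : Val.Eqv v w := Val.eqv_of_tree v w rfl fun s => by
    rw [← Val.reify_sem, ← Val.reify_sem]
    exact congrArg _ ((hv.sem_eq s _).symm.trans ((h s).trans (hw.sem_eq s _)))
  exact hv.trans (hvw.toHTm_eq ▸ hw.symm)

theorem Tm.conv_toHTm {τ : S.Ty} (t : Tm S [] [] τ) : HTm.Conv t.toHTm t.eval.toHTm :=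
  HTm.conv_of_sem fun s => reify_injective τ (by rw [Tm.reify_sem, Val.reify_sem])

theorem Tm.eqv_eval {τ : S.Ty} {t u : Tm S [] [] τ} :
    Val.Eqv t.eval u.eval ↔ ∀ s : S.Env, sem₀ t.toHTm s = sem₀ u.toHTm s := by
  constructor
  · intro h s
    exact reify_injective τ (by rw [Tm.reify_sem, Tm.reify_sem, h.tree_eq])
  · intro h
    exact Val.eqv_of_tree _ _ rfl fun s => by rw [← Tm.reify_sem, ← Tm.reify_sem, h]

end Normalization

section Source

variable {S : NSig.{u}}

/-! ### Renaming and substitution in αProlog -/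

theorem Nm.lift_weaken {Λ Λ' : List S.NameTy} (f : ∀ ν, Nm S Λ ν → Nm S Λ' ν) {μ ν : S.NameTy}
    (n : Nm S Λ ν) : Nm.lift f ν (n.weaken (μ := μ)) = (f ν n).weaken := by
  cases n <;> rfl

theorem Nm.inst_weaken {Λ : List S.NameTy} {μ ν : S.NameTy} (a : S.Name μ) (n : Nm S Λ ν) :
    Nm.inst a ν n.weaken = n := by
  cases n <;> rfl

theorem Nm.lift_lift {Λ Λ' Λ'' : List S.NameTy} (f : ∀ ν, Nm S Λ ν → Nm S Λ' ν)
    (g : ∀ ν, Nm S Λ' ν → Nm S Λ'' ν) {μ : S.NameTy} (ν : S.NameTy) (n : Nm S (μ :: Λ) ν) :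
    Nm.lift g ν (Nm.lift f ν n) = Nm.lift (fun ν n => g ν (f ν n)) ν n := by
  rcases n with a | (_ | i)
  · exact Nm.lift_weaken _ _
  · rfl
  · exact Nm.lift_weaken _ _

theorem Tm.mapName_mapName {Λ Λ' Λ'' : List S.NameTy} {Γ : List S.Ty} {τ : S.Ty} (t : Tm S Λ Γ τ)
    (f : ∀ ν, Nm S Λ ν → Nm S Λ' ν) (g : ∀ ν, Nm S Λ' ν → Nm S Λ'' ν) :
    (t.mapName f).mapName g = t.mapName fun ν n => g ν (f ν n) := by
  induction t with
  | name a => rfl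
  | var X => rfl
  | fn f ts ih => simp only [Tm.mapName, ih]
  | swap a b t ih => simp only [Tm.mapName, ih]
  | abs a t ih => simp only [Tm.mapName, ih]

theorem Tm.mapName_congr {Λ Λ' : List S.NameTy} {Γ : List S.Ty} {τ : S.Ty} {t : Tm S Λ Γ τ}
    {f g : ∀ ν, Nm S Λ ν → Nm S Λ' ν} (h : ∀ ν n, n.names ⊆ t.names → f ν n = g ν n) :
    t.mapName f = t.mapName g := by
  induction t with
  | name a => simp only [Tm.mapName, h _ a (List.Subset.refl _)]
  | var X => rfl
  | fn k ts ih =>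
    simp only [Tm.mapName]
    congr 1
    funext i
    exact ih i fun ν n hn => h ν n fun c hc =>
      List.mem_flatMap.2 ⟨i, List.mem_finRange i, hn hc⟩
  | swap a b t ih =>
    simp only [Tm.mapName, h _ a fun c hc => List.mem_append.2 (.inl (List.mem_append.2 (.inl hc))),
      h _ b fun c hc => List.mem_append.2 (.inl (List.mem_append.2 (.inr hc))),
      ih fun ν n hn => h ν n fun c hc => List.mem_append.2 (.inr (hn hc))]
  | abs a t ih =>
    simp only [Tm.mapName, h _ a fun c hc => List.mem_append.2 (.inl hc),
      ih fun ν n hn => h ν n fun c hc => List.mem_append.2 (.inr (hn hc))]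

theorem Tm.mapName_id {Λ : List S.NameTy} {Γ : List S.Ty} {τ : S.Ty} (t : Tm S Λ Γ τ) :
    (t.mapName fun _ n => n) = t := by
  induction t with
  | name a => rfl
  | var X => rfl
  | fn f ts ih => simp only [Tm.mapName, ih]
  | swap a b t ih => simp only [Tm.mapName, ih]
  | abs a t ih => simp only [Tm.mapName, ih]

theorem Tm.mapName_subst {Λ Λ' : List S.NameTy} {Γ Γ' : List S.Ty} {τ : S.Ty} (t : Tm S Λ Γ τ)
    (θ : ∀ τ, Ix Γ τ → Tm S Λ Γ' τ) (f : ∀ ν, Nm S Λ ν → Nm S Λ' ν) :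
    (t.subst θ).mapName f = (t.mapName f).subst fun τ i => (θ τ i).mapName f := by
  induction t with
  | name a => rfl
  | var X => rfl
  | fn f ts ih => simp only [Tm.mapName, Tm.subst, ih]
  | swap a b t ih => simp only [Tm.mapName, Tm.subst, ih]
  | abs a t ih => simp only [Tm.mapName, Tm.subst, ih]

theorem Tm.subst_subst {Λ : List S.NameTy} {Γ Γ' Γ'' : List S.Ty} {τ : S.Ty} (t : Tm S Λ Γ τ)
    (θ : ∀ τ, Ix Γ τ → Tm S Λ Γ' τ) (θ' : ∀ τ, Ix Γ' τ → Tm S Λ Γ'' τ) :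
    (t.subst θ).subst θ' = t.subst fun τ i => (θ τ i).subst θ' := by
  induction t with
  | name a => rfl
  | var X => rfl
  | fn f ts ih => simp only [Tm.subst, ih]
  | swap a b t ih => simp only [Tm.subst, ih]
  | abs a t ih => simp only [Tm.subst, ih]

theorem Tm.subst_var {Λ : List S.NameTy} {Γ : List S.Ty} {τ : S.Ty} (t : Tm S Λ Γ τ) :
    (t.subst fun _ i => .var i) = t := by
  induction t with
  | name a => rfl
  | var X => rfl
  | fn f ts ih => simp only [Tm.subst, ih]
  | swap a b t ih => simp only [Tm.subst, ih]
  | abs a t ih => simp only [Tm.subst, ih]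

theorem Tm.mapName_liftSub {Λ Λ' : List S.NameTy} {Γ Γ' : List S.Ty} {σ : S.Ty}
    (θ : ∀ τ, Ix Γ τ → Tm S Λ Γ' τ) (f : ∀ ν, Nm S Λ ν → Nm S Λ' ν) :
    (fun τ (i : Ix (σ :: Γ) τ) => (Tm.liftSub θ τ i).mapName f) =
      Tm.liftSub fun τ i => (θ τ i).mapName f := by
  funext τ i
  cases i with
  | z => rfl
  | s i => exact Tm.mapName_subst _ _ _

theorem Tm.liftSub_subst {Λ : List S.NameTy} {Γ Γ' Γ'' : List S.Ty} {σ : S.Ty}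
    (θ : ∀ τ, Ix Γ τ → Tm S Λ Γ' τ) (θ' : ∀ τ, Ix Γ' τ → Tm S Λ Γ'' τ) :
    (fun τ (i : Ix (σ :: Γ) τ) => (Tm.liftSub θ τ i).subst (Tm.liftSub θ')) =
      Tm.liftSub fun τ i => (θ τ i).subst θ' := by
  funext τ i
  cases i with
  | z => rfl
  | s i =>
    refine (Tm.subst_subst _ _ _).trans ?_
    exact (Tm.subst_subst _ θ' fun _ j => .var (.s j)).symm

theorem Goal.mapName_mapName {Λ : List S.NameTy} {Γ : List S.Ty} (G : Goal S Λ Γ) :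
    ∀ {Λ' Λ'' : List S.NameTy} (f : ∀ ν, Nm S Λ ν → Nm S Λ' ν) (g : ∀ ν, Nm S Λ' ν → Nm S Λ'' ν),
      (G.mapName f).mapName g = G.mapName fun ν n => g ν (f ν n) := by
  induction G with
  | top => intros; rfl
  | atom p ts => intros; simp only [Goal.mapName, Tm.mapName_mapName]
  | fresh a t => intros; simp only [Goal.mapName, Tm.mapName_mapName]
  | eq t u => intros; simp only [Goal.mapName, Tm.mapName_mapName]
  | and G H hG hH => intros; simp only [Goal.mapName, hG, hH]
  | or G H hG hH => intros; simp only [Goal.mapName, hG, hH]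
  | ex G hG => intros; simp only [Goal.mapName, hG]
  | new G hG => intros; simp only [Goal.mapName, hG, Nm.lift_lift]

theorem Goal.mapName_congr {Λ : List S.NameTy} {Γ : List S.Ty} (G : Goal S Λ Γ) :
    ∀ {Λ' : List S.NameTy} {f g : ∀ ν, Nm S Λ ν → Nm S Λ' ν},
      (∀ ν n, n.names ⊆ G.names → f ν n = g ν n) → G.mapName f = G.mapName g := by
  induction G with
  | top => intros; rfl
  | atom p ts =>
    intro _ f g h
    simp only [Goal.mapName]
    congr 1
    funext i
    exact Tm.mapName_congr fun ν n hn => h ν n fun c hc =>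
      List.mem_flatMap.2 ⟨i, List.mem_finRange i, hn hc⟩
  | fresh a t =>
    intro _ f g h
    simp only [Goal.mapName, h _ a fun c hc => List.mem_append.2 (.inl hc),
      Tm.mapName_congr fun ν n hn => h ν n fun c hc => List.mem_append.2 (.inr (hn hc))]
  | eq t u =>
    intro _ f g h
    simp only [Goal.mapName, Tm.mapName_congr (t := t) fun ν n hn => h ν n fun c hc =>
      List.mem_append.2 (.inl (hn hc)), Tm.mapName_congr (t := u) fun ν n hn => h ν n fun c hc =>
      List.mem_append.2 (.inr (hn hc))]
  | and G H hG hH =>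
    intro _ f g h
    simp only [Goal.mapName, hG fun ν n hn => h ν n fun c hc => List.mem_append.2 (.inl (hn hc)),
      hH fun ν n hn => h ν n fun c hc => List.mem_append.2 (.inr (hn hc))]
  | or G H hG hH =>
    intro _ f g h
    simp only [Goal.mapName, hG fun ν n hn => h ν n fun c hc => List.mem_append.2 (.inl (hn hc)),
      hH fun ν n hn => h ν n fun c hc => List.mem_append.2 (.inr (hn hc))]
  | ex G hG => intro _ f g h; simp only [Goal.mapName, hG h]
  | new G hG =>
    intro _ f g h
    refine congrArg Goal.new (hG fun ν n hn => ?_)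
    rcases n with a | (_ | i)
    · exact congrArg Nm.weaken (h _ (.free a) hn)
    · rfl
    · exact congrArg Nm.weaken (h _ (.bound i) (List.nil_subset _))

theorem Goal.mapName_subst {Λ : List S.NameTy} {Γ : List S.Ty} (G : Goal S Λ Γ) :
    ∀ {Λ' : List S.NameTy} {Γ' : List S.Ty} (θ : ∀ τ, Ix Γ τ → Tm S Λ Γ' τ)
      (f : ∀ ν, Nm S Λ ν → Nm S Λ' ν),
      (G.subst θ).mapName f = (G.mapName f).subst fun τ i => (θ τ i).mapName f := by
  induction G with
  | top => intros; rfl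
  | atom p ts => intros; simp only [Goal.mapName, Goal.subst, Tm.mapName_subst]
  | fresh a t => intros; simp only [Goal.mapName, Goal.subst, Tm.mapName_subst]
  | eq t u => intros; simp only [Goal.mapName, Goal.subst, Tm.mapName_subst]
  | and G H hG hH => intros; simp only [Goal.mapName, Goal.subst, hG, hH]
  | or G H hG hH => intros; simp only [Goal.mapName, Goal.subst, hG, hH]
  | ex G hG => intros; simp only [Goal.mapName, Goal.subst, hG, Tm.mapName_liftSub]
  | new G hG =>
    intros
    simp only [Goal.mapName, Goal.subst, hG, Tm.mapName_mapName, Nm.lift_weaken]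

theorem Goal.subst_subst {Λ : List S.NameTy} {Γ : List S.Ty} (G : Goal S Λ Γ) :
    ∀ {Γ' Γ'' : List S.Ty} (θ : ∀ τ, Ix Γ τ → Tm S Λ Γ' τ) (θ' : ∀ τ, Ix Γ' τ → Tm S Λ Γ'' τ),
      (G.subst θ).subst θ' = G.subst fun τ i => (θ τ i).subst θ' := by
  induction G with
  | top => intros; rfl
  | atom p ts => intros; simp only [Goal.subst, Tm.subst_subst]
  | fresh a t => intros; simp only [Goal.subst, Tm.subst_subst]
  | eq t u => intros; simp only [Goal.subst, Tm.subst_subst]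
  | and G H hG hH => intros; simp only [Goal.subst, hG, hH]
  | or G H hG hH => intros; simp only [Goal.subst, hG, hH]
  | ex G hG => intros; simp only [Goal.subst, hG, Tm.liftSub_subst]
  | new G hG => intros; simp only [Goal.subst, hG, Tm.mapName_subst]

theorem Goal.subst_liftSub_inst {Λ : List S.NameTy} {Γ Γ' : List S.Ty} {σ : S.Ty}
    (G : Goal S Λ (σ :: Γ)) (θ : ∀ τ, Ix Γ τ → Tm S Λ Γ' τ) (t : Tm S Λ Γ' σ) :
    (G.subst (Tm.liftSub θ)).inst t = G.subst (Ix.cons (C := Tm S Λ Γ') t θ) := by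
  rw [Goal.inst, Goal.subst_subst]
  congr 1
  funext τ i
  cases i with
  | z => rfl
  | s i => exact (Tm.subst_subst _ _ _).trans (Tm.subst_var _)

theorem Goal.mapName_inst {Λ Λ' : List S.NameTy} {Γ : List S.Ty} {σ : S.Ty}
    (G : Goal S Λ (σ :: Γ)) (t : Tm S Λ Γ σ) (f : ∀ ν, Nm S Λ ν → Nm S Λ' ν) :
    (G.inst t).mapName f = (G.mapName f).inst (t.mapName f) := by
  rw [Goal.inst, Goal.mapName_subst, Goal.inst]
  congr 1
  funext τ i
  cases i <;> rfl

theorem Goal.new_subst_instName {Λ Λ' : List S.NameTy} {Γ Γ' : List S.Ty} {μ : S.NameTy}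
    (G : Goal S (μ :: Λ) Γ) (f : ∀ ν, Nm S Λ ν → Nm S Λ' ν) (θ : ∀ τ, Ix Γ τ → Tm S Λ' Γ' τ)
    (b : S.Name μ) :
    ((G.mapName (Nm.lift f)).subst fun τ i => (θ τ i).mapName fun _ => Nm.weaken).instName b =
      (G.mapName fun ν n => Nm.inst b ν (Nm.lift f ν n)).subst θ := by
  simp only [Goal.instName, Goal.mapName_subst, Goal.mapName_mapName, Tm.mapName_mapName,
    Nm.inst_weaken, Tm.mapName_id]

theorem Goal.act_act (π π' : S.NPerm) {Λ : List S.NameTy} {Γ : List S.Ty} (G : Goal S Λ Γ) :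
    (G.act π).act π' = G.act (π' * π) := by
  refine (Goal.mapName_mapName _ _ _).trans (congrArg (fun f => G.mapName f) ?_)
  funext ν n
  cases n <;> rfl

theorem Tm.act_act (π π' : S.NPerm) {Λ : List S.NameTy} {Γ : List S.Ty} {τ : S.Ty}
    (t : Tm S Λ Γ τ) : (t.act π).act π' = t.act (π' * π) := by
  refine (Tm.mapName_mapName _ _ _).trans (congrArg (fun f => t.mapName f) ?_)
  funext ν n
  cases n <;> rfl

theorem Goal.mapName_id {Λ : List S.NameTy} {Γ : List S.Ty} (G : Goal S Λ Γ) :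
    (G.mapName fun _ n => n) = G := by
  induction G with
  | top => rfl
  | atom p ts => simp only [Goal.mapName, Tm.mapName_id]
  | fresh a t => simp only [Goal.mapName, Tm.mapName_id]
  | eq t u => simp only [Goal.mapName, Tm.mapName_id]
  | and G H hG hH => simp only [Goal.mapName, hG, hH]
  | or G H hG hH => simp only [Goal.mapName, hG, hH]
  | ex G hG => simp only [Goal.mapName, hG]
  | new G hG =>
    refine congrArg Goal.new (.trans (congrArg (fun f => G.mapName f) ?_) hG)
    funext ν n
    rcases n with a | (_ | i) <;> rfl

theorem Goal.subst_var {Λ : List S.NameTy} {Γ : List S.Ty} (G : Goal S Λ Γ) :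
    (G.subst fun _ i => .var i) = G := by
  induction G with
  | top => rfl
  | atom p ts => simp only [Goal.subst, Tm.subst_var]
  | fresh a t => simp only [Goal.subst, Tm.subst_var]
  | eq t u => simp only [Goal.subst, Tm.subst_var]
  | and G H hG hH => simp only [Goal.subst, hG, hH]
  | or G H hG hH => simp only [Goal.subst, hG, hH]
  | ex G hG =>
    refine congrArg Goal.ex (.trans (congrArg (fun f => G.subst f) ?_) hG)
    funext τ i
    cases i <;> rfl
  | new G hG => exact congrArg Goal.new hG

theorem Nm.act_one {Λ : List S.NameTy} :
    (Nm.act 1 : ∀ ν, Nm S Λ ν → Nm S Λ ν) = fun _ n => n := by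
  funext ν n
  cases n <;> rfl

theorem Goal.act_one {Λ : List S.NameTy} {Γ : List S.Ty} (G : Goal S Λ Γ) : G.act 1 = G := by
  rw [Goal.act, Nm.act_one, Goal.mapName_id]

theorem Tm.act_one {Λ : List S.NameTy} {Γ : List S.Ty} {τ : S.Ty} (t : Tm S Λ Γ τ) :
    t.act 1 = t := by
  rw [Tm.act, Nm.act_one, Tm.mapName_id]

/-- Renaming a goal after replacing its outermost bound name amounts to renaming it before. -/
theorem Goal.act_instName {ν : S.NameTy} {Γ : List S.Ty} (G : Goal S [ν] Γ) {a b : S.Name ν}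
    {π π' : S.NPerm} (ha : π' ν a = b)
    (h : ∀ c ∈ G.names, π' c.1 c.2 = π c.1 c.2) :
    (G.instName a).act π' = (G.mapName (Nm.lift (Nm.act π))).instName b := by
  refine (Goal.mapName_mapName _ _ _).trans (.trans ?_ (Goal.mapName_mapName _ _ _).symm)
  refine Goal.mapName_congr _ fun μ n hn => ?_
  rcases n with c | (_ | i)
  · exact congrArg Nm.free (h ⟨μ, c⟩ (hn (List.mem_singleton.2 rfl)))
  · exact congrArg Nm.free ha
  · cases i

end Source

section Representation

variable {S : NSig.{u}}

/-! ### Opening `∇`-prefixes -/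

/-- The formula `F` becomes `A`, up to conversion and a permutation of the nominal constants, when
its `∇`-quantifiers are instantiated by nominal constants outside the support. -/
inductive Opens : HFm S.target [] → HFm S.target [] → Prop
  | base {F A : HFm S.target []} (π : S.NPerm)
      (h : HFm.Conv F (HFm.mapNom (L := S.target) (fun ν => π ν) A)) : Opens F A
  | nabla {ν : S.NameTy} {B : HFm S.target [.base (.inl ν)]} {A : HFm S.target []}
      (h : ∀ c : S.Name ν, (⟨ν, c⟩ : S.AnyName) ∉ B.supp →
        Opens (B.inst (.nom (L := S.target) c)) A) : Opens (HFm.nabla (L := S.target) B) A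

theorem Opens.of_conv {F A : HFm S.target []} (h : HFm.Conv F A) : Opens F A :=
  .base 1 (A.bind_id.symm ▸ h : HFm.Conv F (A.bind _ _))

theorem Opens.conv {F A : HFm S.target []} (h : Opens F A) :
    ∀ {F' : HFm S.target []}, HFm.Conv F F' → Opens F' A := by
  induction h with
  | base π h => exact fun h' => .base π (h'.symm.trans h)
  | nabla h ih =>
    intro F' h'
    cases h' with
    | nabla h' => exact .nabla fun c hc => ih c (fun hc' => hc (h'.mem_supp hc')) (h'.inst _)

theorem NSig.mapNom_inv_mapNom (π : S.NPerm) {Γ : List S.target.Ty} (B : HFm S.target Γ) :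
    HFm.mapNom (L := S.target) (fun ν => π⁻¹ ν)
      (HFm.mapNom (L := S.target) (fun ν => π ν) B) = B := by
  rw [HFm.mapNom_mapNom,
    show (fun ν a => π⁻¹ ν (π ν a)) = fun ν (a : S.Name ν) => a from
      funext fun ν => funext fun a => (π ν).symm_apply_apply a]
  exact B.bind_id

theorem Opens.mapNom {F A : HFm S.target []} (h : Opens F A) (π : S.NPerm) :
    Opens (HFm.mapNom (L := S.target) (fun ν => π ν) F) A := by
  induction h with
  | base π' h =>
    refine .base (π * π') ((h.bind _ _).trans ?_)
    exact (HFm.mapNom_mapNom (L := S.target) (fun ν => π' ν) (fun ν => π ν) _) ▸ .refl _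
  | @nabla ν B A h ih =>
    have h' := HFm.mapNom_nabla (L := S.target) (ν := ν) (fun ν => π ν) B
    simp only at h'
    rw [h']
    refine .nabla fun c hc => ?_
    have key := ih (π⁻¹ ν c) fun hB => hc <| by
      by_contra hc'
      have := HFm.notMem_supp_mapNom (L := S.target) (m := fun ν => π⁻¹ ν)
        (fun ν => (π⁻¹ ν).injective) _ hc'
      rw [NSig.mapNom_inv_mapNom] at this
      exact this hB
    rw [HFm.mapNom_inst] at key
    simpa [HTm.mapNom, HTm.bind] using key

/-- To open a `∇`-quantifier it suffices to consider one nominal constant outside the support. -/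
theorem Opens.nabla_of_inst {ν : S.NameTy} {B : HFm S.target [.base (.inl ν)]}
    {A : HFm S.target []} (c : S.Name ν) (hc : (⟨ν, c⟩ : S.AnyName) ∉ B.supp)
    (h : Opens (B.inst (.nom (L := S.target) c)) A) : Opens (HFm.nabla (L := S.target) B) A := by
  refine .nabla fun d hd => ?_
  have h' := h.mapNom (S.swapping c d)
  rw [HFm.mapNom_inst] at h'
  simp only [HTm.mapNom, HTm.bind, NSig.swapping_left] at h'
  refine h'.conv (HFm.Conv.inst (HFm.conv_mapNom (l := [⟨ν, c⟩, ⟨ν, d⟩]) (fun e he => ?_) B ?_) _)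
  · simp only [List.mem_cons, List.not_mem_nil, or_false, not_or] at he
    exact NSig.swapping_of_ne c d he.1 he.2
  · simp only [List.mem_cons, List.not_mem_nil, or_false]
    rintro e (rfl | rfl)
    · exact hc
    · exact hd

theorem NSig.Env.mix_cons (a : S.AnyName) (as : List S.AnyName) (e s : S.Env) :
    NSig.Env.mix (a :: as) e s = NSig.Env.mix as e (s.upd a (e a.1 a.2)) :=
  NSig.Env.ext fun b => by
    by_cases h : b ∈ as
    · rw [NSig.Env.mix_mem _ _ h, NSig.Env.mix_mem _ _ (List.mem_cons_of_mem _ h)]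
    · rw [NSig.Env.mix_notMem _ _ h]
      by_cases hb : b = a
      · subst hb; rw [NSig.Env.mix_mem _ _ List.mem_cons_self, NSig.Env.upd_self]
      · rw [NSig.Env.mix_notMem _ _ (by simp [h, hb]), NSig.Env.upd_ne _ _ hb]

theorem HFm.nablaNom_bind_inst {L : HSig.{u}} {Γ Γ' : List L.Ty} (a : L.AnyNom) (B : HFm L Γ)
    (θ : ∀ τ, Ix Γ τ → HTm L Γ' τ) (n : ∀ ν, L.Nom ν → HTm L Γ' (L.nomTy ν))
    (u : HTm L Γ' (L.nomTy a.1)) :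
    ((B.bind (fun _ i => .var (.s i)) (absMap L a Γ)).bind (HTm.liftSub θ)
      fun ν a => (n ν a).weaken).inst u =
      B.bind θ fun ν b => (absMap L a Γ ν b).bind (Ix.cons u θ) n := by
  rw [HFm.bind_liftSub_inst, HFm.bind_bind]
  rfl

/-- The prefix `∇a⃗` can be opened with the nominal constants `r(a⃗)`, provided that these are
distinct and do not occur in the formula otherwise. -/
theorem opens_nablas {Γ : List S.target.Ty} (B : HFm S.target Γ) {A : HFm S.target []} {r : S.Env}
    {κ : ∀ τ, Ix Γ τ → HTm S.target [] τ} :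
    ∀ (as : List S.AnyName) (s : S.Env), (∀ a ∈ as, ∀ b ∈ as, r.app a = r.app b → a = b) →
      (∀ a ∈ as, ∀ b ∈ B.noms, b ∉ as → s.app b ≠ r.app a) →
      (∀ a ∈ as, ∀ τ i, r.app a ∉ (κ τ i).supp) →
      Opens (B.bind κ fun ν a => .nom (L := S.target) (NSig.Env.mix as r s ν a)) A →
      Opens ((HFm.nablas (L := S.target) as B).bind κ fun ν a => .nom (L := S.target) (s ν a)) A
  | [], s, _, _, _, h => h
  | a :: as, s, hr, hs, hκ, h => by
    rw [NSig.Env.mix_cons] at h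
    have ih := opens_nablas B as (s.upd a (r a.1 a.2))
      (fun a ha b hb => hr a (List.mem_cons_of_mem _ ha) b (List.mem_cons_of_mem _ hb)) ?_
      (fun a ha => hκ a (List.mem_cons_of_mem _ ha)) h
    · refine Opens.nabla_of_inst (r a.1 a.2) ?_ ?_
      · refine HFm.notMem_supp_bind _ ?_ fun b hb => ?_
        · rintro _ (_ | i) hc
          · exact HTm.supp_subset_noms _ hc
          · obtain ⟨u, hu, hn⟩ := HTm.exists_conv_of_notMem_supp (hκ a List.mem_cons_self _ i)
            refine hn ?_
            have := HTm.supp_subset_noms _ (hu.weaken.mem_supp hc)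
            rwa [HTm.weaken, HTm.noms_rename] at this
        · rw [HTm.weaken, HTm.noms_rename]
          intro hc
          have hc : r.app a = s.app b := hc
          rcases HFm.noms_bind _ _ _ hb with ⟨_, _, h⟩ | ⟨d, hd, h⟩
          · exact h
          · obtain ⟨rfl, hne⟩ := noms_absMap h
            obtain ⟨hB, has⟩ := HFm.noms_nablas (L := S.target) _ as hd
            exact hs a List.mem_cons_self b hB (by simp [hne, has]) hc.symm
      · refine Eq.mp (congrArg (fun F => Opens F A) ?_) ih
        refine (Eq.trans ?_ (HFm.nablaNom_bind_inst (L := S.target) a _ κ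
          (fun ν b => .nom (L := S.target) (s ν b)) (.nom (L := S.target) (r a.1 a.2))).symm)
        refine HFm.bind_congr _ fun b _ => ?_
        by_cases hb : b = a
        · subst hb; rw [absMap_self, NSig.Env.upd_self]; rfl
        · rw [absMap_of_ne hb, NSig.Env.upd_ne _ _ hb]; rfl
    · intro d hd b hb hbas
      by_cases hba : b = a
      · subst hba
        intro h'
        refine hbas (?_ : b ∈ as)
        have : b = d := hr b List.mem_cons_self d (List.mem_cons_of_mem _ hd) (by
          rw [← h', NSig.Env.app, NSig.Env.app, NSig.Env.upd_self])
        rwa [this]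
      · rw [NSig.Env.app, NSig.Env.upd_ne _ _ hba]
        exact hs d (List.mem_cons_of_mem _ hd) b hb (by simp [hba, hbas])

/-! ### Raised witnesses -/

/-- Application of a raised value to the values of the names `a⃗`. -/
def semApps {τ : S.target.Ty} : ∀ as : List S.AnyName,
    Dom S (raiseTy (L := S.target) as τ) → S.Env → Dom S τ
  | [], d, _ => d
  | a :: as, f, e => semApps as ((f : S.Name a.1 → Dom S _) (e a.1 a.2)) e

theorem sem_appNoms {Γ : List S.target.Ty} {τ : S.target.Ty} (s : S.Env)
    (γ : ∀ τ, Ix Γ τ → Dom S τ) : ∀ (as : List S.AnyName)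
      (t : HTm S.target Γ (raiseTy (L := S.target) as τ)),
      sem (HTm.appNoms (L := S.target) as t) s γ = semApps as (sem t s γ) s
  | [], _ => rfl
  | a :: as, t => sem_appNoms s γ as (.app t (.nom (L := S.target) a.2))

theorem semApps_congr {τ : S.target.Ty} {e e' : S.Env} : ∀ (as : List S.AnyName)
    (d : Dom S (raiseTy (L := S.target) as τ)), (∀ a ∈ as, e a.1 a.2 = e' a.1 a.2) →
      semApps as d e = semApps as d e'
  | [], _, _ => rfl
  | a :: as, d, h => by
    simp only [semApps, h a List.mem_cons_self]
    exact semApps_congr as _ fun b hb => h b (List.mem_cons_of_mem _ hb)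

/-- The closed term `u` is, up to conversion, the abstraction of the ground term `t` over the names
`r(a⃗)`: these names are fresh for `u`, and applying `u` to any names replaces them in `t`. -/
structure Raises (as : List S.AnyName) (r : S.Env) {τ : S.Ty}
    (u : HTm S.target [] (raiseTy (L := S.target) as (trTy τ))) (t : Tm S [] [] τ) : Prop where
  notMem_supp : ∀ a ∈ as, r.app a ∉ u.supp
  sem_eq : ∀ s e : S.Env, semApps as (sem₀ u s) (fun ν a => e ν (r ν a)) =
    sem₀ t.toHTm (NSig.Env.mix (as.map r.app) e s)

/-- The abstraction of a closed term over the names `r(a⃗)`. -/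
noncomputable def lamNoms (r : S.Env) {τ : S.target.Ty} (t : HTm S.target [] τ) :
    ∀ as : List S.AnyName, HTm S.target [] (raiseTy (L := S.target) as τ)
  | [] => t
  | a :: as => .lam (HTm.absNom (L := S.target) (r.app a) (lamNoms r t as))

theorem noms_lamNoms (r : S.Env) {τ : S.target.Ty} (t : HTm S.target [] τ) {c : S.AnyName} :
    ∀ as : List S.AnyName, c ∈ (lamNoms r t as).noms → c ∉ as.map r.app
  | [], _ => List.not_mem_nil
  | a :: as, h => by
    obtain ⟨h, hne⟩ := HTm.noms_absNom (L := S.target) _ h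
    rw [List.map_cons, List.mem_cons]
    exact not_or.2 ⟨hne, noms_lamNoms r t as h⟩

theorem semApps_lamNoms (r : S.Env) {τ : S.target.Ty} (t : HTm S.target [] τ) (e : S.Env) :
    ∀ (as : List S.AnyName) (s : S.Env),
      semApps as (sem₀ (lamNoms r t as) s) (fun ν a => e ν (r ν a)) =
        sem₀ t (NSig.Env.mix (as.map r.app) e s)
  | [], s => by
    refine congrArg (sem₀ t) (NSig.Env.ext fun b => ?_)
    exact (NSig.Env.mix_notMem e s List.not_mem_nil).symm
  | a :: as, s => by
    rw [List.map_cons, NSig.Env.mix_cons]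
    refine (congrArg (fun d => semApps as d _) ?_).trans (semApps_lamNoms r t e as _)
    exact sem_absNom (S := S) (r.app a) (lamNoms r t as) s _ (e a.1 (r a.1 a.2))

theorem raises_lamNoms (as : List S.AnyName) (r : S.Env) {τ : S.Ty} (t : Tm S [] [] τ) :
    Raises as r (lamNoms r t.toHTm as) t where
  notMem_supp _ ha h :=
    noms_lamNoms r _ as (HTm.supp_subset_noms _ h) (List.mem_map_of_mem ha)
  sem_eq s e := semApps_lamNoms r _ e as s

theorem sem₀_mix_of_notMem_supp {τ : S.target.Ty} {u : HTm S.target [] τ} (e : S.Env) :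
    ∀ (l : List S.AnyName) (s : S.Env), (∀ a ∈ l, a ∉ u.supp) →
      sem₀ u (NSig.Env.mix l e s) = sem₀ u s
  | [], s, _ => congrArg (sem₀ u) (NSig.Env.ext fun _ => NSig.Env.mix_notMem e s List.not_mem_nil)
  | a :: l, s, h => by
    rw [NSig.Env.mix_cons, sem₀_mix_of_notMem_supp e l _ fun b hb => h b (List.mem_cons_of_mem _ hb)]
    obtain ⟨v, hv, ha⟩ := HTm.exists_conv_of_notMem_supp (h a List.mem_cons_self)
    refine (hv.sem_eq _ _).trans (.trans (sem_congr v fun b hb => ?_) (hv.sem_eq _ _).symm)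
    exact s.upd_ne _ fun h => ha (h ▸ hb)

/-- Every closed term of a raised type is the abstraction of a ground term over any names outside
its support: apply it to these names and normalize. -/
theorem exists_raises (as : List S.AnyName) (r : S.Env) {τ : S.Ty}
    (u : HTm S.target [] (raiseTy (L := S.target) as (trTy τ)))
    (h : ∀ a ∈ as, r.app a ∉ u.supp) : ∃ t : Tm S [] [] τ, Raises as r u t := by
  have app : ∀ (as : List S.AnyName) (u : HTm S.target [] (raiseTy (L := S.target) as (trTy τ))),
      ∃ v : HTm S.target [] (trTy τ), ∀ s : S.Env,
        sem₀ v s = semApps as (sem₀ u s) fun ν a => s ν (r ν a) := by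
    intro as
    induction as with
    | nil => exact fun u => ⟨u, fun _ => rfl⟩
    | cons a as ih => exact fun u => ih (.app u (.nom (L := S.target) (r a.1 a.2)))
  obtain ⟨v, hv⟩ := app as u
  obtain ⟨w, hw⟩ := v.exists_conv_val
  refine ⟨w.toTm, h, fun s e => ?_⟩
  have hwv : ∀ s, sem₀ w.toTm.toHTm s = sem₀ v s := fun s =>
    (reify_injective τ (by rw [Tm.reify_sem, Val.eval_toTm]; exact (Val.reify_sem w s).symm)).trans
      (hw.sem_eq s _).symm
  rw [hwv, hv, sem₀_mix_of_notMem_supp]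
  · refine semApps_congr as _ fun a ha => ?_
    exact (NSig.Env.mix_mem (a := r.app a) _ _ (List.mem_map_of_mem ha)).symm
  · intro b hb
    obtain ⟨a, ha, rfl⟩ := List.mem_map.1 hb
    exact h a ha

end Representation

section Fundamental

variable {S : NSig.{u}}

/-! ### Representations of goals -/

/-- `Rep as r F G`: the closed formula `F` represents the ground goal `G` over the names `r(a⃗)`.
The list `a⃗` only fixes the types of the raised variables. For an existential quantifier, instances
have to correspond whenever the witnesses do, and for `И` all but finitely many names have to be
suitable. -/
inductive Rep : List S.AnyName → S.Env → HFm S.target [] → Goal S [] [] → Prop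
  | top {as : List S.AnyName} {r : S.Env} : Rep as r .top .top
  | atom {as : List S.AnyName} {r : S.Env} {F : HFm S.target []} {p : S.Pred}
      {ts : ∀ i, Tm S [] [] (S.predArg p i)} (h : Opens F (trGround [] (.atom p ts))) :
      Rep as r F (.atom p ts)
  | fresh {as : List S.AnyName} {r : S.Env} {F : HFm S.target []} {ν : S.NameTy} {τ : S.Ty}
      {a : Nm S [] ν} {t : Tm S [] [] τ} (h : Opens F (trGround [] (.fresh a t))) :
      Rep as r F (.fresh a t)
  | eq {as : List S.AnyName} {r : S.Env} {F : HFm S.target []} {τ : S.Ty} {t u : Tm S [] [] τ}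
      (h : Opens F (trGround [] (.eq t u))) : Rep as r F (.eq t u)
  | and {as : List S.AnyName} {r : S.Env} {F F' : HFm S.target []} {G G' : Goal S [] []}
      (h : Rep as r F G) (h' : Rep as r F' G') : Rep as r (.and F F') (.and G G')
  | or {as : List S.AnyName} {r : S.Env} {F F' : HFm S.target []} {G G' : Goal S [] []}
      (h : Rep as r F G) (h' : Rep as r F' G') : Rep as r (.or F F') (.or G G')
  | ex {as : List S.AnyName} {r : S.Env} {τ : S.Ty}
      {F : HFm S.target [raiseTy (L := S.target) as (trTy τ)]} {G : Goal S [] [τ]}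
      (hF : ∀ a ∈ as, r.app a ∉ F.supp)
      (h : ∀ u t, Raises as r u t → Rep as r (F.inst u) (G.inst t)) : Rep as r (.ex F) (.ex G)
  | new {as : List S.AnyName} {r : S.Env} {F : HFm S.target []} {ν : S.NameTy}
      {G : Goal S [ν] []} (b : S.Name ν) (l : List S.AnyName) (hb : (⟨ν, b⟩ : S.AnyName) ∉ as)
      (h : ∀ b' : S.Name ν, (⟨ν, b'⟩ : S.AnyName) ∉ l →
        Rep (as ++ [⟨ν, b⟩]) (r.upd ⟨ν, b⟩ b') F (G.instName b')) : Rep as r F (.new G)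

theorem Rep.conv {as : List S.AnyName} {r : S.Env} {F : HFm S.target []} {G : Goal S [] []}
    (h : Rep as r F G) : ∀ {F' : HFm S.target []}, HFm.Conv F F' → Rep as r F' G := by
  induction h with
  | top => intro F' h'; cases h'; exact .top
  | atom h => exact fun h' => .atom (h.conv h')
  | fresh h => exact fun h' => .fresh (h.conv h')
  | eq h => exact fun h' => .eq (h.conv h')
  | and _ _ ih ih' => intro F' h'; cases h' with | and k k' => exact .and (ih k) (ih' k')
  | or _ _ ih ih' => intro F' h'; cases h' with | or k k' => exact .or (ih k) (ih' k')
  | ex hF _ ih =>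
    intro F' h'
    cases h' with
    | ex k =>
      exact .ex (fun a ha h => hF a ha (k.symm.mem_supp h)) fun u t hut => ih u t hut (k.inst u)
  | new b l hb _ ih => exact fun h' => .new b l hb fun b' hb' => ih b' hb' h'

/-! ### The translation represents goals -/

/-- The map that turns the names in a goal, via the environment `η`, into the names `r(η(·))`. -/
def renNm {Λ : List S.NameTy} (η : ∀ ν, Nm S Λ ν → S.Name ν) (r : S.Env) :
    ∀ ν, Nm S Λ ν → Nm S [] ν :=
  fun ν n => .free (r ν (η ν n))

/-- The renaming `r` is injective on `a⃗`, and all names in the list `N` that are not in `a⃗` are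
fixed by it and different from the names `r(a⃗)`. -/
structure Compat {Λ : List S.NameTy} (as : List S.AnyName) (η : ∀ ν, Nm S Λ ν → S.Name ν)
    (r : S.Env) (N : List S.AnyName) : Prop where
  inj : ∀ a ∈ as, ∀ b ∈ as, r.app a = r.app b → a = b
  cases : ∀ ν n, n.names ⊆ N → (⟨ν, η ν n⟩ : S.AnyName) ∈ as ∨
    (r ν (η ν n) = η ν n ∧ (⟨ν, η ν n⟩ : S.AnyName) ∉ as.map r.app)

theorem Compat.mono {Λ : List S.NameTy} {as : List S.AnyName} {η : ∀ ν, Nm S Λ ν → S.Name ν}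
    {r : S.Env} {N N' : List S.AnyName} (h : Compat as η r N) (hN : N' ⊆ N) : Compat as η r N' :=
  ⟨h.inj, fun ν n hn => h.cases ν n fun _ hc => hN (hn hc)⟩

theorem Compat.eq_of_eq {Λ : List S.NameTy} {as : List S.AnyName} {η : ∀ ν, Nm S Λ ν → S.Name ν}
    {r : S.Env} {N : List S.AnyName} (h : Compat as η r N) {ν : S.NameTy} {n m : Nm S Λ ν}
    (hn : n.names ⊆ N) (hm : m.names ⊆ N) (he : r ν (η ν n) = r ν (η ν m)) : η ν n = η ν m := by
  rcases h.cases ν n hn with h₁ | ⟨h₁, h₁'⟩ <;> rcases h.cases ν m hm with h₂ | ⟨h₂, h₂'⟩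
  · have := h.inj _ h₁ _ h₂ (congrArg (Sigma.mk ν) he)
    exact eq_of_heq (Sigma.mk.inj this).2
  · refine absurd (List.mem_map.2 ⟨_, h₁, ?_⟩) h₂'
    exact congrArg (Sigma.mk ν) (he.trans h₂)
  · refine absurd (List.mem_map.2 ⟨_, h₂, ?_⟩) h₁'
    exact congrArg (Sigma.mk ν) (he.symm.trans h₁)
  · exact h₁.symm.trans (he.trans h₂)

theorem NSig.swapping_map (r : S.Env) {ν : S.NameTy} (a b : S.Name ν) {c : S.AnyName}
    (ha : r.app c = r.app ⟨ν, a⟩ → c = ⟨ν, a⟩) (hb : r.app c = r.app ⟨ν, b⟩ → c = ⟨ν, b⟩) :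
    S.swapping (r ν a) (r ν b) c.1 (r c.1 c.2) = r c.1 (S.swapping a b c.1 c.2) := by
  by_cases hca : c = ⟨ν, a⟩
  · subst hca; simp only [NSig.swapping_left]
  by_cases hcb : c = ⟨ν, b⟩
  · subst hcb; simp only [NSig.swapping_right]
  rw [NSig.swapping_of_ne a b hca hcb]
  exact NSig.swapping_of_ne (c := r.app c) _ _ (fun h => hca (ha h)) fun h => hcb (hb h)

theorem Compat.app_inj {Λ : List S.NameTy} {as : List S.AnyName} {η : ∀ ν, Nm S Λ ν → S.Name ν}
    {r : S.Env} {N : List S.AnyName} (h : Compat as η r N) {ν μ : S.NameTy} {n : Nm S Λ ν}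
    {m : Nm S Λ μ} (hn : n.names ⊆ N) (hm : m.names ⊆ N)
    (he : r.app ⟨ν, η ν n⟩ = r.app ⟨μ, η μ m⟩) :
    (⟨ν, η ν n⟩ : S.AnyName) = ⟨μ, η μ m⟩ := by
  cases (Sigma.mk.inj he).1
  rw [h.eq_of_eq hn hm (eq_of_heq (Sigma.mk.inj he).2)]

/-- A term without variables denotes the same value before and after an injective renaming of the
names that occur in it. -/
theorem sem_trTm_ground {Λ : List S.NameTy} {Γ : List S.Ty} {Γ' : List S.target.Ty}
    {as N : List S.AnyName} {η : ∀ ν, Nm S Λ ν → S.Name ν}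
    {ρ : ∀ τ, Ix Γ τ → HTm S.target Γ' (trTy τ)} {r : S.Env} {θ : ∀ τ, Ix Γ τ → Tm S [] [] τ}
    (hc : Compat as η r N) (γ : ∀ τ, Ix Γ' τ → Dom S τ) {τ : S.Ty} (t : Tm S Λ Γ τ)
    (ht : ¬ t.HasVar) (hN : t.names ⊆ N) :
    ∀ s s' : S.Env, (∀ ν n, n.names ⊆ N → s ν (η ν n) = s' ν (r ν (η ν n))) →
      sem (trTm η ρ t) s γ = sem₀ ((t.mapName (renNm η r)).subst θ).toHTm s' := by
  induction t with
  | name a => intro s s' hs; exact hs _ a hN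
  | var X => exact absurd trivial ht
  | fn f ts ih =>
    intro s s' hs
    refine (sem_apps_con s γ f _).trans (.trans ?_ (sem_apps_con s' _ f _).symm)
    refine congrArg (Tree.fn f) (funext fun i => congrArg _ ?_)
    exact ih i (fun h => ht ⟨i, h⟩)
      (fun c hc => hN (List.mem_flatMap.2 ⟨i, List.mem_finRange i, hc⟩)) s s' hs
  | @swap ν τ a b t ih =>
    intro s s' hs
    have hN' := List.append_subset.1 hN
    have ha := (List.append_subset.1 hN'.1).1
    have hb := (List.append_subset.1 hN'.1).2
    refine (sem_swapNom (S := S) (η ν a) (η ν b) _ s γ).trans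
      (.trans ?_ (sem_swapNom (S := S) (r ν (η ν a)) (r ν (η ν b)) _ s' _).symm)
    refine ih ht hN'.2 _ _ fun μ n hn => ?_
    have hsw := NSig.swapping_map r (η ν a) (η ν b) (c := ⟨μ, η μ n⟩) (hc.app_inj hn ha)
      (hc.app_inj hn hb)
    simp only at hsw
    rw [hsw]
    by_cases hna : (⟨μ, η μ n⟩ : S.AnyName) = ⟨ν, η ν a⟩
    · cases (Sigma.mk.inj hna).1
      rw [eq_of_heq (Sigma.mk.inj hna).2, NSig.swapping_left, hs _ b hb]
    by_cases hnb : (⟨μ, η μ n⟩ : S.AnyName) = ⟨ν, η ν b⟩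
    · cases (Sigma.mk.inj hnb).1
      rw [eq_of_heq (Sigma.mk.inj hnb).2, NSig.swapping_right, hs _ a ha]
    have := NSig.swapping_of_ne (η ν a) (η ν b) hna hnb
    simp only at this
    rw [this, hs _ n hn]
  | @abs ν τ a t ih =>
    intro s s' hs
    have ha := (List.append_subset.1 hN).1
    refine funext fun (c : S.Name ν) => ?_
    refine (sem_absNom (S := S) ⟨ν, η ν a⟩ _ s γ c).trans
      (.trans ?_ (sem_absNom (S := S) ⟨ν, r ν (η ν a)⟩ _ s' _ c).symm)
    refine ih ht (List.append_subset.1 hN).2 _ _ fun μ n hn => ?_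
    by_cases hna : (⟨μ, η μ n⟩ : S.AnyName) = ⟨ν, η ν a⟩
    · cases (Sigma.mk.inj hna).1
      rw [eq_of_heq (Sigma.mk.inj hna).2, NSig.Env.upd_mk, NSig.Env.upd_mk]
    · have h₁ := s.upd_ne c hna
      have h₂ := s'.upd_ne (a := ⟨ν, r ν (η ν a)⟩) (b := ⟨μ, r μ (η μ n)⟩) c fun h =>
        hna (hc.app_inj hn ha h)
      simp only at h₁ h₂
      rw [h₁, h₂, hs _ n hn]

/-- The values of a translated term, in terms of those of its renamed ground instance. The names
that act on variables are among `a⃗`, hence change the environment on `a⃗` only, which is what the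
correspondence between the raised variables and the witnesses can absorb. -/
theorem sem_trTm {Λ : List S.NameTy} {Γ : List S.Ty} {Γ' : List S.target.Ty}
    {as N : List S.AnyName} {η : ∀ ν, Nm S Λ ν → S.Name ν}
    {ρ : ∀ τ, Ix Γ τ → HTm S.target Γ' (trTy τ)} {r : S.Env} {θ : ∀ τ, Ix Γ τ → Tm S [] [] τ}
    (hc : Compat as η r N) (γ : ∀ τ, Ix Γ' τ → Dom S τ) (s : S.Env)
    (hρ : ∀ τ X (e : S.Env), sem (ρ τ X) (NSig.Env.mix as (fun ν a => e ν (r ν a)) s) γ =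
      sem₀ (θ τ X).toHTm (NSig.Env.mix (as.map r.app) e s))
    {τ : S.Ty} (t : Tm S Λ Γ τ) (hN : t.names ⊆ N)
    (hact : ∀ ν n, (∀ c ∈ n.names, t.ActsOnVar c) → (⟨ν, η ν n⟩ : S.AnyName) ∈ as) :
    ∀ e : S.Env, sem (trTm η ρ t) (NSig.Env.mix as (fun ν a => e ν (r ν a)) s) γ =
      sem₀ ((t.mapName (renNm η r)).subst θ).toHTm (NSig.Env.mix (as.map r.app) e s) := by
  have hname : ∀ (e : S.Env) ν n, n.names ⊆ N →
      NSig.Env.mix as (fun ν a => e ν (r ν a)) s ν (η ν n) =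
        NSig.Env.mix (as.map r.app) e s ν (r ν (η ν n)) := by
    intro e ν n hn
    rcases hc.cases ν n hn with h | ⟨h, h'⟩
    · exact (NSig.Env.mix_mem (a := ⟨ν, η ν n⟩) _ _ h).trans
        (NSig.Env.mix_mem (a := r.app ⟨ν, η ν n⟩) _ _ (List.mem_map_of_mem h)).symm
    · rw [h]
      refine (NSig.Env.mix_notMem (a := ⟨ν, η ν n⟩) _ _ fun h'' => h' ?_).trans
        (NSig.Env.mix_notMem (a := ⟨ν, η ν n⟩) _ _ h').symm
      exact List.mem_map.2 ⟨_, h'', congrArg (Sigma.mk ν) h⟩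
  induction t with
  | name a => intro e; exact hname e _ a hN
  | var X => intro e; exact hρ _ X e
  | fn f ts ih =>
    intro e
    refine (sem_apps_con _ γ f _).trans (.trans ?_ (sem_apps_con _ _ f _).symm)
    refine congrArg (Tree.fn f) (funext fun i => congrArg _ ?_)
    exact ih i (fun c hc => hN (List.mem_flatMap.2 ⟨i, List.mem_finRange i, hc⟩))
      (fun ν n hn => hact ν n fun c hc => ⟨i, hn c hc⟩) e
  | @swap ν τ a b t ih =>
    intro e
    by_cases ht : t.HasVar
    · have ha : (⟨ν, η ν a⟩ : S.AnyName) ∈ as := hact ν a fun c hc => .inl ⟨.inl hc, ht⟩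
      have hb : (⟨ν, η ν b⟩ : S.AnyName) ∈ as := hact ν b fun c hc => .inl ⟨.inr hc, ht⟩
      refine (sem_swapNom (S := S) (η ν a) (η ν b) _ _ γ).trans
        (.trans ?_ (sem_swapNom (S := S) (r ν (η ν a)) (r ν (η ν b)) _ _ _).symm)
      have key := ih (fun c hc => hN (List.mem_append.2 (.inr hc)))
        (fun ν n hn => hact ν n fun c hc => .inr (hn c hc))
        fun μ c => e μ (S.swapping (r ν (η ν a)) (r ν (η ν b)) μ c)
      refine Eq.trans (congrArg (fun s => sem _ s γ) ?_) (key.trans (congrArg (sem₀ _) ?_))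
      · refine NSig.Env.ext fun c => ?_
        by_cases hcas : c ∈ as
        · have hsw : (⟨c.1, S.swapping (η ν a) (η ν b) c.1 c.2⟩ : S.AnyName) ∈ as := by
            rcases NSig.swapping_cases (η ν a) (η ν b) c with h | h | h <;> rw [h] <;> assumption
          rw [NSig.Env.mix_mem _ _ hcas]
          refine (NSig.Env.mix_mem _ _ hsw).trans ?_
          simp only
          rw [NSig.swapping_map r (η ν a) (η ν b) (hc.inj c hcas _ ha) (hc.inj c hcas _ hb)]
        · rw [NSig.swapping_of_ne (η ν a) (η ν b) (ne_of_mem_of_not_mem ha hcas).symm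
              (ne_of_mem_of_not_mem hb hcas).symm,
            NSig.Env.mix_notMem _ _ hcas, NSig.Env.mix_notMem _ _ hcas]
      · refine NSig.Env.ext fun c => ?_
        have ha' : (⟨ν, r ν (η ν a)⟩ : S.AnyName) ∈ as.map r.app := List.mem_map.2 ⟨_, ha, rfl⟩
        have hb' : (⟨ν, r ν (η ν b)⟩ : S.AnyName) ∈ as.map r.app := List.mem_map.2 ⟨_, hb, rfl⟩
        by_cases hcas : c ∈ as.map r.app
        · have hsw : (⟨c.1, S.swapping (r ν (η ν a)) (r ν (η ν b)) c.1 c.2⟩ : S.AnyName) ∈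
              as.map r.app := by
            rcases NSig.swapping_cases (r ν (η ν a)) (r ν (η ν b)) c with h | h | h <;>
              rw [h] <;> assumption
          rw [NSig.Env.mix_mem _ _ hcas]
          exact (NSig.Env.mix_mem _ _ hsw).symm
        · rw [NSig.swapping_of_ne (r ν (η ν a)) (r ν (η ν b)) (ne_of_mem_of_not_mem ha' hcas).symm
              (ne_of_mem_of_not_mem hb' hcas).symm,
            NSig.Env.mix_notMem _ _ hcas, NSig.Env.mix_notMem _ _ hcas]
    · exact sem_trTm_ground hc γ (.swap a b t) ht hN _ _ (hname e)
  | @abs ν τ a t ih =>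
    intro e
    by_cases ht : t.HasVar
    · have ha : (⟨ν, η ν a⟩ : S.AnyName) ∈ as := hact ν a fun c hc => .inl ⟨hc, ht⟩
      refine funext fun (d : S.Name ν) => ?_
      refine (sem_absNom (S := S) ⟨ν, η ν a⟩ _ _ γ d).trans
        (.trans ?_ (sem_absNom (S := S) ⟨ν, r ν (η ν a)⟩ _ _ _ d).symm)
      have key := ih (fun c hc => hN (List.mem_append.2 (.inr hc)))
        (fun ν n hn => hact ν n fun c hc => .inr (hn c hc)) (e.upd ⟨ν, r ν (η ν a)⟩ d)
      refine Eq.trans (congrArg (fun s => sem _ s γ) ?_) (key.trans (congrArg (sem₀ _) ?_))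
      · refine NSig.Env.ext fun c => ?_
        rw [NSig.Env.mix_upd _ _ _ _ ha]
        by_cases hcas : c ∈ as
        · rw [NSig.Env.mix_mem _ _ hcas, NSig.Env.mix_mem _ _ hcas]
          by_cases hca : c = ⟨ν, η ν a⟩
          · subst hca; rw [NSig.Env.upd_mk]; exact (NSig.Env.upd_mk _ _ _).symm
          · rw [NSig.Env.upd_ne _ _ hca]
            exact (NSig.Env.upd_ne (b := r.app c) _ _ fun h => hca (hc.inj c hcas _ ha h)).symm
        · rw [NSig.Env.mix_notMem _ _ hcas, NSig.Env.mix_notMem _ _ hcas]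
      · exact (NSig.Env.mix_upd _ _ _ _ (List.mem_map.2 ⟨_, ha, rfl⟩)).symm
    · exact sem_trTm_ground hc γ (.abs a t) ht hN _ _ (hname e)
theorem Ix.exists_list {α : Type u} {A : Type v} : ∀ {Γ : List α} (P : ∀ τ, Ix Γ τ → A → Prop),
    (∀ τ i, ∃ l : List A, ∀ a, P τ i a → a ∈ l) → ∃ l : List A, ∀ τ i a, P τ i a → a ∈ l
  | [], _, _ => ⟨[], fun _ i => i.elim⟩
  | _ :: _, P, h => by
    obtain ⟨l, hl⟩ := h _ .z
    obtain ⟨l', hl'⟩ := Ix.exists_list (fun τ i => P τ (.s i)) fun τ i => h τ (.s i)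
    refine ⟨l ++ l', ?_⟩
    rintro τ (_ | i) a ha
    · exact List.mem_append.2 (.inl (hl a ha))
    · exact List.mem_append.2 (.inr (hl' τ i a ha))

/-- The data for translating a goal and closing the result: names that stand for the bound names
are among `a⃗`, and the closed instances under `κ` of the raised variables `ρ` are the abstractions
of the ground terms `θ` over the names `r(a⃗)`. -/
structure RepEnv {Λ : List S.NameTy} {Γ : List S.Ty} {Γ' : List S.target.Ty} (as : List S.AnyName)
    (η : ∀ ν, Nm S Λ ν → S.Name ν) (ρ : ∀ τ, Ix Γ τ → HTm S.target Γ' (trTy τ)) (r : S.Env)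
    (κ : ∀ τ, Ix Γ' τ → HTm S.target [] τ) (θ : ∀ τ, Ix Γ τ → Tm S [] [] τ) : Prop where
  free : ∀ ν a, η ν (.free a) = a
  bound : ∀ ν (i : Ix Λ ν), (⟨ν, η ν (.bound i)⟩ : S.AnyName) ∈ as
  noms : ∀ τ i, (ρ τ i).noms ⊆ {a | a ∈ as}
  notMem_supp : ∀ a ∈ as, ∀ τ i, r.app a ∉ (κ τ i).supp
  sem_eq : ∀ τ X (s e : S.Env), sem (ρ τ X) (NSig.Env.mix as (fun ν a => e ν (r ν a)) s)
    (fun τ i => sem₀ (κ τ i) s) = sem₀ (θ τ X).toHTm (NSig.Env.mix (as.map r.app) e s)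

section

variable {Λ : List S.NameTy} {Γ : List S.Ty} {Γ' : List S.target.Ty} {as : List S.AnyName}
  {η : ∀ ν, Nm S Λ ν → S.Name ν} {ρ : ∀ τ, Ix Γ τ → HTm S.target Γ' (trTy τ)} {r : S.Env}
  {κ : ∀ τ, Ix Γ' τ → HTm S.target [] τ} {θ : ∀ τ, Ix Γ τ → Tm S [] [] τ}

theorem RepEnv.names (h : RepEnv as η ρ r κ θ) (ν : S.NameTy) (n : Nm S Λ ν) :
    (⟨ν, η ν n⟩ : S.AnyName) ∈ n.names ∨ (⟨ν, η ν n⟩ : S.AnyName) ∈ {a | a ∈ as} := by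
  cases n with
  | free a => exact .inl (List.mem_singleton.2 (congrArg _ (h.free ν a)))
  | bound i => exact .inr (h.bound ν i)

theorem RepEnv.sem_trTm (h : RepEnv as η ρ r κ θ) {N : List S.AnyName} (hc : Compat as η r N)
    {τ : S.Ty} {t : Tm S Λ Γ τ} (hN : t.names ⊆ N) (hact : ∀ a, t.ActsOnVar a → a ∈ as)
    (s : S.Env) :
    sem (trTm η ρ t) (NSig.Env.mix as (fun ν a => s ν (r ν a)) s) (fun τ i => sem₀ (κ τ i) s) =
      sem₀ ((t.mapName (renNm η r)).subst θ).toHTm s := by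
  have key := NomHO.sem_trTm hc (fun τ i => sem₀ (κ τ i) s) s (fun τ X e => h.sem_eq τ X s e) t hN
    (fun ν n hn => by
      cases n with
      | free a => rw [h.free]; exact hact _ (hn _ (List.mem_singleton.2 rfl))
      | bound i => exact h.bound ν i) s
  rwa [NSig.Env.mix_self] at key

theorem RepEnv.conv_trTm (h : RepEnv as η ρ r κ θ) {N : List S.AnyName} (hc : Compat as η r N)
    {τ : S.Ty} {t : Tm S Λ Γ τ} (hN : t.names ⊆ N) (hact : ∀ a, t.ActsOnVar a → a ∈ as) :
    HTm.Conv ((trTm η ρ t).bind κ fun ν a =>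
        .nom (L := S.target) (NSig.Env.mix as r (fun _ a => a) ν a))
      ((t.mapName (renNm η r)).subst θ).toHTm := by
  refine HTm.conv_of_sem fun s => (sem_bind _ _ _ s _).trans (.trans ?_ (h.sem_trTm hc hN hact s))
  refine congrArg (fun s' => sem _ s' _) (NSig.Env.ext fun c => ?_)
  show s c.1 (NSig.Env.mix as r (fun _ a => a) c.1 c.2) = _
  by_cases hcas : c ∈ as
  · rw [NSig.Env.mix_mem _ _ hcas, NSig.Env.mix_mem _ _ hcas]
  · rw [NSig.Env.mix_notMem _ _ hcas, NSig.Env.mix_notMem _ _ hcas]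

/-- A formula `∇a⃗.B` opens to `A` if `B[r(a⃗)/a⃗]` is convertible to `A`. -/
theorem RepEnv.opens (h : RepEnv as η ρ r κ θ) {N : List S.AnyName} (hc : Compat as η r N)
    {B : HFm S.target Γ'} (hB : ∀ b ∈ B.noms, b ∈ N ∨ b ∈ as) {A : HFm S.target []}
    (hA : HFm.Conv (B.bind κ fun ν a =>
      .nom (L := S.target) (NSig.Env.mix as r (fun _ a => a) ν a)) A) :
    Opens ((HFm.nablas (L := S.target) as B).subst κ) A := by
  refine opens_nablas B as (fun _ a => a) hc.inj (fun a ha b hb hbas => ?_) h.notMem_supp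
    (.of_conv hA)
  rcases hc.cases b.1 (.free b.2)
    (fun c hc => by rw [List.mem_singleton.1 hc]; exact (hB b hb).resolve_right hbas) with h' | ⟨_, h'⟩
  · rw [h.free] at h'; exact absurd h' hbas
  · rw [h.free] at h'
    exact fun he => h' (List.mem_map.2 ⟨a, ha, he.symm⟩)

theorem RepEnv.ex (h : RepEnv as η ρ r κ θ) {τ : S.Ty}
    {u : HTm S.target [] (raiseTy (L := S.target) as (trTy τ))} {t : Tm S [] [] τ}
    (hut : Raises as r u t) :
    RepEnv as η (Ix.cons (C := fun τ => HTm S.target _ (trTy τ))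
      (HTm.appNoms (L := S.target) as (.var .z)) fun σ i => (ρ σ i).weaken) r
      (Ix.cons u κ) (Ix.cons (C := Tm S [] []) t θ) where
  free := h.free
  bound := h.bound
  noms := by
    rintro _ (_ | i) d hd
    · exact (HTm.noms_appNoms (L := S.target) as _ hd).resolve_left fun h => h.elim
    · exact h.noms _ i (by simpa [Ix.cons, HTm.weaken, HTm.noms_rename] using hd)
  notMem_supp := by
    rintro a ha _ (_ | i)
    · exact hut.notMem_supp a ha
    · exact h.notMem_supp a ha _ i
  sem_eq := by
    rintro _ (_ | X) s e
    · refine (sem_appNoms _ _ as _).trans (.trans ?_ (hut.sem_eq s e))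
      exact semApps_congr as _ fun a ha => NSig.Env.mix_mem _ _ ha
    · exact (sem_rename _ _ _ _).trans (h.sem_eq _ X s e)

theorem NSig.Env.map_app_upd {as : List S.AnyName} (r : S.Env) {ν : S.NameTy} {b : S.Name ν}
    (b' : S.Name ν) (hb : (⟨ν, b⟩ : S.AnyName) ∉ as) :
    (as ++ [(⟨ν, b⟩ : S.AnyName)]).map (r.upd ⟨ν, b⟩ b').app = as.map r.app ++ [⟨ν, b'⟩] := by
  have hra : ∀ a ∈ as, (r.upd ⟨ν, b⟩ b').app a = r.app a := fun a ha =>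
    congrArg (Sigma.mk a.1) (r.upd_ne b' (ne_of_mem_of_not_mem ha hb))
  rw [List.map_append, List.map_singleton, List.map_congr_left hra, NSig.Env.app, NSig.Env.upd_mk]

theorem NSig.Env.injOn_upd {as : List S.AnyName} {r : S.Env} {ν : S.NameTy} {b b' : S.Name ν}
    (hr : ∀ a ∈ as, ∀ b ∈ as, r.app a = r.app b → a = b) (hb : (⟨ν, b⟩ : S.AnyName) ∉ as)
    (hb' : (⟨ν, b'⟩ : S.AnyName) ∉ as.map r.app) : ∀ c ∈ as ++ [⟨ν, b⟩], ∀ d ∈ as ++ [⟨ν, b⟩],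
      (r.upd ⟨ν, b⟩ b').app c = (r.upd ⟨ν, b⟩ b').app d → c = d := by
  have hra : ∀ a ∈ as, (r.upd ⟨ν, b⟩ b').app a = r.app a := fun a ha =>
    congrArg (Sigma.mk a.1) (r.upd_ne b' (ne_of_mem_of_not_mem ha hb))
  have hrb : (r.upd ⟨ν, b⟩ b').app ⟨ν, b⟩ = ⟨ν, b'⟩ := congrArg (Sigma.mk ν) (r.upd_mk b b')
  intro c hc d hd he
  rcases List.mem_append.1 hc with hc | hc <;> rcases List.mem_append.1 hd with hd | hd
  · rw [hra c hc, hra d hd] at he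
    exact hr c hc d hd he
  · rw [hra c hc, List.mem_singleton.1 hd, hrb] at he
    exact absurd (List.mem_map.2 ⟨c, hc, he⟩) hb'
  · rw [hra d hd, List.mem_singleton.1 hc, hrb] at he
    exact absurd (List.mem_map.2 ⟨d, hd, he.symm⟩) hb'
  · rw [List.mem_singleton.1 hc, List.mem_singleton.1 hd]

theorem RepEnv.new (h : RepEnv as η ρ r κ θ) {ν : S.NameTy} {b b' : S.Name ν}
    (hb : (⟨ν, b⟩ : S.AnyName) ∉ as) (hκ : ∀ τ i, (⟨ν, b'⟩ : S.AnyName) ∉ (κ τ i).supp)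
    (hθ : ∀ τ i, (⟨ν, b'⟩ : S.AnyName) ∉ (θ τ i).toHTm.noms) :
    RepEnv (as ++ [⟨ν, b⟩]) (nmEnv η b) ρ (r.upd ⟨ν, b⟩ b') κ θ := by
  have hr : ∀ a ∈ as, (r.upd ⟨ν, b⟩ b').app a = r.app a := fun a ha =>
    congrArg (Sigma.mk a.1) (r.upd_ne b' (ne_of_mem_of_not_mem ha hb))
  have hrb : (r.upd ⟨ν, b⟩ b').app ⟨ν, b⟩ = ⟨ν, b'⟩ := congrArg (Sigma.mk ν) (r.upd_mk b b')
  constructor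
  · exact h.free
  · rintro μ (_ | i)
    · exact List.mem_append.2 (.inr (List.mem_singleton.2 rfl))
    · exact List.mem_append.2 (.inl (h.bound μ i))
  · exact fun τ i c hc => List.mem_append.2 (.inl (h.noms τ i hc))
  · intro a ha τ i
    rcases List.mem_append.1 ha with ha | ha
    · rw [hr a ha]; exact h.notMem_supp a ha τ i
    · rw [List.mem_singleton.1 ha, hrb]; exact hκ τ i
  · intro τ X s e
    refine (sem_congr _ fun c hc => ?_).trans ((h.sem_eq τ X s e).trans (sem_congr _ fun c hc => ?_))
    · have hcas : c ∈ as := h.noms τ X hc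
      rw [NSig.Env.mix_mem _ _ hcas, NSig.Env.mix_mem _ _ (List.mem_append.2 (.inl hcas)),
        r.upd_ne b' (ne_of_mem_of_not_mem hcas hb)]
    · have hcb : c ≠ ⟨ν, b'⟩ := fun h => hθ τ X (h ▸ hc)
      rw [r.map_app_upd b' hb]
      by_cases hcas : c ∈ as.map r.app
      · rw [NSig.Env.mix_mem _ _ hcas, NSig.Env.mix_mem _ _ (List.mem_append.2 (.inl hcas))]
      · rw [NSig.Env.mix_notMem _ _ hcas, NSig.Env.mix_notMem _ _ (by simp [hcas, hcb])]

theorem Compat.new (h : RepEnv as η ρ r κ θ) {N : List S.AnyName} (hc : Compat as η r N)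
    {ν : S.NameTy} {b b' : S.Name ν} (hb : (⟨ν, b⟩ : S.AnyName) ∉ as)
    (hbN : (⟨ν, b⟩ : S.AnyName) ∉ N) (hb' : (⟨ν, b'⟩ : S.AnyName) ∉ as.map r.app)
    (hbN' : (⟨ν, b'⟩ : S.AnyName) ∉ N) :
    Compat (as ++ [⟨ν, b⟩]) (nmEnv η b) (r.upd ⟨ν, b⟩ b') N := by
  have hmap := r.map_app_upd b' hb
  constructor
  · exact NSig.Env.injOn_upd hc.inj hb hb'
  · intro μ n hn
    rcases n with a | (_ | i)
    · have haN : (⟨μ, a⟩ : S.AnyName) ∈ N := hn (List.mem_singleton.2 rfl)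
      have hab : (⟨μ, a⟩ : S.AnyName) ≠ ⟨ν, b⟩ := ne_of_mem_of_not_mem haN hbN
      have hab' : (⟨μ, a⟩ : S.AnyName) ≠ ⟨ν, b'⟩ := ne_of_mem_of_not_mem haN hbN'
      have h₁ := hc.cases μ (.free a) hn
      have h₂ := r.upd_ne b' hab
      simp only [nmEnv, h.free] at h₁ h₂ ⊢
      rw [h₂, hmap]
      rcases h₁ with h₁ | ⟨h₁, h₁'⟩
      · exact .inl (List.mem_append.2 (.inl h₁))
      · refine .inr ⟨h₁, fun h' => ?_⟩
        rcases List.mem_append.1 h' with h' | h'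
        · exact h₁' h'
        · exact hab' (List.mem_singleton.1 h')
    · exact .inl (List.mem_append.2 (.inr (List.mem_singleton.2 rfl)))
    · exact .inl (List.mem_append.2 (.inl (h.bound μ i)))

end

/-- The translation of a goal represents its ground instances, whatever names have been chosen for
the bound names. -/
theorem rep_trGoal {Λ : List S.NameTy} {Γ : List S.Ty} (G : Goal S Λ Γ) :
    ∀ {Γ' : List S.target.Ty} {as : List S.AnyName}
      {η : ∀ ν, Nm S Λ ν → S.Name ν} {ρ : ∀ τ, Ix Γ τ → HTm S.target Γ' (trTy τ)} {r : S.Env}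
      {κ : ∀ τ, Ix Γ' τ → HTm S.target [] τ} {θ : ∀ τ, Ix Γ τ → Tm S [] [] τ},
      RepEnv as η ρ r κ θ → Compat as η r G.names → (∀ a, G.ActsOnVar a → a ∈ as) →
      Rep as r ((trGoal as η ρ G).subst κ) ((G.mapName (renNm η r)).subst θ) := by
  induction G with
  | top => intros; exact .top
  | atom p ts =>
    intro _ as η ρ r κ θ h hc hact
    have hN : ∀ i, (ts i).names ⊆ (Goal.atom (S := S) p ts).names := fun i c hc =>
      List.mem_flatMap.2 ⟨i, List.mem_finRange i, hc⟩
    refine .atom (h.opens hc (fun b hb => ?_) (.atom fun i => ?_))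
    · obtain ⟨i, hi⟩ := Set.mem_iUnion.1 hb
      exact (noms_trTm (A := {a | a ∈ as}) h.names h.noms _ hi).imp (fun h => hN i h) id
    · exact h.conv_trTm hc (hN i) fun a ha => hact a ⟨i, ha⟩
  | @fresh _ _ ν τ a t =>
    intro _ as η ρ r κ θ h hc hact
    have ha : a.names ⊆ (Goal.fresh (S := S) a t).names := List.subset_append_left _ _
    have ht : t.names ⊆ (Goal.fresh (S := S) a t).names := List.subset_append_right _ _
    refine .fresh (h.opens hc (fun b hb => ?_) (.atom fun i => ?_))
    · obtain ⟨i, hi⟩ := Set.mem_iUnion.1 hb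
      rcases i with ⟨_ | _ | i, hlt⟩
      · have hb' : b = ⟨_, η _ a⟩ := hi
        rw [hb']
        exact (h.names ν a).imp (fun h => ha h) id
      · exact (noms_trTm (A := {a | a ∈ as}) h.names h.noms t hi).imp (fun h => ht h) id
      · exact absurd hlt (Nat.not_lt.2 (Nat.le_add_left 2 i))
    · rcases i with ⟨_ | _ | i, hlt⟩
      · refine (?_ : HTm.nom (L := S.target) (NSig.Env.mix as r (fun _ a => a) ν (η ν a)) =
          .nom (L := S.target) (r ν (η ν a))) ▸ HTm.Conv.refl _
        congr 1
        by_cases has : (⟨ν, η ν a⟩ : S.AnyName) ∈ as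
        · exact NSig.Env.mix_mem (a := ⟨ν, η ν a⟩) _ _ has
        · refine (NSig.Env.mix_notMem (a := ⟨ν, η ν a⟩) _ _ has).trans ?_
          exact ((hc.cases ν a ha).resolve_left has).1.symm
      · exact h.conv_trTm hc ht hact
      · exact absurd hlt (Nat.not_lt.2 (Nat.le_add_left 2 i))
  | eq t u =>
    intro _ as η ρ r κ θ h hc hact
    have ht : t.names ⊆ (Goal.eq (S := S) t u).names := List.subset_append_left _ _
    have hu : u.names ⊆ (Goal.eq (S := S) t u).names := List.subset_append_right _ _
    refine .eq (h.opens hc (fun b hb => ?_)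
      (.eq (h.conv_trTm hc ht fun a ha => hact a (.inl ha))
        (h.conv_trTm hc hu fun a ha => hact a (.inr ha))))
    rcases hb with hb | hb
    · exact (noms_trTm (A := {a | a ∈ as}) h.names h.noms _ hb).imp (fun h => ht h) id
    · exact (noms_trTm (A := {a | a ∈ as}) h.names h.noms _ hb).imp (fun h => hu h) id
  | and G H hG hH =>
    intro _ as η ρ r κ θ h hc hact
    exact .and (hG h (hc.mono (List.subset_append_left _ _)) fun a ha => hact a (.inl ha))
      (hH h (hc.mono (List.subset_append_right _ _)) fun a ha => hact a (.inr ha))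
  | or G H hG hH =>
    intro _ as η ρ r κ θ h hc hact
    exact .or (hG h (hc.mono (List.subset_append_left _ _)) fun a ha => hact a (.inl ha))
      (hH h (hc.mono (List.subset_append_right _ _)) fun a ha => hact a (.inr ha))
  | ex G hG =>
    intro _ as η ρ r κ θ h hc hact
    refine .ex (fun a ha => ?_) fun u t hut => ?_
    · refine HFm.notMem_supp_bind _ ?_ fun b hb hab => ?_
      · rintro _ (_ | i) hc
        · exact HTm.supp_subset_noms _ hc
        · obtain ⟨u, hu, hn⟩ := HTm.exists_conv_of_notMem_supp (h.notMem_supp a ha _ i)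
          have := HTm.supp_subset_noms _ (hu.weaken.mem_supp hc)
          rw [HTm.weaken, HTm.noms_rename] at this
          exact hn this
      · rw [HTm.weaken, HTm.noms_rename] at hab
        have hab : r.app a = b := hab
        obtain ⟨hbN, hbas⟩ := noms_trGoal G as η _ h.names (by
          rintro _ (_ | i) d hd
          · exact (HTm.noms_appNoms (L := S.target) as _ hd).resolve_left fun h => h.elim
          · exact h.noms _ i (by simpa [Ix.cons, HTm.weaken, HTm.noms_rename] using hd)) hb
        rcases hc.cases b.1 (.free b.2) (fun c hc => by rwa [List.mem_singleton.1 hc]) with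
          h' | ⟨_, h'⟩
        · rw [h.free] at h'; exact hbas h'
        · rw [h.free] at h'
          exact h' (List.mem_map.2 ⟨a, ha, hab⟩)
    · rw [Goal.subst_liftSub_inst]
      exact (HFm.bind_liftSub_inst _ κ (fun _ a => .nom a) u).symm ▸ hG (h.ex hut) hc hact
  | @new _ _ ν G hG =>
    intro _ as η ρ r κ θ h hc hact
    have hbl := (S.exists_fresh ν (as ++ G.names)).choose_spec
    rw [List.mem_append, not_or] at hbl
    obtain ⟨l, hl⟩ := Ix.exists_list (fun τ i a => a ∈ (κ τ i).noms)
      fun τ i => (κ τ i).exists_noms_subset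
    obtain ⟨l', hl'⟩ := Ix.exists_list (fun τ i a => a ∈ (θ τ i).toHTm.noms)
      fun τ i => (θ τ i).toHTm.exists_noms_subset
    refine .new (S.freshName ν (as ++ G.names)) (as.map r.app ++ G.names ++ l ++ l') hbl.1
      fun b' hb' => ?_
    simp only [List.mem_append, not_or] at hb'
    obtain ⟨⟨⟨hb₁, hb₂⟩, hb₃⟩, hb₄⟩ := hb'
    have h' := h.new (b' := b') hbl.1 (fun τ i h => hb₃ (hl τ i _ (HTm.supp_subset_noms _ h)))
      fun τ i h => hb₄ (hl' τ i _ h)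
    have key := hG h' (hc.new h hbl.1 hbl.2 hb₁ hb₂)
      fun a ha => List.mem_append.2 (.inl (hact a ha))
    refine Eq.mp (congrArg (Rep _ _ _) ?_) key
    refine .trans (congrArg (Goal.subst θ) (G.mapName_congr fun μ n hn => ?_))
      (Goal.new_subst_instName G _ θ b').symm
    rcases n with a | (_ | i)
    · refine congrArg Nm.free (?_ :
        r.upd ⟨ν, S.freshName ν (as ++ G.names)⟩ b' μ (η μ (.free a)) = r μ (η μ (.free a)))
      rw [h.free]
      exact r.upd_ne (b := ⟨μ, a⟩) b' (ne_of_mem_of_not_mem (hn (List.mem_singleton.2 rfl)) hbl.2)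
    · exact congrArg Nm.free (r.upd_mk _ b')
    · exact congrArg Nm.free (r.upd_ne (b := ⟨μ, η μ (.bound i)⟩) b'
        (ne_of_mem_of_not_mem (h.bound μ i) hbl.1))

end Fundamental

section Clauses

variable {S : NSig.{u}}

/-! ### Translated clauses -/

theorem Tm.mem_names_of_actsOnVar {Λ : List S.NameTy} {Γ : List S.Ty} {a : S.AnyName} {τ : S.Ty}
    {t : Tm S Λ Γ τ} (h : t.ActsOnVar a) : a ∈ t.names := by
  induction t with
  | name b => exact h.elim
  | var X => exact h.elim
  | fn f ts ih =>
    obtain ⟨i, hi⟩ := h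
    exact List.mem_flatMap.2 ⟨i, List.mem_finRange i, ih i hi⟩
  | swap b c t ih =>
    rcases h with ⟨h | h, _⟩ | h
    · exact List.mem_append.2 (.inl (List.mem_append.2 (.inl h)))
    · exact List.mem_append.2 (.inl (List.mem_append.2 (.inr h)))
    · exact List.mem_append.2 (.inr (ih h))
  | abs b t ih =>
    rcases h with ⟨h, _⟩ | h
    · exact List.mem_append.2 (.inl h)
    · exact List.mem_append.2 (.inr (ih h))

theorem Goal.mem_names_of_actsOnVar {a : S.AnyName} {Λ : List S.NameTy} {Γ : List S.Ty}
    {G : Goal S Λ Γ} (h : G.ActsOnVar a) : a ∈ G.names := by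
  induction G with
  | top => exact h.elim
  | atom p ts =>
    obtain ⟨i, hi⟩ := h
    exact List.mem_flatMap.2 ⟨i, List.mem_finRange i, Tm.mem_names_of_actsOnVar hi⟩
  | fresh b t => exact List.mem_append.2 (.inr (Tm.mem_names_of_actsOnVar h))
  | eq t u => exact List.mem_append.2 (h.imp Tm.mem_names_of_actsOnVar Tm.mem_names_of_actsOnVar)
  | and G H hG hH => exact List.mem_append.2 (Or.imp hG hH h)
  | or G H hG hH => exact List.mem_append.2 (Or.imp hG hH h)
  | ex G hG => exact hG h
  | new G hG => exact hG h

theorem Nm.act_eq_renNm (π : S.NPerm) :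
    (Nm.act π : ∀ ν, Nm S [] ν → Nm S [] ν) = renNm (fun _ a => a.get) fun ν => π ν := by
  funext ν n
  cases n with
  | free a => rfl
  | bound i => exact i.elim

theorem Tm.act_subst {Γ Γ' : List S.Ty} {τ : S.Ty} (t : Tm S [] Γ τ) (π : S.NPerm)
    (θ : ∀ τ, Ix Γ τ → Tm S [] Γ' τ) : (t.subst θ).act π =
      (t.mapName (renNm (fun _ a => a.get) fun ν => π ν)).subst fun τ X => (θ τ X).act π := by
  rw [Tm.act, Tm.mapName_subst, ← Nm.act_eq_renNm]
  rfl

theorem Goal.act_subst {Γ Γ' : List S.Ty} (G : Goal S [] Γ) (π : S.NPerm)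
    (θ : ∀ τ, Ix Γ τ → Tm S [] Γ' τ) : (G.subst θ).act π =
      (G.mapName (renNm (fun _ a => a.get) fun ν => π ν)).subst fun τ X => (θ τ X).act π := by
  rw [Goal.act, Goal.mapName_subst, ← Nm.act_eq_renNm]
  rfl

theorem NSig.app_injective (π : S.NPerm) :
    Function.Injective (NSig.Env.app (S := S) fun ν => π ν) := by
  rintro ⟨ν, a⟩ ⟨μ, b⟩ h
  cases (Sigma.mk.inj h).1
  cases (π _).injective (eq_of_heq (Sigma.mk.inj h).2)
  rfl

theorem compat_self (π : S.NPerm) (as : List S.AnyName) :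
    Compat as (fun _ (a : Nm S [] _) => a.get) (fun ν => π ν) as where
  inj _ _ _ _ h := NSig.app_injective π h
  cases ν n hn := by
    cases n with
    | free a => exact .inl (hn (List.mem_singleton.2 rfl))
    | bound i => exact i.elim

theorem Tm.not_hasVar {Λ : List S.NameTy} : ∀ {τ : S.Ty} (t : Tm S Λ [] τ), ¬ t.HasVar
  | _, .name _, h => h
  | _, .var X, _ => X.elim
  | _, .fn _ ts, h => Exists.elim h fun i h => (ts i).not_hasVar h
  | _, .swap _ _ t, h => t.not_hasVar h
  | _, .abs _ t, h => t.not_hasVar h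

theorem Tm.subst_nil {τ : S.Ty} (t : Tm S [] [] τ) (θ : ∀ τ, Ix [] τ → Tm S [] [] τ) :
    t.subst θ = t := by
  rw [show θ = fun _ i => .var i from funext fun _ => funext fun i => i.elim, Tm.subst_var]

theorem Tm.sem_act (π : S.NPerm) {τ : S.Ty} (t : Tm S [] [] τ) (s : S.Env) :
    sem₀ (t.act π).toHTm s = sem₀ t.toHTm fun ν a => s ν (π ν a) := by
  have h := sem_trTm_ground (Γ' := []) (ρ := fun _ i => i.elim) (θ := fun _ i => i.elim)
    (compat_self π t.names) (fun _ i => i.elim) t t.not_hasVar (List.Subset.refl _)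
    (fun ν a => s ν (π ν a)) s fun _ _ _ => rfl
  rw [← Nm.act_eq_renNm, Tm.subst_nil] at h
  exact h.symm

theorem Tm.conv_mapNom (π : S.NPerm) {τ : S.Ty} (t : Tm S [] [] τ) :
    HTm.Conv (HTm.mapNom (L := S.target) (fun ν => π ν) t.toHTm) (t.act π).toHTm :=
  HTm.conv_of_sem fun s => by
    refine (sem_bind t.toHTm _ _ s _).trans (.trans ?_ (t.sem_act π s).symm)
    exact congrArg (sem _ _) (funext fun _ => funext fun i => i.elim)

/-- A family over the positions in `Γ` gives a family over the positions in `Γ.map f`. -/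
def Ix.unmap {α β : Type u} {f : α → β} {C : β → Type v} :
    ∀ {Γ : List α}, (∀ τ, Ix Γ τ → C (f τ)) → ∀ τ', Ix (Γ.map f) τ' → C τ'
  | [], _ => fun _ i => i.elim
  | _ :: _, h => Ix.cons (h _ .z) (Ix.unmap fun τ i => h τ (.s i))

theorem Ix.unmap_map {α β : Type u} {f : α → β} {C : β → Type v} :
    ∀ {Γ : List α} (h : ∀ τ, Ix Γ τ → C (f τ)) (τ : α) (i : Ix Γ τ), Ix.unmap h _ (i.map f) = h τ i
  | _ :: _, _, _, .z => rfl
  | _ :: _, h, τ, .s i => Ix.unmap_map (fun τ i => h τ (.s i)) τ i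

theorem Ix.map_induction {α β : Type u} {f : α → β} :
    ∀ {Γ : List α} {P : ∀ τ', Ix (Γ.map f) τ' → Prop}, (∀ (τ : α) (i : Ix Γ τ), P (f τ) (i.map f)) →
      ∀ τ' i, P τ' i
  | [], _, _, _, i => i.elim
  | _ :: _, _, h, _, .z => h _ .z
  | _ :: _, P, h, τ', .s i =>
    Ix.map_induction (P := fun τ' i => P τ' (.s i)) (fun τ i => h τ (.s i)) τ' i

/-- The name at a position in a list of names. -/
def nameAt : ∀ (as : List S.AnyName) (ν : S.NameTy), Ix (as.map Sigma.fst) ν → S.Name ν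
  | [], _ => fun i => i.elim
  | a :: as, ν => fun i => Ix.cons (C := S.Name) a.2 (nameAt as) ν i

theorem nameAt_mem : ∀ (as : List S.AnyName) (ν : S.NameTy) (i : Ix (as.map Sigma.fst) ν),
    (⟨ν, nameAt as ν i⟩ : S.AnyName) ∈ as
  | _ :: _, _, .z => List.mem_cons_self
  | _ :: as, ν, .s i => List.mem_cons_of_mem _ (nameAt_mem as ν i)

theorem exists_nameAt : ∀ (as : List S.AnyName) (a : S.AnyName), a ∈ as →
    ∃ i : Ix (as.map Sigma.fst) a.1, nameAt as a.1 i = a.2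
  | b :: as, a, h => by
    by_cases hab : a = b
    · subst hab; exact ⟨.z, rfl⟩
    · obtain ⟨i, hi⟩ := exists_nameAt as a ((List.mem_cons.1 h).resolve_left hab)
      exact ⟨.s i, hi⟩

theorem nameAt_injective : ∀ (as : List S.AnyName), as.Nodup → ∀ ν,
    Function.Injective (nameAt as ν)
  | [], _, _ => fun i => i.elim
  | a :: as, h, ν => by
    obtain ⟨ha, has⟩ := List.nodup_cons.1 h
    intro i j hij
    cases i with
    | z =>
      cases j with
      | z => rfl
      | s j =>
        have h' : a = ⟨a.1, nameAt as a.1 j⟩ := congrArg (Sigma.mk a.1) hij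
        exact absurd (Eq.mpr (congrArg (· ∈ as) h') (nameAt_mem as _ j)) ha
    | s i =>
      cases j with
      | z =>
        have h' : a = ⟨a.1, nameAt as a.1 i⟩ := congrArg (Sigma.mk a.1) hij.symm
        exact absurd (Eq.mpr (congrArg (· ∈ as) h') (nameAt_mem as _ i)) ha
      | s j => exact congrArg Ix.s (nameAt_injective as has ν hij)

/-- Distinct names can be moved to other distinct names by a composition of swappings. -/
theorem exists_perm_nameAt : ∀ (as : List S.AnyName), as.Nodup →
    ∀ ζ : ∀ ν, Ix (as.map Sigma.fst) ν → S.Name ν, (∀ ν, Function.Injective (ζ ν)) →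
      ∃ π ∈ S.perms, ∀ ν i, π ν (nameAt as ν i) = ζ ν i
  | [], _, _, _ => ⟨1, S.perms.one_mem, fun _ i => i.elim⟩
  | a :: as, h, ζ, hζ => by
    obtain ⟨ha, has⟩ := List.nodup_cons.1 h
    obtain ⟨π, hπ, hπζ⟩ := exists_perm_nameAt as has (fun ν i => ζ ν (.s i))
      fun ν i j hij => by cases hζ ν hij; rfl
    refine ⟨S.swapping (π a.1 a.2) (ζ a.1 .z) * π,
      S.perms.mul_mem (Submonoid.subset_closure ⟨_, _, _, rfl⟩) hπ, ?_⟩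
    rintro ν (_ | i)
    · exact NSig.swapping_left _ _
    · refine Eq.trans ?_ (hπζ ν i)
      refine NSig.swapping_of_ne (c := ⟨ν, π ν (nameAt as ν i)⟩) _ _ (fun h' => ha ?_) fun h' => ?_
      · have := NSig.app_injective π (a₁ := ⟨ν, nameAt as ν i⟩) (a₂ := a) h'
        exact this ▸ nameAt_mem as ν i
      · rw [hπζ] at h'
        cases (Sigma.mk.inj h').1
        cases hζ _ (eq_of_heq (Sigma.mk.inj h').2)

/-- The assignment for the head of a clause: the variables for the names `a⃗` have the values `e`,
the others are given by `γ`. -/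
def headAssign {Γ : List S.target.Ty} (γ : ∀ τ, Ix Γ τ → Dom S τ) (e : S.Env) :
    ∀ (as : List S.AnyName) (τ : S.target.Ty), Ix (headCtx S.target (as.map Sigma.fst) Γ) τ → Dom S τ
  | [] => γ
  | a :: as => Ix.cons (C := Dom S) (σ := .base (.inl a.1)) (e a.1 a.2) (headAssign γ e as)

theorem sem_absNoms {Γ : List S.target.Ty} {τ : S.target.Ty} (t : HTm S.target Γ τ)
    (γ : ∀ τ, Ix Γ τ → Dom S τ) (e : S.Env) : ∀ (as : List S.AnyName) (s : S.Env),
      sem (HTm.absNoms (L := S.target) as t) s (headAssign γ e as) =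
        sem t (NSig.Env.mix as e s) γ
  | [], s => congrArg (fun s => sem t s γ)
      (NSig.Env.ext fun _ => (NSig.Env.mix_notMem e s List.not_mem_nil).symm)
  | a :: as, s => by
    rw [NSig.Env.mix_cons]
    exact (sem_absNom (S := S) a _ s (headAssign γ e as) (e a.1 a.2)).trans
      (sem_absNoms t γ e as _)

theorem sem_headSub {Γ : List S.target.Ty} (θ : ∀ τ, Ix Γ τ → HTm S.target [] τ) (s e : S.Env) :
    ∀ (as : List S.AnyName) (ζ : ∀ ν, Ix (as.map Sigma.fst) ν → S.Name ν),
      (∀ ν i, s ν (ζ ν i) = e ν (nameAt as ν i)) →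
      (fun τ i => sem₀ (headSub (L := S.target) θ (as.map Sigma.fst) ζ τ i) s) =
        headAssign (fun τ i => sem₀ (θ τ i) s) e as
  | [], _, _ => rfl
  | a :: as, ζ, h => by
    funext τ i
    cases i with
    | z => exact h _ .z
    | s i =>
      exact congrFun (congrFun (sem_headSub θ s e as (fun ν i => ζ ν (.s i)) fun ν i => h ν (.s i))
        τ) i

/-- The value of the head of a translated clause: instantiating `∇a⃗` by the nominal constants `ζ`
amounts to evaluating `a⃗` as these. -/
theorem sem_head {Γ : List S.target.Ty} {τ : S.target.Ty} (t : HTm S.target Γ τ)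
    (θ : ∀ τ, Ix Γ τ → HTm S.target [] τ) (s e : S.Env) (as : List S.AnyName)
    (ζ : ∀ ν, Ix (as.map Sigma.fst) ν → S.Name ν)
    (h : ∀ ν i, s ν (ζ ν i) = e ν (nameAt as ν i)) :
    sem₀ ((HTm.absNoms (L := S.target) as t).subst (headSub (L := S.target) θ (as.map Sigma.fst) ζ))
        s =
      sem t (NSig.Env.mix as e s) fun τ i => sem₀ (θ τ i) s := by
  refine (sem_bind _ _ _ s _).trans (.trans ?_ (sem_absNoms t _ e as s))
  exact congrArg (sem _ s) (sem_headSub θ s e as ζ h)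

/-- The raised variables of a clause, instantiated by `κ`, correspond to the ground substitution `θ`. -/
theorem repEnv_raiseEnv {as : List S.AnyName} {vars : List S.Ty} {r : S.Env}
    {κ : ∀ τ, Ix (vars.map fun τ => raiseTy (L := S.target) as (trTy τ)) τ → HTm S.target [] τ}
    {θ : ∀ τ, Ix vars τ → Tm S [] [] τ}
    (h : ∀ τ X, Raises as r (κ _ (X.map fun τ => raiseTy (L := S.target) as (trTy τ))) (θ τ X)) :
    RepEnv as (fun _ (a : Nm S [] _) => a.get) (raiseEnv as vars) r κ θ where
  free _ _ := rfl
  bound _ i := i.elim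
  noms := noms_raiseEnv as vars
  notMem_supp a ha := Ix.map_induction fun τ X => (h τ X).notMem_supp a ha
  sem_eq τ X s e := by
    refine (sem_appNoms _ _ as _).trans (.trans ?_ ((h τ X).sem_eq s e))
    exact semApps_congr as _ fun a ha => NSig.Env.mix_mem _ _ ha

/-! ### From αProlog to `𝒢⁻` -/

theorem HProv.conv {L : HSig.{u}} {𝒟 : Set (HClause L)} {F : HFm L []} (h : HProv 𝒟 F) :
    ∀ {F' : HFm L []}, HFm.Conv F F' → HProv 𝒟 F' := by
  induction h with
  | top => intro F' h'; cases h'; exact .top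
  | eq h => intro F' h'; cases h' with | eq k k' => exact .eq (k.symm.trans (h.trans k'))
  | and _ _ ih ih' => intro F' h'; cases h' with | and k k' => exact .and (ih k) (ih' k')
  | or_left _ ih => intro F' h'; cases h' with | or k k' => exact .or_left (ih k)
  | or_right _ ih => intro F' h'; cases h' with | or k k' => exact .or_right (ih k')
  | ex t _ ih => intro F' h'; cases h' with | ex k => exact .ex t (ih (k.inst t))
  | nabla a ha _ ih =>
    intro F' h'
    cases h' with
    | nabla k => exact .nabla a (fun h => ha (k.symm.mem_supp h)) (ih (k.inst _))
  | defn D hD θ ζ hζ hsupp hts h _ =>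
    intro F' h'
    cases h' with
    | atom k => exact .defn D hD θ ζ hζ hsupp (fun i => (k i).symm.trans (hts i)) h

theorem Opens.hProv {F A : HFm S.target []} {𝒟 : Set (HClause S.target)} (h : Opens F A)
    (hA : ∀ π : S.NPerm, HProv 𝒟 (HFm.mapNom (L := S.target) (fun ν => π ν) A)) : HProv 𝒟 F := by
  induction h with
  | base π h => exact (hA π).conv h.symm
  | @nabla ν B A h ih =>
    obtain ⟨l, hl⟩ := HFm.exists_noms_subset B
    obtain ⟨c, hc⟩ := S.exists_fresh ν l
    have hc' : (⟨ν, c⟩ : S.AnyName) ∉ B.supp := fun h => hc (hl _ (HFm.supp_subset_noms _ h))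
    exact .nabla (L := S.target) c hc' (ih c hc' hA)

/-- Backchaining on a translated clause. -/
theorem HProv.backchain {Δ : Set (NClause S)} {D : NClause S} (hD : D ∈ Δ) (π : S.NPerm)
    (θ : ∀ τ, Ix D.vars τ → Tm S [] [] τ)
    {us : ∀ i, HTm S.target [] (trTy (S.predArg D.pred i))}
    (hus : ∀ i, HTm.Conv (us i) (((D.args i).subst θ).act π).toHTm)
    (hbody : ∀ F, Rep D.bnames (fun ν => π ν) F ((D.body.subst θ).act π) →
      HProv (trProgram Δ) F) :
    HProv (trProgram Δ) (.atom (L := S.target) (.inl D.pred) us) := by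
  let κ : ∀ τ, Ix (trClause D).xs τ → HTm S.target [] τ :=
    Ix.unmap fun τ X => lamNoms (fun ν => π ν) ((θ τ X).act π).toHTm D.bnames
  have hκ : ∀ τ X, Raises D.bnames (fun ν => π ν)
      (κ _ (X.map fun τ => raiseTy (L := S.target) D.bnames (trTy τ))) ((θ τ X).act π) := by
    intro τ X
    rw [show κ _ (X.map _) = _ from Ix.unmap_map _ τ X]
    exact raises_lamNoms _ _ _
  have hrep := repEnv_raiseEnv hκ
  have hc := compat_self π D.bnames
  refine .defn (trClause D) (.inl ⟨D, hD, rfl⟩) κ (fun ν i => π ν (nameAt D.bnames ν i))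
    (fun ν => (π ν).injective.comp (nameAt_injective _ D.nodup ν))
    (fun τ x ν z => hrep.notMem_supp _ (nameAt_mem _ _ z) τ x) (fun i => (hus i).trans ?_)
    (hbody _ ?_)
  · refine HTm.conv_of_sem fun s => ?_
    refine .trans ?_ (sem_head _ κ s (fun ν a => s ν (π ν a)) D.bnames _ fun _ _ => rfl).symm
    rw [Tm.act_subst]
    exact (hrep.sem_trTm hc (D.args_closed i)
      (fun a ha => D.args_closed i (Tm.mem_names_of_actsOnVar ha)) s).symm
  · rw [Goal.act_subst]
    exact rep_trGoal D.body hrep (hc.mono D.body_closed) fun a ha =>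
      D.body_closed (Goal.mem_names_of_actsOnVar ha)

theorem Val.Fresh.hProv {Δ : Set (NClause S)} {ν : S.NameTy} {τ : S.Ty} {a : S.Name ν} {v : Val S τ}
    (h : Val.Fresh ⟨ν, a⟩ v) (π : S.NPerm)
    {us : ∀ i, HTm S.target [] (S.target.predArg (.inr (ν, trTy τ)) i)}
    (h₀ : HTm.Conv (us 0) (.nom (L := S.target) (π ν a)))
    (h₁ : HTm.Conv (us 1) (HTm.mapNom (L := S.target) (fun ν => π ν) v.toHTm)) :
    HProv (trProgram Δ) (.atom (L := S.target) (.inr (ν, trTy τ)) us) := by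
  have hsupp : (⟨ν, π ν a⟩ : S.AnyName) ∉
      (HTm.mapNom (L := S.target) (fun ν => π ν) v.toHTm).supp :=
    HTm.notMem_supp_mapNom (L := S.target) (c := ⟨ν, a⟩) (fun ν => (π ν).injective)
      fun h' => Val.notMem_noms h (HTm.supp_subset_noms _ h')
  refine .defn (freshClause S ν (trTy τ)) (.inr ⟨ν, trTy τ, rfl⟩)
    (Ix.cons (HTm.mapNom (L := S.target) (fun ν => π ν) v.toHTm) fun _ i => i.elim)
    (Ix.cons (C := S.Name) (π ν a) fun _ i => i.elim) ?_ ?_ ?_ .top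
  · rintro μ (_ | i) (_ | j) _
    · rfl
    · exact j.elim
    · exact i.elim
    · exact i.elim
  · rintro σ (_ | i) μ (_ | j)
    · exact hsupp
    · exact j.elim
    · exact i.elim
    · exact i.elim
  · rintro ⟨_ | _ | i, hlt⟩
    · exact h₀
    · exact h₁
    · exact absurd hlt (Nat.not_lt.2 (Nat.le_add_left 2 i))

/-- Provable goals have provable representations. The statement is closed under permutations, since
a name that is chosen for a bound name in the given proof may have to be exchanged. -/
theorem NProv.hProv {Δ : Set (NClause S)} {G : Goal S [] []} (h : NProv Δ G) :
    ∀ (π : S.NPerm) {as : List S.AnyName} {r : S.Env} {F : HFm S.target []},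
      Rep as r F (G.act π) → HProv (trProgram Δ) F := by
  induction h with
  | top =>
    intro π as r F hF
    have hF : Rep as r F .top := hF
    cases hF
    exact .top
  | @fresh ν τ a t h =>
    intro π as r F hF
    have hF : Rep as r F (.fresh (Nm.act π ν a) (t.act π)) := hF
    cases hF with
    | fresh hF =>
      refine hF.hProv fun π' => ?_
      refine Val.Fresh.hProv (Δ := Δ) h (π' * π) ?_ ?_
      · cases a with
        | free a => exact .refl _
        | bound i => exact i.elim
      · refine ((t.act π).conv_mapNom π').trans ?_
        rw [Tm.act_act]
        exact (t.conv_mapNom (π' * π)).symm.trans (t.conv_toHTm.bind _ _)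
  | @eq τ t u h =>
    intro π as r F hF
    have hF : Rep as r F (.eq (t.act π) (u.act π)) := hF
    cases hF with
    | eq hF =>
      refine hF.hProv fun π' => .eq (HTm.Conv.bind ?_ _ _)
      exact HTm.conv_of_sem fun s => by
        have := Tm.eqv_eval.1 h
        exact (Tm.sem_act π t s).trans ((this _).trans (Tm.sem_act π u s).symm)
  | @and G H hG hH ihG ihH =>
    intro π as r F hF
    have hF : Rep as r F (.and (G.act π) (H.act π)) := hF
    cases hF with
    | and k k' => exact .and (ihG π k) (ihH π k')
  | @or_left G H h ih =>
    intro π as r F hF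
    have hF : Rep as r F (.or (G.act π) (H.act π)) := hF
    cases hF with
    | or k k' => exact .or_left (ih π k)
  | @or_right G H h ih =>
    intro π as r F hF
    have hF : Rep as r F (.or (G.act π) (H.act π)) := hF
    cases hF with
    | or k k' => exact .or_right (ih π k')
  | @ex τ G t h ih =>
    intro π as r F hF
    have hF : Rep as r F (.ex (G.act π)) := hF
    cases hF with
    | ex _ k =>
      refine .ex (lamNoms r (t.act π).toHTm as) (ih π (as := as) (r := r) ?_)
      rw [Goal.act, Goal.mapName_inst]
      exact k _ _ (raises_lamNoms as r (t.act π))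
  | @new ν G a ha h ih =>
    intro π as r F hF
    have hF : Rep as r F (.new (G.mapName (Nm.lift (Nm.act π)))) := hF
    cases hF with
    | new b l hb k =>
      -- The name `a` of the given proof is exchanged for one that suits the representation.
      obtain ⟨a', ha'⟩ := S.exists_fresh ν (l ++ G.names.map (NSig.Env.app fun ν => π ν))
      rw [List.mem_append, not_or] at ha'
      refine ih (S.swapping (π ν a) a' * π) (as := as ++ [⟨ν, b⟩]) (r := r.upd ⟨ν, b⟩ a')
        (F := F) ?_
      rw [Goal.act_instName (π := π) (π' := S.swapping (π ν a) a' * π) (b := a') G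
        (NSig.swapping_left _ _)]
      · exact k a' ha'.1
      · intro c hc
        refine NSig.swapping_of_ne (c := ⟨c.1, π c.1 c.2⟩) _ _ (fun h' => ha ?_) fun h' => ha'.2 ?_
        · exact NSig.app_injective π (a₁ := c) (a₂ := ⟨ν, a⟩) h' ▸ hc
        · exact List.mem_map.2 ⟨c, hc, h'⟩
  | @backchain D hD π₀ hπ₀ θ ts hts h ih =>
    intro π as r F hF
    have hF : Rep as r F (.atom D.pred fun i => (ts i).act π) := hF
    cases hF with
    | atom hF =>
      refine hF.hProv fun π' => ?_
      refine HProv.backchain hD (π' * π * π₀) θ (fun i => ?_) fun F' hF' => ih (π' * π)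
        (as := D.bnames) (r := fun ν => (π' * π * π₀) ν) ?_ (F := F')
      · refine HTm.conv_of_sem fun s => ?_
        refine (HTm.Conv.sem_eq ((ts i |>.act π).conv_mapNom π') s _).trans ?_
        refine (Tm.sem_act π' _ s).trans ((Tm.sem_act π _ _).trans ?_)
        refine (Tm.eqv_eval.1 (hts i) _).trans ((Tm.sem_act π₀ _ _).trans ?_)
        exact (Tm.sem_act (π' * π * π₀) _ s).symm
      · rw [Goal.act_act]
        exact hF'

end Clauses

section Soundness

variable {S : NSig.{u}}

/-! ### From `𝒢⁻` to αProlog -/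

/-- The goal has the form `Иa.G`. -/
def Goal.IsNew : ∀ {Λ : List S.NameTy} {Γ : List S.Ty}, Goal S Λ Γ → Prop
  | _, _, .new _ => True
  | _, _, _ => False

/-- As `И` leaves no trace in the translation, it is stripped off before a proof of a
representation is analysed. -/
theorem Rep.nProv_of_not_isNew {Δ : Set (NClause S)} {as : List S.AnyName} {r : S.Env}
    {F : HFm S.target []} {G : Goal S [] []} (h : Rep as r F G) :
    (∀ a ∈ as, ∀ b ∈ as, r.app a = r.app b → a = b) →
    (∀ {as : List S.AnyName} {r : S.Env} {G : Goal S [] []},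
      (∀ a ∈ as, ∀ b ∈ as, r.app a = r.app b → a = b) → Rep as r F G → ¬ G.IsNew → NProv Δ G) →
    NProv Δ G := by
  induction h with
  | top => exact fun _ _ => .top
  | atom h => exact fun hr H => H hr (.atom h) id
  | fresh h => exact fun hr H => H hr (.fresh h) id
  | eq h => exact fun hr H => H hr (.eq h) id
  | and h h' _ _ => exact fun hr H => H hr (.and h h') id
  | or h h' _ _ => exact fun hr H => H hr (.or h h') id
  | ex hF h _ => exact fun hr H => H hr (.ex hF h) id
  | @new as r F ν G b l hb h ih =>
    intro hr H
    obtain ⟨b', hb'⟩ := S.exists_fresh ν (l ++ as.map r.app ++ G.names)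
    simp only [List.mem_append, not_or] at hb'
    exact .new b' hb'.2 (ih b' hb'.1.1 (NSig.Env.injOn_upd hr hb hb'.1.2) H)

/-- Some permutation moves the names in `N` away from those in `L`, and moves only names that are
in `L` or not in `M`. -/
theorem NSig.exists_perm_avoiding (M N : List S.AnyName) : ∀ L : List S.AnyName,
    ∃ (σ : S.NPerm) (l : List S.AnyName), (∀ c : S.AnyName, c ∉ l → σ c.1 c.2 = c.2) ∧
      (∀ c ∈ l, c ∈ L ∨ c ∉ M) ∧ ∀ x ∈ N, NSig.Env.app (fun ν => σ ν) x ∉ L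
  | [] => ⟨1, [], fun _ _ => rfl, fun _ h => absurd h List.not_mem_nil, fun _ _ => List.not_mem_nil⟩
  | c :: L => by
    obtain ⟨σ, l, hσ, hl, hN⟩ := NSig.exists_perm_avoiding M N L
    obtain ⟨d, hd⟩ := S.exists_fresh c.1 (c :: L ++ M ++ N.map (NSig.Env.app fun ν => σ ν))
    simp only [List.mem_append, not_or] at hd
    obtain ⟨⟨hdL, hdM⟩, hdN⟩ := hd
    refine ⟨S.swapping c.2 d * σ, c :: ⟨c.1, d⟩ :: l, fun e he => ?_, fun e he => ?_, fun x hx => ?_⟩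
    · simp only [List.mem_cons, not_or] at he
      refine Eq.trans ?_ (hσ e he.2.2)
      have h := hσ e he.2.2
      exact NSig.swapping_of_ne (c := ⟨e.1, σ e.1 e.2⟩) _ _ (by rw [h]; exact he.1)
        (by rw [h]; exact he.2.1)
    · rcases List.mem_cons.1 he with rfl | he
      · exact .inl List.mem_cons_self
      rcases List.mem_cons.1 he with rfl | he
      · exact .inr hdM
      exact (hl e he).imp (List.mem_cons_of_mem _) id
    · by_cases hxc : NSig.Env.app (fun ν => σ ν) x = c
      · have : NSig.Env.app (fun ν => (S.swapping c.2 d * σ) ν) x = ⟨c.1, d⟩ :=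
          (congrArg (NSig.Env.app fun ν => S.swapping c.2 d ν) hxc).trans
            (congrArg (Sigma.mk c.1) (NSig.swapping_left c.2 d))
        rwa [this]
      · have : NSig.Env.app (fun ν => (S.swapping c.2 d * σ) ν) x = NSig.Env.app (fun ν => σ ν) x :=
          congrArg (Sigma.mk x.1) (NSig.swapping_of_ne (c := NSig.Env.app (fun ν => σ ν) x) c.2 d hxc
            fun h => hdN (List.mem_map.2 ⟨x, hx, h⟩))
        rw [this, List.mem_cons, not_or]
        exact ⟨hxc, hN x hx⟩

theorem sem₀_mapNom (m : S.Env) {τ : S.target.Ty} (t : HTm S.target [] τ) (s : S.Env) :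
    sem₀ (HTm.mapNom (L := S.target) m t) s = sem₀ t fun ν a => s ν (m ν a) :=
  (sem_bind t _ _ s _).trans (congrArg (sem t _) (funext fun _ => funext fun i => i.elim))

theorem NSig.comp_inv_comp (π : S.NPerm) (s : S.Env) :
    (fun ν a => s ν (π⁻¹ ν (π ν a))) = s :=
  funext fun ν => funext fun a => congrArg (s ν) ((π ν).symm_apply_apply a)

theorem Val.fresh_of_notMem_supp {ν : S.NameTy} {τ : S.Ty} {a : S.Name ν} {t : Tm S [] [] τ}
    {π : S.NPerm} (h : (⟨ν, π ν a⟩ : S.AnyName) ∉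
      (HTm.mapNom (L := S.target) (fun ν => π ν) t.toHTm).supp) : Val.Fresh ⟨ν, a⟩ t.eval := by
  obtain ⟨v, hv, hav⟩ := HTm.exists_conv_of_notMem_supp (L := S.target) h
  have hsem : ∀ s : S.Env, t.eval.tree s = reify τ (sem₀ v fun ν b => s ν (π⁻¹ ν b)) := fun s => by
    rw [← Tm.reify_sem]
    refine congrArg (reify τ) (.trans ?_ (hv.sem_eq _ _))
    refine .trans ?_ (sem₀_mapNom _ _ _).symm
    exact congrArg (sem₀ _) (NSig.comp_inv_comp π s).symm
  refine Val.fresh_of_tree fun s d => ?_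
  rw [hsem, hsem]
  refine congrArg (reify τ) (sem_congr v fun c hc => s.upd_ne (b := ⟨c.1, π⁻¹ c.1 c.2⟩) d fun h' => ?_)
  have h' := congrArg (NSig.Env.app fun ν => π ν) h'
  have hc' : NSig.Env.app (fun ν => π ν) ⟨c.1, π⁻¹ c.1 c.2⟩ = c :=
    congrArg (Sigma.mk c.1) ((π c.1).apply_symm_apply c.2)
  rw [hc'] at h'
  exact hav (Eq.mp (congrArg (· ∈ v.noms) h') hc)

/-- A use of a translated clause is a backchaining step: the nominal constants for `∇a⃗` determine a
permutation, and the terms for the raised variables, applied to them, the ground substitution. -/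
theorem NProv.of_trClause {Δ : Set (NClause S)} {D : NClause S} (hD : D ∈ Δ)
    (θ : ∀ τ, Ix (trClause D).xs τ → HTm S.target [] τ)
    (ζ : ∀ ν, Ix (trClause D).zs ν → S.Name ν) (hζ : ∀ ν, Function.Injective (ζ ν))
    (hsupp : ∀ τ (x : Ix (trClause D).xs τ) ν (z : Ix (trClause D).zs ν),
      (⟨ν, ζ ν z⟩ : S.AnyName) ∉ (θ τ x).supp)
    {π π' : S.NPerm} {us : ∀ i, Tm S [] [] (S.predArg D.pred i)}
    (hus : ∀ i, HTm.Conv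
      (HTm.mapNom (L := S.target) (fun ν => π ν)
        (((trClause D).args i).subst (headSub (L := S.target) θ (trClause D).zs ζ)))
      (HTm.mapNom (L := S.target) (fun ν => π' ν) (us i).toHTm))
    (ih : ∀ (π : S.NPerm) {as : List S.AnyName} {r : S.Env} {G : Goal S [] []},
      (∀ a ∈ as, ∀ b ∈ as, r.app a = r.app b → a = b) →
      Rep as r (HFm.mapNom (L := S.target) (fun ν => π ν) ((trClause D).body.subst θ)) G →
      NProv Δ G) :
    NProv Δ (.atom D.pred us) := by
  let π₀ : S.NPerm := π'⁻¹ * π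
  let κ : ∀ τ, Ix (trClause D).xs τ → HTm S.target [] τ := fun τ x =>
    HTm.mapNom (L := S.target) (fun ν => π₀ ν) (θ τ x)
  obtain ⟨ϖ, hϖ, hϖζ⟩ := exists_perm_nameAt D.bnames D.nodup (fun ν i => π₀ ν (ζ ν i))
    fun ν => (π₀ ν).injective.comp (hζ ν)
  have hκ : ∀ a ∈ D.bnames, ∀ τ x, NSig.Env.app (fun ν => ϖ ν) a ∉ (κ τ x).supp := by
    intro a ha τ x
    obtain ⟨i, hi⟩ := exists_nameAt D.bnames a ha
    have h := HTm.notMem_supp_mapNom (L := S.target) (fun ν => (π₀ ν).injective) (hsupp τ x a.1 i)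
    rw [NSig.Env.app, ← hi, hϖζ]
    exact h
  choose θ' hθ' using fun τ (X : Ix D.vars τ) =>
    exists_raises D.bnames (fun ν => ϖ ν)
      (κ _ (X.map fun τ => raiseTy (L := S.target) D.bnames (trTy τ))) fun a ha => hκ a ha _ _
  have hrep := repEnv_raiseEnv hθ'
  have hc := compat_self ϖ D.bnames
  have hθ : (fun τ X => ((θ' τ X).act ϖ⁻¹).act ϖ) = θ' :=
    funext fun τ => funext fun X => by rw [Tm.act_act, mul_inv_cancel, Tm.act_one]
  refine .backchain D hD ϖ hϖ (fun τ X => (θ' τ X).act ϖ⁻¹) (fun i => ?_) ?_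
  · rw [Tm.act_subst, hθ]
    refine Tm.eqv_eval.2 fun s => ?_
    have h₁ := (hus i).sem_eq (fun ν a => s ν (π'⁻¹ ν a)) fun _ i => i.elim
    have h₂ := (sem₀_mapNom _ _ _).symm.trans (h₁.trans (sem₀_mapNom _ _ _))
    rw [NSig.comp_inv_comp] at h₂
    refine h₂.symm.trans ((sem_head _ θ (fun ν a => s ν (π₀ ν a)) (fun ν a => s ν (ϖ ν a))
      D.bnames ζ fun ν i => congrArg (s ν) (hϖζ ν i).symm).trans ?_)
    refine .trans ?_ (hrep.sem_trTm hc (D.args_closed i)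
      (fun a ha => D.args_closed i (Tm.mem_names_of_actsOnVar ha)) s)
    refine .trans (sem_congr _ fun c hc => ?_) (congrArg (sem _ _) (funext fun τ => funext fun x =>
      (sem₀_mapNom _ (θ τ x) s).symm))
    have hcD : c ∈ D.bnames := (noms_trTm (A := {a | a ∈ D.bnames}) (names_get _)
      (noms_raiseEnv _ _) _ hc).elim (fun h => D.args_closed i h) id
    rw [NSig.Env.mix_mem _ _ hcD, NSig.Env.mix_mem _ _ hcD]
  · rw [Goal.act_subst, hθ]
    refine ih π₀ hc.inj (Eq.mp (congrArg (fun F => Rep _ _ F _) ?_)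
      (rep_trGoal D.body hrep (hc.mono D.body_closed) fun a ha =>
        D.body_closed (Goal.mem_names_of_actsOnVar ha)))
    refine .trans (HFm.bind_congr _ fun c hc => ?_) (HFm.bind_bind _ _ _ _ _).symm
    obtain ⟨h, hn⟩ := noms_trGoal D.body D.bnames _ _ (names_get {a | a ∈ D.bnames})
      (noms_raiseEnv _ _) hc
    exact absurd (D.body_closed h) hn

/-- Goals with provable representations are provable. The statement is closed under permutations,
since a witness in the given proof may contain names that the representation reserves. -/
theorem HProv.nProv {Δ : Set (NClause S)} {F : HFm S.target []} (h : HProv (trProgram Δ) F) :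
    ∀ (π : S.NPerm) {as : List S.AnyName} {r : S.Env} {G : Goal S [] []},
      (∀ a ∈ as, ∀ b ∈ as, r.app a = r.app b → a = b) →
      Rep as r (HFm.mapNom (L := S.target) (fun ν => π ν) F) G → NProv Δ G := by
  induction h with
  | top =>
    intro π as r G hr hF
    refine hF.nProv_of_not_isNew hr fun {as r G} hr hF hG => ?_
    have hF : Rep as r .top G := hF
    cases hF with
    | top => exact .top
    | atom h => cases h with | base π' h => exact nomatch h
    | fresh h => cases h with | base π' h => exact nomatch h
    | eq h => cases h with | base π' h => exact nomatch h
    | new => exact absurd trivial hG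
  | @eq τ t u h =>
    intro π as r G hr hF
    refine hF.nProv_of_not_isNew hr fun {as r G} hr hF hG => ?_
    have hF : Rep as r (.eq (HTm.mapNom (L := S.target) (fun ν => π ν) t)
      (HTm.mapNom (L := S.target) (fun ν => π ν) u)) G := hF
    cases hF with
    | atom h => cases h with | base π' h => exact nomatch h
    | fresh h => cases h with | base π' h => exact nomatch h
    | @eq _ _ _ τ' t' u' h =>
      cases h with
      | base π' h' =>
        have h' : HFm.Conv _ (.eq (HTm.mapNom (L := S.target) (fun ν => π' ν) t'.toHTm)
          (HTm.mapNom (L := S.target) (fun ν => π' ν) u'.toHTm)) := h'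
        cases h' with
        | eq k k' =>
          refine .eq (Tm.eqv_eval.2 fun s => ?_)
          have := (k.symm.trans ((h.bind _ _).trans k')).sem_eq (fun ν a => s ν (π'⁻¹ ν a))
            fun _ i => i.elim
          have := (sem₀_mapNom _ _ _).symm.trans (this.trans (sem₀_mapNom _ _ _))
          rwa [NSig.comp_inv_comp] at this
    | new => exact absurd trivial hG
  | @and B C _ _ ihB ihC =>
    intro π as r G hr hF
    refine hF.nProv_of_not_isNew hr fun {as r G} hr hF hG => ?_
    have hF : Rep as r (.and (HFm.mapNom (L := S.target) (fun ν => π ν) B)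
      (HFm.mapNom (L := S.target) (fun ν => π ν) C)) G := hF
    cases hF with
    | atom h => cases h with | base π' h => exact nomatch h
    | fresh h => cases h with | base π' h => exact nomatch h
    | eq h => cases h with | base π' h => exact nomatch h
    | and k k' => exact .and (ihB π hr k) (ihC π hr k')
    | new => exact absurd trivial hG
  | @or_left B C _ ih =>
    intro π as r G hr hF
    refine hF.nProv_of_not_isNew hr fun {as r G} hr hF hG => ?_
    have hF : Rep as r (.or (HFm.mapNom (L := S.target) (fun ν => π ν) B)
      (HFm.mapNom (L := S.target) (fun ν => π ν) C)) G := hF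
    cases hF with
    | atom h => cases h with | base π' h => exact nomatch h
    | fresh h => cases h with | base π' h => exact nomatch h
    | eq h => cases h with | base π' h => exact nomatch h
    | or k k' => exact .or_left (ih π hr k)
    | new => exact absurd trivial hG
  | @or_right B C _ ih =>
    intro π as r G hr hF
    refine hF.nProv_of_not_isNew hr fun {as r G} hr hF hG => ?_
    have hF : Rep as r (.or (HFm.mapNom (L := S.target) (fun ν => π ν) B)
      (HFm.mapNom (L := S.target) (fun ν => π ν) C)) G := hF
    cases hF with
    | atom h => cases h with | base π' h => exact nomatch h
    | fresh h => cases h with | base π' h => exact nomatch h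
    | eq h => cases h with | base π' h => exact nomatch h
    | or k k' => exact .or_right (ih π hr k')
    | new => exact absurd trivial hG
  | @ex τ B u _ ih =>
    intro π as r G hr hF
    refine hF.nProv_of_not_isNew hr fun {as r G} hr hF hG => ?_
    have e := HFm.mapNom_ex (L := S.target) (fun ν => π ν) B
    simp only at e
    rw [e] at hF
    cases hF with
    | atom h => cases h with | base π' h => exact nomatch h
    | fresh h => cases h with | base π' h => exact nomatch h
    | eq h => cases h with | base π' h => exact nomatch h
    | new => exact absurd trivial hG
    | ex hB k =>
      obtain ⟨M, hM⟩ := (HFm.mapNom (L := S.target) (fun ν => π ν) B).exists_noms_subset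
      obtain ⟨N, hN⟩ := (HTm.mapNom (L := S.target) (fun ν => π ν) u).exists_noms_subset
      -- The witness may contain names `r(a⃗)`; `σ` moves them away and fixes `B` up to conversion.
      obtain ⟨σ, l, hσ, hl, hσN⟩ := NSig.exists_perm_avoiding M N (as.map r.app)
      have hu : HTm.mapNom (L := S.target) (fun ν => (σ * π) ν) u =
          HTm.mapNom (L := S.target) (fun ν => σ ν) (HTm.mapNom (L := S.target) (fun ν => π ν) u) :=
        (HTm.mapNom_mapNom (L := S.target) (fun ν => π ν) (fun ν => σ ν) u).symm
      have hB' : HFm.mapNom (L := S.target) (fun ν => (σ * π) ν) B =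
          HFm.mapNom (L := S.target) (fun ν => σ ν) (HFm.mapNom (L := S.target) (fun ν => π ν) B) :=
        (HFm.mapNom_mapNom (L := S.target) (fun ν => π ν) (fun ν => σ ν) B).symm
      obtain ⟨t, ht⟩ := exists_raises as r (HTm.mapNom (L := S.target) (fun ν => (σ * π) ν) u)
        fun a ha h => by
          rw [hu] at h
          obtain ⟨x, hx, hax⟩ := HTm.mem_noms_mapNom (L := S.target) (HTm.supp_subset_noms _ h)
          exact hσN x (hN x hx) (List.mem_map.2 ⟨a, ha, hax⟩)
      refine .ex t (ih (σ * π) hr ?_)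
      have e' := HFm.mapNom_inst (L := S.target) (fun ν => (σ * π) ν) B u
      simp only at e'
      rw [e']
      refine (k _ t ht).conv (HFm.Conv.inst ?_ _)
      rw [hB']
      refine (HFm.conv_mapNom (L := S.target) hσ _ fun c hc h => ?_).symm
      rcases hl c hc with hc | hc
      · obtain ⟨a, ha, rfl⟩ := List.mem_map.1 hc
        exact hB a ha h
      · exact hc (hM c (HFm.supp_subset_noms _ h))
  | @nabla ν B a ha _ ih =>
    intro π as r G hr hF
    refine hF.nProv_of_not_isNew hr fun {as r G} hr hF hG => ?_
    have e := HFm.mapNom_nabla (L := S.target) (ν := ν) (fun ν => π ν) B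
    simp only at e
    rw [e] at hF
    have e' := HFm.mapNom_inst (L := S.target) (fun ν => π ν) B (.nom a)
    simp only at e'
    have ha' := HFm.notMem_supp_mapNom (L := S.target) (fun ν => (π ν).injective) B ha
    refine ih π hr ?_
    rw [e']
    cases hF with
    | atom h =>
      cases h with
      | base π' h => exact nomatch h
      | nabla k => exact .atom (k _ ha')
    | fresh h =>
      cases h with
      | base π' h => exact nomatch h
      | nabla k => exact .fresh (k _ ha')
    | eq h =>
      cases h with
      | base π' h => exact nomatch h
      | nabla k => exact .eq (k _ ha')
    | new => exact absurd trivial hG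
  | defn D hD θ ζ hζ hsupp hts _ ih =>
    intro π as r G hr hF
    refine hF.nProv_of_not_isNew hr fun {as r G} hr hF hG => ?_
    rcases hD with ⟨D, hD, rfl⟩ | ⟨ν, τ, rfl⟩
    · have hF : Rep as r (.atom (L := S.target) (.inl D.pred) fun i =>
        HTm.mapNom (L := S.target) (fun ν => π ν) _) G := hF
      cases hF with
      | @atom _ _ _ p us h =>
        cases h with
        | base π' h =>
          have h : HFm.Conv _ (.atom (L := S.target) (.inl p) fun i =>
            HTm.mapNom (L := S.target) (fun ν => π' ν) (us i).toHTm) := h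
          cases h with
          | atom k =>
            exact .of_trClause hD θ ζ hζ hsupp (fun i => ((hts i).bind _ _).symm.trans (k i)) ih
      | fresh h => cases h with | base π' h => exact nomatch h
      | eq h => cases h with | base π' h => exact nomatch h
      | new => exact absurd trivial hG
    · have hF : Rep as r (.atom (L := S.target) (.inr (ν, τ)) fun i =>
        HTm.mapNom (L := S.target) (fun ν => π ν) _) G := hF
      cases hF with
      | atom h => cases h with | base π' h => exact nomatch h
      | eq h => cases h with | base π' h => exact nomatch h
      | new => exact absurd trivial hG
      | @fresh _ _ _ ν' τ' a t h =>
        cases h with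
        | base π' h =>
          have h : HFm.Conv _ (.atom (L := S.target) (.inr (ν', trTy τ')) fun i =>
            HTm.mapNom (L := S.target) (fun ν => π' ν) _) := h
          cases h with
          | atom k =>
            refine .fresh (Val.fresh_of_notMem_supp (π := π') ?_)
            have k₀ := ((hts (0 : Fin 2)).bind _ _).symm.trans (k (0 : Fin 2))
            have k₁ := ((hts (1 : Fin 2)).bind _ _).symm.trans (k (1 : Fin 2))
            have h₀ : π ν (ζ ν .z) = π' ν a.get := k₀.sem_eq (fun _ a => a) fun _ i => i.elim
            rw [← h₀]
            have := HTm.notMem_supp_mapNom (L := S.target) (fun ν => (π ν).injective)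
              (hsupp _ .z ν .z)
            exact fun h => this (HTm.Conv.mem_supp k₁.symm h)

/-- The translation of a ground goal represents it. -/
theorem rep_trGround (G : Goal S [] []) (as : List S.AnyName)
    (hG : ∀ a : S.AnyName, G.ActsOnVar a → a ∈ as) :
    Rep as (fun _ a => a) (trGround as G) G := by
  have hrep : RepEnv (S := S) as (fun _ (a : Nm S [] _) => a.get) (fun _ i => i.elim) (fun _ a => a)
      (fun _ (i : Ix [] _) => i.elim) (fun _ (i : Ix [] _) => i.elim) :=
    ⟨fun _ _ => rfl, fun _ i => i.elim, fun _ i => i.elim, fun _ _ _ i => i.elim, fun _ i => i.elim⟩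
  have hc : Compat as (fun _ (a : Nm S [] _) => a.get) (fun _ a => a) G.names := by
    refine ⟨fun _ _ _ _ h => h, fun ν n _ => ?_⟩
    by_cases h : (⟨ν, n.get⟩ : S.AnyName) ∈ as
    · exact .inl h
    · refine .inr ⟨rfl, fun h' => h ?_⟩
      obtain ⟨a, ha, h'⟩ := List.mem_map.1 h'
      exact h' ▸ ha
  have key := rep_trGoal G hrep hc hG
  have h₁ : (trGround as G).subst (fun _ (i : Ix [] _) => i.elim) = trGround as G := by
    refine .trans ?_ (trGround as G).bind_id
    exact congrArg (fun θ => (trGround as G).bind θ _) (funext fun _ => funext fun i => i.elim)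
  have h₂ : renNm (fun _ (a : Nm S [] _) => a.get) (fun _ a => a) = fun _ n => n := by
    funext ν n
    cases n with
    | free a => rfl
    | bound i => exact i.elim
  have h₃ : (fun τ (i : Ix [] τ) => i.elim : ∀ τ, Ix [] τ → Tm S [] [] τ) = fun _ i => .var i :=
    funext fun _ => funext fun i => i.elim
  rw [h₂, Goal.mapName_id, h₃, Goal.subst_var] at key
  exact h₁ ▸ key

end Soundness

end NomHO

theorem theorem2 (S : NomHO.NSig.{u}) (Δ : Set (NomHO.NClause S)) (G : NomHO.Goal S [] [])
    (as : List S.AnyName) (has : as.Nodup) (hG : ∀ a : S.AnyName, G.ActsOnVar a → a ∈ as) :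
    NomHO.NProv Δ G ↔ NomHO.HProv (NomHO.trProgram Δ) (NomHO.trGround as G) := by
  have hrep := NomHO.rep_trGround G as hG
  constructor
  · intro h
    refine h.hProv 1 (as := as) (r := fun _ a => a) ?_
    rwa [G.act_one]
  · intro h
    refine h.nProv 1 (as := as) (r := fun _ a => a) (fun _ _ _ _ h => h) ?_
    exact Eq.mpr (congrArg (fun F => NomHO.Rep as (fun _ a => a) F G)
      (NomHO.trGround as G).bind_id) hrep
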